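/- Let $K\ge 0$, let $\mu\in(0,\infty)^2$, let $\alpha_1,\dots,\alpha_K$ be $2\times 2$ matrices with entries $\alpha_{ijk}\ge 0$, and let $\beta_k=\mathrm{Dg}(\beta_{k1},\beta_{k2})$ with $\beta_{ki}>0$, where $\mathrm{Dg}(x)$ denotes the diagonal matrix with diagonal $x$. Let $N=(N_1,N_2)^\top$ be a bivariate multi-kernel exponential Hawkes process on $\mathbb R$ with these parameters, that is, a simple, locally finite bivariate point process without common events, adapted to a filtration $(\mathcal F_t)_{t\in\mathbb R}$, whose stochastic intensity with respect to that filtration is $$\lambda_t=\mu+\sum_{k=1}^K\lambda_k(t),\qquad \lambda_k(t)=\int_{(-\infty,t)}h_k(t-u)\,dN_u,\qquad h_k(t)_{ij}=\alpha_{ijk}e^{-\beta_{ki}t},$$ where the integrals converge almost surely. (The stochastic intensity property means that $\mathbb E\int C_t\,dN_i(t)=\mathbb E\int C_t\,\lambda_{t,i}\,dt$ for every nonnegative predictable process $C$ and $i=1,2$.) Let $N_t$ denote the vector of the numbers of events of the two types in $(0,t]$. Assume that the process is in steady state from time $0$ on: the law of $(\lambda_1(t),\dots,\lambda_K(t))$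 does not depend on $t\ge 0$. Then the matrix $I-\sum_{k}\beta_k^{-1}\alpha_k$ is invertible, the random variables $\lambda_t$, $\lambda_k(t)\lambda_t^\top$ and $\lambda_tN_t^\top$ are integrable for all $t\ge 0$ and all $k$, the moments $\mathbb E[\lambda_t]$ and $\mathbb E[\lambda_k(t)\lambda_t^\top]$ may be evaluated at any time $t\ge 0$ in the formulas $$A=\Bigl(I-\sum_{k=1}^K\beta_k^{-1}\alpha_k\Bigr)^{-1}\mu\,\mathbb E[\lambda_t^\top]=\mathbb E[\lambda_t]\,\mathbb E[\lambda_t^\top],$$ $$B=\Bigl(I-\sum_{k=1}^K\beta_k^{-1}\alpha_k\Bigr)^{-1}\sum_{k=1}^K\beta_k^{-1}\Bigl(-\beta_k^{-1}\alpha_kA+\mathbb E[\lambda_k(t)\lambda_t^\top]+\alpha_k\,\mathrm{Dg}(\mathbb E[\lambda_t])\Bigr),$$ and the cross moment is asymptotically affine in $t$: $$\mathbb E[\lambda_tN_t^\top]-(At+B)\longrightarrow 0\qquad\text{as } t\to\infty .$$ -/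

import Mathlib

open MeasureTheory ProbabilityTheory Filter Topology Set
open scoped ENNReal Matrix

noncomputable section

namespace MultiKernelHawkes

/-- Parameters of a bivariate Hawkes model with `K` exponential kernels: the baseline `μ`, the
matrices `α k`, and the decay rates `β k i` (the rate depends only on the kernel and on the row). -/
structure Params (K : ℕ) where
  μ : Fin 2 → ℝ
  α : Fin K → Matrix (Fin 2) (Fin 2) ℝ
  β : Fin K → Fin 2 → ℝ

/-- The diagonal matrix `β_k`. -/
def Params.βMat {K : ℕ} (θ : Params K) (k : Fin K) : Matrix (Fin 2) (Fin 2) ℝ :=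
  Matrix.diagonal (θ.β k)

/-- The matrix `∑ k, β_k⁻¹ α_k`. -/
def Params.branching {K : ℕ} (θ : Params K) : Matrix (Fin 2) (Fin 2) ℝ :=
  ∑ k, (θ.βMat k)⁻¹ * θ.α k

/-- The `k`-th kernel `h_k(t)`, with entries `α_{ijk} exp (-β_{ki} t)`. -/
def Params.kernel {K : ℕ} (θ : Params K) (k : Fin K) (t : ℝ) : Matrix (Fin 2) (Fin 2) ℝ :=
  Matrix.of fun i j => θ.α k i j * Real.exp (-θ.β k i * t)

variable {Ω : Type*} {mΩ : MeasurableSpace Ω}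

/-- A bivariate simple point process on the whole real line, adapted to the filtration `ℱ`:
`S i ω` is the set of event times of type `i`. It is locally finite, the number of events in
`(a, b]` is known at time `b`, and almost surely no two events of different types coincide. -/
structure IsPointProcess (P : Measure Ω) (ℱ : Filtration ℝ mΩ) (S : Fin 2 → Ω → Set ℝ) :
    Prop where
  locallyFinite : ∀ i ω a b, (S i ω ∩ Icc a b).Finite
  adapted : ∀ i a b, Measurable[ℱ b] fun ω => (S i ω ∩ Ioc a b).ncard
  noCommonEvents : ∀ᵐ ω ∂P, Disjoint (S 0 ω) (S 1 ω)

/-- The random measure `dN_i`, the counting measure of the event times of type `i`. -/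
def eventMeasure (S : Fin 2 → Ω → Set ℝ) (i : Fin 2) (ω : Ω) : Measure ℝ :=
  Measure.count.restrict (S i ω)

/-- The counting process `N_i(t)`: the number of events of type `i` in `(0, t]`. -/
def N (S : Fin 2 → Ω → Set ℝ) (t : ℝ) (ω : Ω) (i : Fin 2) : ℝ :=
  (S i ω ∩ Ioc 0 t).ncard

/-- The component `λ_k(t) = ∫_{(-∞, t)} h_k(t - u) dN_u` of the intensity. -/
def component {K : ℕ} (θ : Params K) (S : Fin 2 → Ω → Set ℝ) (k : Fin K) (t : ℝ) (ω : Ω)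
    (i : Fin 2) : ℝ :=
  ∑ j, ∫ u in Iio t, θ.kernel k (t - u) i j ∂(eventMeasure S j ω)

/-- The intensity `λ_t = μ + ∑ k, λ_k(t)`. -/
def intensity {K : ℕ} (θ : Params K) (S : Fin 2 → Ω → Set ℝ) (t : ℝ) (ω : Ω) (i : Fin 2) : ℝ :=
  θ.μ i + ∑ k, component θ S k t ω i

/-- The predictable σ-algebra on `ℝ × Ω`, generated by the sets `(s, ∞) × A` with `A ∈ ℱ s`. -/
@[reducible]
def predictable (ℱ : Filtration ℝ mΩ) : MeasurableSpace (ℝ × Ω) :=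
  MeasurableSpace.generateFrom {B | ∃ s A, MeasurableSet[ℱ s] A ∧ B = Ioi s ×ˢ A}

/-- `S` is a Hawkes process with parameters `θ`: the integrals that define its intensity converge
almost surely, and `intensity θ S` is its stochastic intensity with respect to `ℱ`, that is,
`E ∫ C_t dN_i(t) = E ∫ C_t λ_i(t) dt` for every predictable `C ≥ 0`. -/
structure IsHawkes {K : ℕ} (θ : Params K) (P : Measure Ω) (ℱ : Filtration ℝ mΩ)
    (S : Fin 2 → Ω → Set ℝ) : Prop where
  pointProcess : IsPointProcess P ℱ S
  convergent : ∀ᵐ ω ∂P, ∀ k i j t,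
    IntegrableOn (fun u => θ.kernel k (t - u) i j) (Iio t) (eventMeasure S j ω)
  stochasticIntensity : ∀ (i : Fin 2) (C : ℝ × Ω → ℝ≥0∞), Measurable[predictable ℱ] C →
    ∫⁻ ω, ∫⁻ t, C (t, ω) ∂(eventMeasure S i ω) ∂P =
      ∫⁻ ω, ∫⁻ t, C (t, ω) * ENNReal.ofReal (intensity θ S t ω i) ∂volume ∂P

/-- Steady state from time `0` on: the law of `Λ_t = (λ_1(t), …, λ_K(t))` does not depend on
`t ≥ 0`. -/
def IsSteadyState {K : ℕ} (θ : Params K) (P : Measure Ω) (S : Fin 2 → Ω → Set ℝ) : Prop :=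
  ∀ t, 0 ≤ t → IdentDistrib (fun ω k i => component θ S k t ω i)
    (fun ω k i => component θ S k 0 ω i) P P

/-- `E[λ_t]`. -/
def meanIntensity {K : ℕ} (θ : Params K) (P : Measure Ω) (S : Fin 2 → Ω → Set ℝ) (t : ℝ) :
    Fin 2 → ℝ :=
  fun i => ∫ ω, intensity θ S t ω i ∂P

/-- `E[λ_k(t) λ_tᵀ]`. -/
def componentMoment {K : ℕ} (θ : Params K) (P : Measure Ω) (S : Fin 2 → Ω → Set ℝ) (k : Fin K)
    (t : ℝ) : Matrix (Fin 2) (Fin 2) ℝ :=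
  Matrix.of fun i j => ∫ ω, component θ S k t ω i * intensity θ S t ω j ∂P

/-- `E[λ_t N_tᵀ]`. -/
def crossMoment {K : ℕ} (θ : Params K) (P : Measure Ω) (S : Fin 2 → Ω → Set ℝ) (t : ℝ) :
    Matrix (Fin 2) (Fin 2) ℝ :=
  Matrix.of fun i j => ∫ ω, intensity θ S t ω i * N S t ω j ∂P

/-- `A = E[λ_s] E[λ_sᵀ]`, with the expectations taken at time `s`. -/
def slopeMat {K : ℕ} (θ : Params K) (P : Measure Ω) (S : Fin 2 → Ω → Set ℝ) (s : ℝ) :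
    Matrix (Fin 2) (Fin 2) ℝ :=
  Matrix.vecMulVec (meanIntensity θ P S s) (meanIntensity θ P S s)

/-- `B = (I - ∑ β_k⁻¹ α_k)⁻¹ ∑ β_k⁻¹ (-β_k⁻¹ α_k A + E[λ_k(s) λ_sᵀ] + α_k Dg(E[λ_s]))`, with the
expectations taken at time `s`. -/
def offsetMat {K : ℕ} (θ : Params K) (P : Measure Ω) (S : Fin 2 → Ω → Set ℝ) (s : ℝ) :
    Matrix (Fin 2) (Fin 2) ℝ :=
  (1 - θ.branching)⁻¹ * ∑ k, (θ.βMat k)⁻¹ *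
    (-((θ.βMat k)⁻¹ * θ.α k * slopeMat θ P S s) + componentMoment θ P S k s +
      θ.α k * Matrix.diagonal (meanIntensity θ P S s))

end MultiKernelHawkes

end

noncomputable section

namespace MultiKernelHawkes

/-! ### Counting measures of locally finite subsets of the line -/

/-! Write G for the branching matrix `θ.branching`, x for the vector of the components λ_k, and m =
E[λ]. No moment is assumed finite, so everything starts from a bounded functional. For v ≥ 0 put V =
∑ v_i x_{ki} / β_{ki} (`potential`) and T_v = ∑ v_i x_{ki} (`total`). Between events V has
derivative -T_v, and an event of type j raises it by w_j, where w = vG. Applying this to exp(-sV),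
taking expectations through the stochastic intensity and cancelling by stationarity gives
`IsHawkes.laplaceIdentity`: ∑_j E[exp(-sV) (1 - exp(-s w_j)) λ_j] = s E[exp(-sV) T_v] for s > 0.

Its expansion as s → 0 is used three times, always with ∑ v_j λ_j = v·μ + T_v. If the spectral
radius of G were at least one, some nonzero v ≥ 0 would satisfy v ≤ vG, and the limit would give v·μ
≤ 0, which is absurd since μ > 0 (`LaplaceIdentity.subcritical`). So some v > 0 has w < v; the first
order then bounds E[T_{v-w}] and the second order bounds E[V T_{v-w}], whence finite first and
second moments (`LaplaceIdentity.integrable`, `LaplaceIdentity.integrable_mul`). The counting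
process inherits finite second moments by a truncation and absorption argument
(`IsHawkes.lintegral_countBefore_sq_le`).

Integration by parts for λ_k(t) N_j(t), followed by expectation, closes on the cross moments Z_l(t)
= E[λ_l(t) N_j(t)] with j fixed (`IsHawkes.crossE_toReal_eq`): Z_i(t) = μ_i m_j t + ∑_k ∫_0^t
exp(-β_{ki}(t - v)) (q_{ki} + ∑_l α_{ilk} Z_l(v)) dv, with q_{ki} = E[λ_{k,i} λ_j] + α_{ijk} m_j.
The matrices A and B are exactly those for which At + B solves this system up to terms exp(-β_{ki}
t). The difference solves a homogeneous system with exponentially small forcing, and subcriticality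
makes the convolution a contraction in an exponentially weighted sup norm, so the difference tends
to zero (`Subcritical.tendsto_zero_of_renewal`). -/

lemma countable_of_finite_inter_Icc {T : Set ℝ} (hT : ∀ a b, (T ∩ Icc a b).Finite) :
    T.Countable := by
  have h : T = ⋃ n : ℕ, T ∩ Icc (-(n : ℝ)) n := by
    ext x
    simp only [mem_iUnion, mem_inter_iff, mem_Icc, exists_and_left, iff_self_and]
    intro _
    obtain ⟨n, hn⟩ := exists_nat_ge |x|
    exact ⟨n, abs_le.1 hn⟩
  rw [h]
  exact countable_iUnion fun n => (hT _ _).countable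

lemma count_restrict_apply {T B : Set ℝ} (hB : MeasurableSet B) (hTB : (T ∩ B).Finite) :
    Measure.count.restrict T B = ((T ∩ B).ncard : ℝ≥0∞) := by
  rw [Measure.restrict_apply hB, inter_comm,
    Measure.count_apply_finite' hTB hTB.measurableSet, ncard_eq_toFinset_card _ hTB]

lemma isFiniteMeasure_count_restrict {T B : Set ℝ} (hB : MeasurableSet B)
    (hTB : (T ∩ B).Finite) : IsFiniteMeasure ((Measure.count.restrict T).restrict B) := by
  refine ⟨?_⟩
  rw [Measure.restrict_apply MeasurableSet.univ, univ_inter, count_restrict_apply hB hTB]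
  exact ENNReal.natCast_lt_top _

lemma lintegral_count_restrict_of_inter_eq_empty {T B : Set ℝ} (hB : MeasurableSet B)
    (hTB : T ∩ B = ∅) (f : ℝ → ℝ≥0∞) : ∫⁻ u in B, f u ∂(Measure.count.restrict T) = 0 := by
  have : (Measure.count.restrict T).restrict B = 0 := by
    rw [Measure.restrict_eq_zero, count_restrict_apply hB (by simp [hTB]), hTB]
    simp
  rw [this, lintegral_zero_measure]

lemma lintegral_count_restrict_singleton (T : Set ℝ) (a : ℝ) (f : ℝ → ℝ≥0∞) :
    ∫⁻ u in {a}, f u ∂(Measure.count.restrict T) = T.indicator f a := by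
  rw [Measure.restrict_singleton, lintegral_smul_measure, lintegral_dirac, smul_eq_mul,
    count_restrict_apply (measurableSet_singleton a) ((finite_singleton a).inter_of_right T)]
  by_cases ha : a ∈ T
  · simp [ha, inter_eq_right.2 (singleton_subset_iff.2 ha)]
  · simp [ha, inter_singleton_eq_empty.2 ha]

/-- Intervals are closed on the left because λ_t only sees events strictly before t: an event at a
influences (a, b], so its effect is booked on [a, b). -/
lemma lintegral_count_restrict_Ico {T : Set ℝ} {a b : ℝ} (hab : a < b)
    (hT : T ∩ Ioo a b = ∅) (f : ℝ → ℝ≥0∞) :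
    ∫⁻ u in Ico a b, f u ∂(Measure.count.restrict T) = T.indicator f a := by
  rw [← Ioo_insert_left hab, insert_eq, lintegral_union measurableSet_Ioo (by simp),
    lintegral_count_restrict_of_inter_eq_empty measurableSet_Ioo hT,
    lintegral_count_restrict_singleton, add_zero]

lemma lintegral_Ico_add_Ico (ν : Measure ℝ) {a b c : ℝ} (hab : a ≤ b) (hbc : b ≤ c)
    (f : ℝ → ℝ≥0∞) :
    ∫⁻ u in Ico a b, f u ∂ν + ∫⁻ u in Ico b c, f u ∂ν = ∫⁻ u in Ico a c, f u ∂ν := by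
  rw [← Ico_union_Ico_eq_Ico hab hbc, lintegral_union measurableSet_Ico (Ico_disjoint_Ico_same)]

/-- A relation between times that is transitive and holds across the gaps of a locally finite set
holds for all pairs of times. -/
lemma rel_of_gap {T : Set ℝ} (hT : ∀ a b, (T ∩ Icc a b).Finite) {R : ℝ → ℝ → Prop}
    (hgap : ∀ a b, a < b → T ∩ Ioo a b = ∅ → R a b)
    (htrans : ∀ a b c, a < b → b < c → R a b → R b c → R a c) {a b : ℝ} (hab : a < b) :
    R a b := by
  have hfin : ∀ a b, (T ∩ Ioo a b).Finite := fun a b =>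
    (hT a b).subset (inter_subset_inter_right _ Ioo_subset_Icc_self)
  -- Induction on the number of points strictly inside: an interior point c lies in neither open
  -- subinterval, so both counts drop.
  induction hn : (T ∩ Ioo a b).ncard using Nat.strong_induction_on generalizing a b with
  | _ n ih =>
    rcases eq_empty_or_nonempty (T ∩ Ioo a b) with h | ⟨c, hcT, hac, hcb⟩
    · exact hgap a b hab h
    · refine htrans a c b hac hcb (ih _ ?_ hac rfl) (ih _ ?_ hcb rfl)
      · rw [← hn]
        refine ncard_lt_ncard ⟨inter_subset_inter_right _ (Ioo_subset_Ioo_right hcb.le),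
          fun h => ?_⟩ (hfin a b)
        exact lt_irrefl c (h ⟨hcT, hac, hcb⟩).2.2
      · rw [← hn]
        refine ncard_lt_ncard ⟨inter_subset_inter_right _ (Ioo_subset_Ioo_left hac.le),
          fun h => ?_⟩ (hfin a b)
        exact lt_irrefl c (h ⟨hcT, hac, hcb⟩).2.1

/-! ### Predictable processes -/

variable {Ω : Type*} {mΩ : MeasurableSpace Ω}

lemma measurable_predictable_fst (ℱ : Filtration ℝ mΩ) :
    Measurable[predictable ℱ] (Prod.fst : ℝ × Ω → ℝ) := by
  refine measurable_of_Ioi fun s => ?_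
  refine MeasurableSpace.measurableSet_generateFrom ⟨s, univ, MeasurableSet.univ, ?_⟩
  ext; simp

lemma predictable_le (ℱ : Filtration ℝ mΩ) : predictable ℱ ≤ Prod.instMeasurableSpace := by
  refine MeasurableSpace.generateFrom_le ?_
  rintro _ ⟨s, A, hA, rfl⟩
  exact measurableSet_Ioi.prod (ℱ.le s A hA)

/-- These are the elementary predictable processes: a value known at time s, switched on strictly
after s. The other predictable processes of the file are built from them by countable suprema,
products and integrals. -/
lemma measurable_predictable_indicator (ℱ : Filtration ℝ mΩ) (s : ℝ) {f : Ω → ℝ≥0∞}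
    (hf : Measurable[ℱ s] f) :
    Measurable[predictable ℱ] fun p : ℝ × Ω => (Ioi s).indicator (fun _ => f p.2) p.1 := by
  intro B hB
  have h : (fun p : ℝ × Ω => (Ioi s).indicator (fun _ => f p.2) p.1) ⁻¹' B =
      (Ioi s ×ˢ (f ⁻¹' B)) ∪ ((Prod.fst ⁻¹' (Ioi s)ᶜ) ∩ {_p | (0 : ℝ≥0∞) ∈ B}) := by
    ext p
    by_cases hp : p.1 ∈ Ioi s
    · have hp' : s < p.1 := hp
      simp [hp']
    · have hp' : ¬ s < p.1 := hp
      simp [hp', not_lt.1 hp']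
  rw [h]
  refine @MeasurableSet.union _ (predictable ℱ) _ _ ?_ ?_
  · exact MeasurableSpace.measurableSet_generateFrom ⟨s, _, hf hB, rfl⟩
  · refine @MeasurableSet.inter _ (predictable ℱ) _ _ ?_ ?_
    · exact measurable_predictable_fst ℱ measurableSet_Ioi.compl
    · exact @MeasurableSet.const _ (predictable ℱ) _

section PointProcess

variable {P : Measure Ω} {ℱ : Filtration ℝ mΩ} {S : Fin 2 → Ω → Set ℝ}

lemma IsPointProcess.finite_inter (hS : IsPointProcess P ℱ S) (i : Fin 2) (ω : Ω) {B : Set ℝ}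
    {a b : ℝ} (hB : B ⊆ Icc a b) : (S i ω ∩ B).Finite :=
  (hS.locallyFinite i ω a b).subset (inter_subset_inter_right _ hB)

/-- The strict past of t is the increasing union, over rational q < t, of the past up to q, which is
known at time q. Rationals keep the supremum countable. -/
lemma IsPointProcess.measurable_eventMeasure_Ioc (hS : IsPointProcess P ℱ S) (i : Fin 2)
    (a b : ℝ) : Measurable[predictable ℱ]
      fun p : ℝ × Ω => eventMeasure S i p.2 (Ioc a b ∩ Iio p.1) := by
  have h : (fun p : ℝ × Ω => eventMeasure S i p.2 (Ioc a b ∩ Iio p.1)) = fun p =>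
      ⨆ q : ℚ, (Ioi (q : ℝ)).indicator (fun _ => eventMeasure S i p.2 (Ioc a (min b q))) p.1 := by
    ext p
    have hU : Ioc a b ∩ Iio p.1 = ⋃ q : {q : ℚ // (q : ℝ) < p.1}, Ioc a (min b q) := by
      ext x
      simp only [mem_inter_iff, mem_Ioc, mem_Iio, mem_iUnion, le_min_iff, Subtype.exists]
      constructor
      · rintro ⟨⟨h1, h2⟩, h3⟩
        obtain ⟨q, hq, hq'⟩ := exists_rat_btwn h3
        exact ⟨q, hq', h1, h2, hq.le⟩
      · rintro ⟨q, hq, h1, h2, h3⟩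
        exact ⟨⟨h1, h2⟩, h3.trans_lt hq⟩
    rw [hU, Directed.measure_iUnion]
    · refine le_antisymm (iSup_le fun q => ?_) (iSup_le fun q => ?_)
      · refine le_iSup_of_le (q : ℚ) ?_
        rw [indicator_of_mem (show p.1 ∈ Ioi _ from q.2)]
      · by_cases hq : (q : ℝ) < p.1
        · rw [indicator_of_mem (show p.1 ∈ Ioi _ from hq)]
          exact le_iSup_of_le (⟨q, hq⟩ : {q : ℚ // (q : ℝ) < p.1}) le_rfl
        · rw [indicator_of_notMem (show p.1 ∉ Ioi _ from hq)]
          exact zero_le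
    · refine Monotone.directed_le fun q r hqr => ?_
      refine Ioc_subset_Ioc_right (min_le_min_left _ ?_)
      exact_mod_cast hqr
  rw [h]
  refine Measurable.iSup fun q => ?_
  refine measurable_predictable_indicator ℱ q
    (f := fun ω => eventMeasure S i ω (Ioc a (min b q))) ?_
  have h2 : (fun ω => eventMeasure S i ω (Ioc a (min b q))) =
      fun ω => (((S i ω ∩ Ioc a (min b q)).ncard : ℕ) : ℝ≥0∞) := by
    ext ω
    exact count_restrict_apply measurableSet_Ioc (hS.finite_inter i ω Ioc_subset_Icc_self)
  rw [h2]
  have h3 : Measurable[ℱ q] fun ω => (S i ω ∩ Ioc a (min b q)).ncard :=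
    (hS.adapted i a (min b q)).mono (ℱ.mono (min_le_right _ _)) le_rfl
  exact (measurable_from_top (f := fun n : ℕ => (n : ℝ≥0∞))).comp h3

/-- Integrals of deterministic functions against the past of the process are predictable. -/
lemma IsPointProcess.measurable_lintegral_Iio (hS : IsPointProcess P ℱ S) (i : Fin 2)
    {g : ℝ → ℝ≥0∞} (hg : Measurable g) : Measurable[predictable ℱ]
      fun p : ℝ × Ω => ∫⁻ u in Iio p.1, g u ∂(eventMeasure S i p.2) := by
  -- The windows (-n, n] make the measures finite, so their measurability can be tested on the
  -- π-system of half-lines; monotone convergence then removes the window.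
  have hfin : ∀ (n : ℕ) (p : ℝ × Ω), IsFiniteMeasure
      ((eventMeasure S i p.2).restrict (Ioc (-(n : ℝ)) n ∩ Iio p.1)) := fun n p =>
    isFiniteMeasure_count_restrict (measurableSet_Ioc.inter measurableSet_Iio)
      (hS.finite_inter i p.2 (inter_subset_left.trans Ioc_subset_Icc_self))
  have hm : ∀ n : ℕ, Measurable[predictable ℱ] fun p : ℝ × Ω =>
      (eventMeasure S i p.2).restrict (Ioc (-(n : ℝ)) n ∩ Iio p.1) := by
    intro n
    refine @Measurable.measure_of_isPiSystem (ℝ × Ω) ℝ (predictable ℱ) _ _ (hfin n) _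
      (borel_eq_generateFrom_Iic ℝ) isPiSystem_Iic ?_ ?_
    · rintro _ ⟨b, rfl⟩
      have := hS.measurable_eventMeasure_Ioc i (-(n : ℝ)) (min n b)
      convert this using 2 with p
      rw [Measure.restrict_apply measurableSet_Iic, ← Ioc_inter_Iic]
      congr 1
      ext x
      simp only [mem_inter_iff]
      tauto
    · convert hS.measurable_eventMeasure_Ioc i (-(n : ℝ)) n using 2 with p
      rw [Measure.restrict_apply MeasurableSet.univ, univ_inter]
  have h : (fun p : ℝ × Ω => ∫⁻ u in Iio p.1, g u ∂(eventMeasure S i p.2)) = fun p =>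
      ⨆ n : ℕ, ∫⁻ u, g u ∂((eventMeasure S i p.2).restrict (Ioc (-(n : ℝ)) n ∩ Iio p.1)) := by
    ext p
    rw [← setLIntegral_iUnion_of_directed]
    · congr 2
      ext x
      simp only [mem_Iio, mem_iUnion, mem_inter_iff, mem_Ioc, exists_and_right, iff_and_self]
      intro _
      obtain ⟨n, hn⟩ := exists_nat_gt |x|
      exact ⟨n, (abs_lt.1 hn).1, (abs_lt.1 hn).2.le⟩
    · refine Monotone.directed_le fun m n hmn => inter_subset_inter_left _ ?_
      have : (m : ℝ) ≤ n := by exact_mod_cast hmn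
      exact Ioc_subset_Ioc (by linarith) this
  rw [h]
  refine Measurable.iSup fun n => ?_
  exact (Measure.measurable_lintegral hg).comp (hm n)

/-- The number of events of type `i` in `[0, t)`, the left-continuous version of `N`. -/
def countBefore (S : Fin 2 → Ω → Set ℝ) (i : Fin 2) (t : ℝ) (ω : Ω) : ℝ≥0∞ :=
  eventMeasure S i ω (Ico 0 t)

lemma IsPointProcess.measurable_countBefore (hS : IsPointProcess P ℱ S) (i : Fin 2) :
    Measurable[predictable ℱ] fun p : ℝ × Ω => countBefore S i p.1 p.2 := by
  convert hS.measurable_lintegral_Iio i (g := (Ici 0).indicator 1)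
    (measurable_one.indicator measurableSet_Ici) using 2 with p
  rw [lintegral_indicator_one measurableSet_Ici, Measure.restrict_apply measurableSet_Ici,
    Ici_inter_Iio, countBefore]

end PointProcess

/-! ### The components of the intensity -/

section Components

variable {K : ℕ} {θ : Params K} {S : Fin 2 → Ω → Set ℝ}

/-- The component `λ_k(t)` of the intensity as an integral with values in `[0, ∞]`. -/
def componentE (θ : Params K) (S : Fin 2 → Ω → Set ℝ) (k : Fin K) (t : ℝ) (ω : Ω)
    (i : Fin 2) : ℝ≥0∞ :=
  ∑ j, ∫⁻ u in Iio t, ENNReal.ofReal (θ.kernel k (t - u) i j) ∂(eventMeasure S j ω)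

/-- The outcomes for which the intensity is finite at all times and there are no common events. -/
structure Regular (θ : Params K) (S : Fin 2 → Ω → Set ℝ) (ω : Ω) : Prop where
  integrableOn : ∀ k i j t,
    IntegrableOn (fun u => θ.kernel k (t - u) i j) (Iio t) (eventMeasure S j ω)
  disjoint : Disjoint (S 0 ω) (S 1 ω)

lemma IsHawkes.ae_regular {P : Measure Ω} {ℱ : Filtration ℝ mΩ} (hS : IsHawkes θ P ℱ S) :
    ∀ᵐ ω ∂P, Regular θ S ω := by
  filter_upwards [hS.convergent, hS.pointProcess.noCommonEvents] with ω h1 h2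
  exact ⟨h1, h2⟩

lemma kernel_apply (k : Fin K) (t : ℝ) (i j : Fin 2) :
    θ.kernel k t i j = θ.α k i j * Real.exp (-θ.β k i * t) := rfl

lemma kernel_nonneg (hα : ∀ k i j, 0 ≤ θ.α k i j) (k : Fin K) (t : ℝ) (i j : Fin 2) :
    0 ≤ θ.kernel k t i j :=
  mul_nonneg (hα k i j) (Real.exp_pos _).le

/-- The decay factor depends on k and the row i only, not on the source j. Hence a whole component
decays by one factor, and (λ_1, …, λ_K) can be updated without the earlier history. -/
lemma ofReal_kernel_add (k : Fin K) (s t : ℝ) (i j : Fin 2) :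
    ENNReal.ofReal (θ.kernel k (s + t) i j) =
      ENNReal.ofReal (Real.exp (-θ.β k i * s)) * ENNReal.ofReal (θ.kernel k t i j) := by
  rw [← ENNReal.ofReal_mul (Real.exp_pos _).le, kernel_apply, kernel_apply, mul_add, Real.exp_add]
  congr 1
  ring

lemma continuous_kernel (k : Fin K) (i j : Fin 2) :
    Continuous fun t => θ.kernel k t i j := by
  simp only [kernel_apply]
  fun_prop

lemma measurable_kernel (k : Fin K) (i j : Fin 2) :
    Measurable fun t => θ.kernel k t i j :=
  (continuous_kernel k i j).measurable

/-- No convergence is needed: if the integral diverges, the Bochner integral and `toReal` of ∞ are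
both 0. Measurability therefore holds without an exceptional set. -/
lemma setIntegral_kernel (hα : ∀ k i j, 0 ≤ θ.α k i j) (k : Fin K) (t : ℝ) (i j : Fin 2)
    (ω : Ω) : ∫ u in Iio t, θ.kernel k (t - u) i j ∂(eventMeasure S j ω) =
      (∫⁻ u in Iio t, ENNReal.ofReal (θ.kernel k (t - u) i j) ∂(eventMeasure S j ω)).toReal :=
  integral_eq_lintegral_of_nonneg_ae (ae_of_all _ fun _ => kernel_nonneg hα _ _ _ _)
    ((continuous_kernel k i j).comp (continuous_const.sub continuous_id)).aestronglyMeasurable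

lemma component_nonneg (hα : ∀ k i j, 0 ≤ θ.α k i j) (k : Fin K) (t : ℝ) (ω : Ω) (i : Fin 2) :
    0 ≤ component θ S k t ω i :=
  Finset.sum_nonneg fun _ _ => integral_nonneg fun _ => kernel_nonneg hα _ _ _ _

/-- Here convergence matters: a divergent component has the default real value 0, while its
counterpart in [0, ∞] is infinite. -/
lemma Regular.ofReal_component {ω : Ω} (hω : Regular θ S ω) (hα : ∀ k i j, 0 ≤ θ.α k i j)
    (k : Fin K) (t : ℝ) (i : Fin 2) :
    ENNReal.ofReal (component θ S k t ω i) = componentE θ S k t ω i := by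
  rw [component, ENNReal.ofReal_sum_of_nonneg
    fun _ _ => integral_nonneg fun _ => kernel_nonneg hα _ _ _ _]
  refine Finset.sum_congr rfl fun j _ => ?_
  exact ofReal_integral_eq_lintegral_ofReal (hω.integrableOn k i j t)
    (ae_of_all _ fun _ => kernel_nonneg hα _ _ _ _)

lemma intensity_pos (hμ : ∀ i, 0 < θ.μ i) (hα : ∀ k i j, 0 ≤ θ.α k i j) (t : ℝ) (ω : Ω)
    (i : Fin 2) : 0 < intensity θ S t ω i :=
  add_pos_of_pos_of_nonneg (hμ i) (Finset.sum_nonneg fun _ _ => component_nonneg hα _ _ _ _)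

/-- The components decay exponentially between events. -/
lemma componentE_eq_add (k : Fin K) {a b : ℝ} (hab : a ≤ b) (ω : Ω) (i : Fin 2) :
    componentE θ S k b ω i =
      ENNReal.ofReal (Real.exp (-θ.β k i * (b - a))) * componentE θ S k a ω i +
      ∑ j, ∫⁻ u in Ico a b, ENNReal.ofReal (θ.kernel k (b - u) i j) ∂(eventMeasure S j ω) := by
  rw [componentE, componentE, Finset.mul_sum, ← Finset.sum_add_distrib]
  refine Finset.sum_congr rfl fun j _ => ?_
  have hm : Measurable fun u => ENNReal.ofReal (θ.kernel k (a - u) i j) :=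
    ((measurable_kernel k i j).comp (measurable_const.sub measurable_id)).ennreal_ofReal
  rw [← lintegral_const_mul _ hm, ← Iio_union_Ico_eq_Iio hab,
    lintegral_union measurableSet_Ico (by
      rw [Set.disjoint_left]; intro x hx hx'; exact absurd hx (not_lt.2 hx'.1))]
  congr 1
  refine lintegral_congr fun u => ?_
  rw [← ofReal_kernel_add, sub_add_sub_cancel]

end Components

/-! ### Predictability of the intensity and expectations of integrals against events -/

section Hawkes

variable {P : Measure Ω} {ℱ : Filtration ℝ mΩ} {K : ℕ} {θ : Params K} {S : Fin 2 → Ω → Set ℝ}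

lemma IsPointProcess.measurable_lintegral_kernel (hS : IsPointProcess P ℱ S) (k : Fin K)
    (i j : Fin 2) : Measurable[predictable ℱ] fun p : ℝ × Ω =>
      ∫⁻ u in Iio p.1, ENNReal.ofReal (θ.kernel k (p.1 - u) i j) ∂(eventMeasure S j p.2) := by
  have hm : Measurable fun u => ENNReal.ofReal (θ.kernel k (-u) i j) :=
    ((measurable_kernel k i j).comp measurable_neg).ennreal_ofReal
  -- Taking exp(-β t) out leaves an integrand that does not depend on t, so the result on
  -- deterministic integrands applies.
  have h : (fun p : ℝ × Ω =>
      ∫⁻ u in Iio p.1, ENNReal.ofReal (θ.kernel k (p.1 - u) i j) ∂(eventMeasure S j p.2)) =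
      fun p => ENNReal.ofReal (Real.exp (-θ.β k i * p.1)) *
        ∫⁻ u in Iio p.1, ENNReal.ofReal (θ.kernel k (-u) i j) ∂(eventMeasure S j p.2) := by
    ext p
    rw [← lintegral_const_mul _ hm]
    refine lintegral_congr fun u => ?_
    rw [← ofReal_kernel_add, sub_eq_add_neg]
  rw [h]
  have h1 : Measurable fun t : ℝ => ENNReal.ofReal (Real.exp (-θ.β k i * t)) := by fun_prop
  exact (h1.comp (measurable_predictable_fst ℱ)).mul (hS.measurable_lintegral_Iio j hm)

lemma IsPointProcess.measurable_componentE (hS : IsPointProcess P ℱ S) (k : Fin K) (i : Fin 2) :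
    Measurable[predictable ℱ] fun p : ℝ × Ω => componentE θ S k p.1 p.2 i :=
  Finset.measurable_sum _ fun j _ => hS.measurable_lintegral_kernel k i j

lemma IsPointProcess.measurable_component (hS : IsPointProcess P ℱ S)
    (hα : ∀ k i j, 0 ≤ θ.α k i j) (k : Fin K) (i : Fin 2) :
    Measurable[predictable ℱ] fun p : ℝ × Ω => component θ S k p.1 p.2 i := by
  simp only [component, setIntegral_kernel hα]
  exact Finset.measurable_sum _ fun j _ => (hS.measurable_lintegral_kernel k i j).ennreal_toReal

lemma IsPointProcess.measurable_intensity (hS : IsPointProcess P ℱ S)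
    (hα : ∀ k i j, 0 ≤ θ.α k i j) (i : Fin 2) :
    Measurable[predictable ℱ] fun p : ℝ × Ω => intensity θ S p.1 p.2 i :=
  (Finset.measurable_sum _ fun k _ => hS.measurable_component hα k i).const_add _

/-- The stochastic intensity property on a bounded interval, with the expectation inside. -/
lemma IsHawkes.lintegral_eventMeasure [SFinite P] (hS : IsHawkes θ P ℱ S)
    (hα : ∀ k i j, 0 ≤ θ.α k i j) (i : Fin 2) {C : ℝ → Ω → ℝ≥0∞}
    (hC : Measurable[predictable ℱ] fun p : ℝ × Ω => C p.1 p.2) {B : Set ℝ}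
    (hB : MeasurableSet B) :
    ∫⁻ ω, ∫⁻ t in B, C t ω ∂(eventMeasure S i ω) ∂P =
      ∫⁻ t in B, ∫⁻ ω, C t ω * ENNReal.ofReal (intensity θ S t ω i) ∂P := by
  have hCB : Measurable[predictable ℱ] fun p : ℝ × Ω => (Prod.fst ⁻¹' B).indicator
      (fun p : ℝ × Ω => C p.1 p.2) p :=
    hC.indicator (measurable_predictable_fst ℱ hB)
  have h := hS.stochasticIntensity i _ hCB
  have h1 : ∀ ω, ∫⁻ t in B, C t ω ∂(eventMeasure S i ω) = ∫⁻ t, (Prod.fst ⁻¹' B).indicator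
      (fun p : ℝ × Ω => C p.1 p.2) (t, ω) ∂(eventMeasure S i ω) := by
    intro ω
    rw [← lintegral_indicator hB]
    rfl
  simp_rw [h1]
  rw [h, lintegral_lintegral_swap, ← lintegral_indicator hB]
  · refine lintegral_congr fun t => ?_
    by_cases ht : t ∈ B
    · rw [indicator_of_mem ht]
      refine lintegral_congr fun ω => ?_
      rw [indicator_of_mem (show (t, ω) ∈ Prod.fst ⁻¹' B from ht)]
    · rw [indicator_of_notMem ht]
      refine (lintegral_congr fun ω => ?_).trans lintegral_zero
      rw [indicator_of_notMem (show (t, ω) ∉ Prod.fst ⁻¹' B from ht), zero_mul]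
  · refine Measurable.aemeasurable ?_
    have hm := (hCB.mul (hS.pointProcess.measurable_intensity hα i).ennreal_ofReal).mono
      (predictable_le ℱ) le_rfl
    exact hm.comp measurable_swap

/-- The masses m ω are finite but not uniformly bounded. Cutting off outside {m ω univ ≤ n} gives
finite kernels, and the supremum over n recovers m. -/
lemma measurable_lintegral_of_measurable_measure {m : Ω → Measure ℝ} (hm : Measurable m)
    [∀ ω, IsFiniteMeasure (m ω)] {f : Ω → ℝ → ℝ≥0∞} (hf : Measurable (Function.uncurry f)) :
    Measurable fun ω => ∫⁻ t, f ω t ∂(m ω) := by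
  classical
  have hmu : Measurable fun ω => m ω univ := Measure.measurable_coe MeasurableSet.univ |>.comp hm
  have hs : ∀ n : ℕ, MeasurableSet {ω | m ω univ ≤ n} := fun n => hmu measurableSet_Iic
  let κ : ℕ → Kernel Ω ℝ := fun n => Kernel.piecewise (hs n) ⟨m, hm⟩ 0
  have hκ : ∀ n ω, κ n ω = if m ω univ ≤ n then m ω else 0 := fun n ω => by
    simp only [κ, Kernel.piecewise_apply, mem_ofPred_eq]
    rfl
  have hfin : ∀ n, IsFiniteKernel (κ n) := fun n => by
    refine ⟨⟨n, ENNReal.natCast_lt_top n, fun ω => ?_⟩⟩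
    rw [hκ]
    split_ifs with h
    · exact h
    · simp
  have h : (fun ω => ∫⁻ t, f ω t ∂(m ω)) = fun ω => ⨆ n, ∫⁻ t, f ω t ∂(κ n ω) := by
    ext ω
    refine le_antisymm ?_ (iSup_le fun n => ?_)
    · obtain ⟨n, hn⟩ := ENNReal.exists_nat_gt (measure_ne_top (m ω) univ)
      refine le_iSup_of_le n ?_
      rw [hκ, if_pos hn.le]
    · rw [hκ]
      split_ifs
      · exact le_rfl
      · simp
  rw [h]
  exact Measurable.iSup fun n => hf.lintegral_kernel_prod_right

lemma IsPointProcess.measurable_setLIntegral (hS : IsPointProcess P ℱ S) (i : Fin 2)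
    {C : ℝ → Ω → ℝ≥0∞} (hC : Measurable[predictable ℱ] fun p : ℝ × Ω => C p.1 p.2)
    {B : Set ℝ} (hB : MeasurableSet B) {a b : ℝ} (hBab : B ⊆ Ico a b) :
    Measurable fun ω => ∫⁻ t in B, C t ω ∂(eventMeasure S i ω) := by
  have hfin : ∀ ω, IsFiniteMeasure ((eventMeasure S i ω).restrict B) := fun ω =>
    isFiniteMeasure_count_restrict hB (hS.finite_inter i ω (hBab.trans Ico_subset_Icc_self))
  refine measurable_lintegral_of_measurable_measure (f := fun ω t => C t ω) ?_
    ((hC.mono (predictable_le ℱ) le_rfl).comp measurable_swap)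
  refine Measure.measurable_of_measurable_coe _ fun D hD => ?_
  -- The predictable integral is frozen at time b: since B ⊆ [a, b), the strict past of b contains
  -- all of B.
  have h := ((hS.measurable_lintegral_Iio i (g := (D ∩ B).indicator 1)
    (measurable_one.indicator (hD.inter hB))).mono (predictable_le ℱ) le_rfl).comp
    (measurable_prodMk_left (x := b))
  convert h using 2 with ω
  simp only [Function.comp]
  rw [lintegral_indicator_one (hD.inter hB), Measure.restrict_apply hD,
    Measure.restrict_apply (hD.inter hB), inter_eq_left.2 (show D ∩ B ⊆ Iio b from
      inter_subset_right.trans (hBab.trans fun x hx => hx.2))]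

lemma IsPointProcess.measurable_lintegral_Ico (hS : IsPointProcess P ℱ S) (i : Fin 2)
    {C : ℝ → Ω → ℝ≥0∞} (hC : Measurable[predictable ℱ] fun p : ℝ × Ω => C p.1 p.2) (a b : ℝ) :
    Measurable fun ω => ∫⁻ t in Ico a b, C t ω ∂(eventMeasure S i ω) :=
  hS.measurable_setLIntegral i hC measurableSet_Ico subset_rfl

/-- Almost surely there is no event at a given time. -/
lemma IsHawkes.ae_notMem [SFinite P] (hS : IsHawkes θ P ℱ S) (hα : ∀ k i j, 0 ≤ θ.α k i j)
    (i : Fin 2) (t : ℝ) : ∀ᵐ ω ∂P, t ∉ S i ω := by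
  have h := hS.lintegral_eventMeasure hα i (C := fun _ _ => 1) measurable_const
    (measurableSet_singleton t)
  have h0 : ∀ f : ℝ → ℝ≥0∞, ∫⁻ u in {t}, f u = 0 := fun f => by
    rw [Measure.restrict_singleton]; simp
  rw [h0] at h
  rw [lintegral_eq_zero_iff (hS.pointProcess.measurable_setLIntegral i measurable_const
    (measurableSet_singleton t) (singleton_subset_iff.2 ⟨le_rfl, lt_add_one t⟩))] at h
  filter_upwards [h] with ω hω hmem
  rw [eventMeasure, lintegral_count_restrict_singleton, indicator_of_mem hmem] at hω
  exact one_ne_zero hω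

/-- The count on [0, t) is predictable and the count on (0, t] need not be; they can differ only
through an event at 0 or at t, which has probability zero. -/
lemma IsHawkes.ae_countBefore [SFinite P] (hS : IsHawkes θ P ℱ S)
    (hα : ∀ k i j, 0 ≤ θ.α k i j) (j : Fin 2) (t : ℝ) :
    ∀ᵐ ω ∂P, ENNReal.ofReal (N S t ω j) = countBefore S j t ω := by
  filter_upwards [hS.ae_notMem hα j 0, hS.ae_notMem hα j t] with ω h0 h1
  rw [countBefore, eventMeasure, count_restrict_apply measurableSet_Ico
    (hS.pointProcess.finite_inter j ω Ico_subset_Icc_self), N, ENNReal.ofReal_natCast]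
  congr 2
  ext x
  simp only [mem_inter_iff, mem_Ioc, mem_Ico, and_congr_right_iff]
  intro hx
  have hx0 : x ≠ 0 := fun h => h0 (h ▸ hx)
  have hxt : x ≠ t := fun h => h1 (h ▸ hx)
  exact ⟨fun h => ⟨h.1.le, h.2.lt_of_ne hxt⟩, fun h => ⟨h.1.lt_of_ne hx0.symm, h.2.le⟩⟩

end Hawkes

/-! ### Pathwise identities -/

section Pathwise

variable {P : Measure Ω} {ℱ : Filtration ℝ mΩ} {K : ℕ} {θ : Params K} {S : Fin 2 → Ω → Set ℝ}

lemma IsPointProcess.ae_mem_restrict (hS : IsPointProcess P ℱ S) (j : Fin 2) (ω : Ω) {B : Set ℝ}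
    (hB : MeasurableSet B) : ∀ᵐ v ∂((eventMeasure S j ω).restrict B), v ∈ S j ω ∧ v ∈ B := by
  have hm : MeasurableSet (S j ω) :=
    (countable_of_finite_inter_Icc (hS.locallyFinite j ω)).measurableSet
  exact (ae_restrict_of_ae (ae_restrict_mem hm)).and (ae_restrict_mem hB)

lemma Regular.notMem {ω : Ω} (hω : Regular θ S ω) {j l : Fin 2} (hjl : l ≠ j) {v : ℝ}
    (hv : v ∈ S j ω) : v ∉ S l ω := by
  have h0 := Set.disjoint_left.1 hω.disjoint
  fin_cases j <;> fin_cases l <;> simp_all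
  exact fun h => h0 h hv

/-- Integration by parts for the product of a component of the intensity and a counting process. -/
lemma IsPointProcess.componentE_mul_countBefore (hS : IsPointProcess P ℱ S) {ω : Ω}
    (hω : Regular θ S ω) (k : Fin K) (i j : Fin 2) (t : ℝ) :
    componentE θ S k t ω i * countBefore S j t ω =
      ∫⁻ v in Ico 0 t, (ENNReal.ofReal (Real.exp (-θ.β k i * (t - v))) * componentE θ S k v ω i +
        ENNReal.ofReal (θ.kernel k (t - v) i j)) ∂(eventMeasure S j ω) +
      ∑ l, ∫⁻ u in Ico 0 t, ENNReal.ofReal (θ.kernel k (t - u) i l) * countBefore S j u ω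
        ∂(eventMeasure S l ω) := by
  have hfin : ∀ l, IsFiniteMeasure ((eventMeasure S l ω).restrict (Ico 0 t)) := fun l =>
    isFiniteMeasure_count_restrict measurableSet_Ico (hS.finite_inter l ω Ico_subset_Icc_self)
  have hk : ∀ l, Measurable fun u => ENNReal.ofReal (θ.kernel k (t - u) i l) := fun l =>
    ((measurable_kernel k i l).comp (measurable_const.sub measurable_id)).ennreal_ofReal
  have hd : ∀ l, Measurable (Function.uncurry fun v u : ℝ =>
      (Ioi v).indicator (fun u => ENNReal.ofReal (θ.kernel k (t - u) i l)) u) := fun l => by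
    have : (Function.uncurry fun v u : ℝ =>
      (Ioi v).indicator (fun u => ENNReal.ofReal (θ.kernel k (t - u) i l)) u) =
      {p : ℝ × ℝ | p.1 < p.2}.indicator fun p => ENNReal.ofReal (θ.kernel k (t - p.2) i l) := by
      ext p
      simp [Function.uncurry, indicator]
    rw [this]
    exact ((hk l).comp measurable_snd).indicator (measurableSet_lt measurable_fst measurable_snd)
  have h1 : componentE θ S k t ω i * countBefore S j t ω =
      ∫⁻ v in Ico 0 t, componentE θ S k t ω i ∂(eventMeasure S j ω) := by
    rw [setLIntegral_const, countBefore]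
  -- Seen from an event v of type j, λ_k(t) is the decayed λ_k(v), plus the contribution of the
  -- event v itself, plus that of the events after v.
  have h2 : ∀ᵐ v ∂((eventMeasure S j ω).restrict (Ico 0 t)), componentE θ S k t ω i =
      (ENNReal.ofReal (Real.exp (-θ.β k i * (t - v))) * componentE θ S k v ω i +
        ENNReal.ofReal (θ.kernel k (t - v) i j)) +
      ∑ l, ∫⁻ u in Ico 0 t, (Ioi v).indicator
        (fun u => ENNReal.ofReal (θ.kernel k (t - u) i l)) u ∂(eventMeasure S l ω) := by
    filter_upwards [hS.ae_mem_restrict j ω measurableSet_Ico] with v hv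
    rw [componentE_eq_add k hv.2.2.le, add_assoc]
    congr 1
    -- The atom at v contributes only for l = j, because there are no common events.
    have h3 : ∀ l, ∫⁻ u in Ico v t, ENNReal.ofReal (θ.kernel k (t - u) i l)
        ∂(eventMeasure S l ω) = (if l = j then ENNReal.ofReal (θ.kernel k (t - v) i l) else 0) +
        ∫⁻ u in Ico 0 t, (Ioi v).indicator
        (fun u => ENNReal.ofReal (θ.kernel k (t - u) i l)) u ∂(eventMeasure S l ω) := by
      intro l
      rw [← Ioo_insert_left hv.2.2, insert_eq, lintegral_union measurableSet_Ioo (by simp),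
        eventMeasure, lintegral_count_restrict_singleton, setLIntegral_indicator measurableSet_Ioi]
      congr 1
      · split_ifs with h
        · rw [indicator_of_mem (h ▸ hv.1)]
        · rw [indicator_of_notMem (hω.notMem h hv.1)]
      · congr 2
        ext x
        simp only [mem_Ioo, mem_inter_iff, mem_Ioi, mem_Ico]
        exact ⟨fun h => ⟨h.1, hv.2.1.trans h.1.le, h.2⟩, fun h => ⟨h.1, h.2.2⟩⟩
    simp_rw [h3]
    rw [Finset.sum_add_distrib, Finset.sum_ite_eq' Finset.univ j]
    simp
  rw [h1, lintegral_congr_ae h2, lintegral_add_right, lintegral_finsetSum]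
  · congr 1
    refine Finset.sum_congr rfl fun l _ => ?_
    -- After the swap, the inner integral over v < u counts the events of type j before u.
    rw [lintegral_lintegral_swap (hd l).aemeasurable]
    refine setLIntegral_congr_fun measurableSet_Ico fun u hu => ?_
    have h4 : ∀ v, (Ioi v).indicator (fun u => ENNReal.ofReal (θ.kernel k (t - u) i l)) u =
        (Iio u).indicator (fun _ => ENNReal.ofReal (θ.kernel k (t - u) i l)) v := fun v => by
      simp [indicator]
    simp only [h4]
    rw [setLIntegral_indicator measurableSet_Iio, setLIntegral_const, countBefore]
    congr 2
    ext x
    simp only [mem_inter_iff, mem_Iio, mem_Ico]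
    exact ⟨fun h => ⟨h.2.1, h.1⟩, fun h => ⟨h.2, h.1, h.2.trans hu.2⟩⟩
  · exact fun l _ => (hd l).lintegral_prod_right
  · exact Finset.measurable_sum _ fun l _ => (hd l).lintegral_prod_right

lemma countBefore_add (j : Fin 2) {a b : ℝ} (ha : 0 ≤ a) (hab : a ≤ b) (ω : Ω) :
    countBefore S j b ω = countBefore S j a ω + eventMeasure S j ω (Ico a b) := by
  rw [countBefore, countBefore, ← Ico_union_Ico_eq_Ico ha hab,
    measure_union Ico_disjoint_Ico_same measurableSet_Ico]

/-- Each event raises a square by (x + 1)² - x² = 2x + 1. Truncation at n keeps the inequality,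
since min (x + 1) n ≤ min x n + 1, and makes all expectations finite before any moment of the count
is known. -/
lemma IsPointProcess.sq_min_countBefore_le (hS : IsPointProcess P ℱ S) (j : Fin 2) (n : ℕ)
    {t : ℝ} (ht : 0 < t) (ω : Ω) :
    (min (countBefore S j t ω) n) ^ 2 ≤
      ∫⁻ v in Ico 0 t, (2 * min (countBefore S j v ω) n + 1) ∂(eventMeasure S j ω) := by
  have key := rel_of_gap (hS.locallyFinite j ω) (R := fun a b => 0 ≤ a →
    (min (countBefore S j b ω) n) ^ 2 ≤ (min (countBefore S j a ω) n) ^ 2 +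
      ∫⁻ v in Ico a b, (2 * min (countBefore S j v ω) n + 1) ∂(eventMeasure S j ω)) ?_ ?_ ht
  · refine (key le_rfl).trans (le_of_eq ?_)
    simp [countBefore]
  · intro a b hab hgap ha
    have h1 : eventMeasure S j ω (Ico a b) = (S j ω).indicator 1 a := by
      rw [← lintegral_count_restrict_Ico hab hgap, ← setLIntegral_one]
      rfl
    rw [countBefore_add j ha hab.le, h1, eventMeasure, lintegral_count_restrict_Ico hab hgap]
    by_cases haS : a ∈ S j ω
    · rw [indicator_of_mem haS, indicator_of_mem haS]
      generalize countBefore S j a ω = x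
      calc (min (x + (1 : ℝ → ℝ≥0∞) a) n) ^ 2 ≤ (min x n + 1) ^ 2 := by
            gcongr
            rw [← min_add_add_right]
            exact min_le_min le_rfl le_self_add
        _ = _ := by ring
    · simp [haS]
  · intro a b c hab hbc h1 h2 ha
    rw [← lintegral_Ico_add_Ico _ hab.le hbc.le, ← add_assoc]
    exact (h2 (ha.trans hab.le)).trans (by gcongr; exact h1 ha)

end Pathwise

/-! ### The exponential of a linear functional of the components -/

section Exponential

variable {P : Measure Ω} {ℱ : Filtration ℝ mΩ} {K : ℕ} {θ : Params K} {S : Fin 2 → Ω → Set ℝ}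

lemma βMat_inv (hβ : ∀ k i, 0 < θ.β k i) (k : Fin K) :
    (θ.βMat k)⁻¹ = Matrix.diagonal fun i => (θ.β k i)⁻¹ := by
  refine Matrix.inv_eq_right_inv ?_
  rw [Params.βMat, Matrix.diagonal_mul_diagonal, ← Matrix.diagonal_one]
  congr 1
  ext i
  exact mul_inv_cancel₀ (hβ k i).ne'

lemma branching_apply (hβ : ∀ k i, 0 < θ.β k i) (i j : Fin 2) :
    θ.branching i j = ∑ k, θ.α k i j / θ.β k i := by
  rw [Params.branching, Matrix.sum_apply]
  refine Finset.sum_congr rfl fun k _ => ?_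
  rw [βMat_inv hβ, Matrix.diagonal_mul, div_eq_inv_mul]

lemma branching_nonneg (hα : ∀ k i j, 0 ≤ θ.α k i j) (hβ : ∀ k i, 0 < θ.β k i) (i j : Fin 2) :
    0 ≤ θ.branching i j := by
  rw [branching_apply hβ]
  exact Finset.sum_nonneg fun k _ => div_nonneg (hα _ _ _) (hβ _ _).le

lemma vecMul_branching_nonneg (hα : ∀ k i j, 0 ≤ θ.α k i j) (hβ : ∀ k i, 0 < θ.β k i)
    {v : Fin 2 → ℝ} (hv : 0 ≤ v) (j : Fin 2) : 0 ≤ (v ᵥ* θ.branching) j := by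
  rw [Matrix.vecMul, dotProduct]
  exact Finset.sum_nonneg fun i _ => mul_nonneg (hv i) (branching_nonneg hα hβ i j)

/-- The linear functional `∑ v_i β_{ki}⁻¹ x_{ki}` of the components. -/
def potential (θ : Params K) (v : Fin 2 → ℝ) (x : Fin K → Fin 2 → ℝ) : ℝ :=
  ∑ k, ∑ i, v i / θ.β k i * x k i

/-- The linear functional `∑ v_i x_{ki}` of the components. -/
def total (v : Fin 2 → ℝ) (x : Fin K → Fin 2 → ℝ) : ℝ :=
  ∑ k, ∑ i, v i * x k i

/-- The vector of all components of the intensity. -/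
def state (θ : Params K) (S : Fin 2 → Ω → Set ℝ) (t : ℝ) (ω : Ω) (k : Fin K) (i : Fin 2) : ℝ :=
  component θ S k t ω i

lemma measurable_potential (v : Fin 2 → ℝ) : Measurable (potential θ v) := by
  unfold potential
  fun_prop

lemma measurable_total (v : Fin 2 → ℝ) : Measurable (total v : (Fin K → Fin 2 → ℝ) → ℝ) := by
  unfold total
  fun_prop

lemma potential_nonneg (hβ : ∀ k i, 0 < θ.β k i) {v : Fin 2 → ℝ} (hv : 0 ≤ v)
    {x : Fin K → Fin 2 → ℝ} (hx : 0 ≤ x) : 0 ≤ potential θ v x :=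
  Finset.sum_nonneg fun k _ => Finset.sum_nonneg fun i _ =>
    mul_nonneg (div_nonneg (hv i) (hβ k i).le) (hx k i)

lemma total_nonneg {v : Fin 2 → ℝ} (hv : 0 ≤ v) {x : Fin K → Fin 2 → ℝ} (hx : 0 ≤ x) :
    0 ≤ total v x :=
  Finset.sum_nonneg fun k _ => Finset.sum_nonneg fun i _ => mul_nonneg (hv i) (hx k i)

lemma state_nonneg (hα : ∀ k i j, 0 ≤ θ.α k i j) (t : ℝ) (ω : Ω) : 0 ≤ state θ S t ω :=
  fun k i => component_nonneg hα k t ω i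

/-- The value at a does not include an event at a, so the decay on (a, b] starts from that value
plus the jump. -/
lemma Regular.component_of_gap {ω : Ω} (hω : Regular θ S ω) (hα : ∀ k i j, 0 ≤ θ.α k i j)
    {a b u : ℝ} (hu : u ∈ Ioc a b) (hgap : ∀ j, S j ω ∩ Ioo a b = ∅) (k : Fin K) (i : Fin 2) :
    component θ S k u ω i = Real.exp (-θ.β k i * (u - a)) *
      (component θ S k a ω i + ∑ j, (S j ω).indicator (fun _ => θ.α k i j) a) := by
  have hind : ∀ j, 0 ≤ (S j ω).indicator (fun _ => θ.α k i j) a := fun j =>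
    indicator_nonneg (fun _ _ => hα k i j) a
  have h0 : 0 ≤ component θ S k a ω i := component_nonneg hα _ _ _ _
  have hsum : 0 ≤ ∑ j, (S j ω).indicator (fun _ => θ.α k i j) a :=
    Finset.sum_nonneg fun j _ => hind j
  rw [← ENNReal.ofReal_eq_ofReal_iff (component_nonneg hα _ _ _ _) (by positivity),
    hω.ofReal_component hα, componentE_eq_add k hu.1.le, ← hω.ofReal_component hα,
    ENNReal.ofReal_mul (by positivity), ENNReal.ofReal_add h0 hsum, mul_add]
  congr 1
  rw [ENNReal.ofReal_sum_of_nonneg fun j _ => hind j, Finset.mul_sum]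
  refine Finset.sum_congr rfl fun j _ => ?_
  have hg : S j ω ∩ Ioo a u = ∅ :=
    subset_eq_empty (inter_subset_inter_right _ (Ioo_subset_Ioo_right hu.2)) (hgap j)
  rw [eventMeasure, lintegral_count_restrict_Ico hu.1 hg]
  by_cases ha : a ∈ S j ω
  · rw [indicator_of_mem ha, indicator_of_mem ha, kernel_apply, mul_comm,
      ENNReal.ofReal_mul (by positivity)]
  · simp [ha]

/-- The weights v_i / β_{ki} are chosen so that, between events, the decay rates cancel and the
potential has derivative -`total`, while an event of type j adds (vG)_j. The claim is the
fundamental theorem of calculus for exp(-sV) after the jump at a, with negative terms moved across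
so that it makes sense in [0, ∞]. -/
lemma Regular.exp_potential_of_gap {ω : Ω} (hω : Regular θ S ω) (hα : ∀ k i j, 0 ≤ θ.α k i j)
    (hβ : ∀ k i, 0 < θ.β k i) {v : Fin 2 → ℝ} (hv : 0 ≤ v) {s : ℝ} (hs : 0 ≤ s) {a b : ℝ}
    (hab : a < b) (hgap : ∀ j, S j ω ∩ Ioo a b = ∅) :
    ENNReal.ofReal (Real.exp (-s * potential θ v (state θ S b ω))) +
      ∑ j, ∫⁻ u in Ico a b, ENNReal.ofReal (Real.exp (-s * potential θ v (state θ S u ω)) *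
        (1 - Real.exp (-s * (v ᵥ* θ.branching) j))) ∂(eventMeasure S j ω) =
    ENNReal.ofReal (Real.exp (-s * potential θ v (state θ S a ω))) +
      ∫⁻ u in Ico a b, ENNReal.ofReal
        (s * Real.exp (-s * potential θ v (state θ S u ω)) * total v (state θ S u ω)) := by
  set c : Fin K → Fin 2 → ℝ := fun k i =>
    state θ S a ω k i + ∑ j, (S j ω).indicator (fun _ => θ.α k i j) a with hc
  set y : ℝ → Fin K → Fin 2 → ℝ := fun u k i => Real.exp (-θ.β k i * (u - a)) * c k i with hy
  have hstate : ∀ u ∈ Ioc a b, state θ S u ω = y u := fun u hu => by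
    ext k i
    exact hω.component_of_gap hα hu hgap k i
  have hc0 : 0 ≤ c := fun k i => add_nonneg (state_nonneg hα a ω k i)
    (Finset.sum_nonneg fun j _ => indicator_nonneg (fun _ _ => hα k i j) a)
  have hy0 : ∀ u, 0 ≤ y u := fun u k i => mul_nonneg (Real.exp_pos _).le (hc0 k i)
  have hderiv : ∀ u, HasDerivAt (fun u => Real.exp (-s * potential θ v (y u)))
      (s * Real.exp (-s * potential θ v (y u)) * total v (y u)) u := by
    intro u
    have h1 : HasDerivAt (fun u => potential θ v (y u)) (-total v (y u)) u := by
      unfold potential total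
      rw [← Finset.sum_neg_distrib]
      refine HasDerivAt.fun_sum fun k _ => ?_
      rw [← Finset.sum_neg_distrib]
      refine HasDerivAt.fun_sum fun i _ => ?_
      have h2 : HasDerivAt (fun u => -θ.β k i * (u - a)) (-θ.β k i) u := by
        simpa using ((hasDerivAt_id u).sub_const a).const_mul (-θ.β k i)
      have h3 := (h2.exp.mul_const (c k i)).const_mul (v i / θ.β k i)
      refine h3.congr_deriv ?_
      have := (hβ k i).ne'
      simp only [hy]
      field_simp
    convert (h1.const_mul (-s)).exp using 1
    ring
  have hcont : Continuous fun u => s * Real.exp (-s * potential θ v (y u)) * total v (y u) := by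
    unfold potential total
    simp only [hy]
    fun_prop
  have hint : ∫⁻ u in Ico a b, ENNReal.ofReal
        (s * Real.exp (-s * potential θ v (state θ S u ω)) * total v (state θ S u ω)) =
      ENNReal.ofReal (Real.exp (-s * potential θ v (y b)) -
        Real.exp (-s * potential θ v (y a))) := by
    rw [setLIntegral_congr Ico_ae_eq_Ioc, setLIntegral_congr_fun measurableSet_Ioc (fun u hu => by
      rw [hstate u hu]), ← intervalIntegral.integral_eq_sub_of_hasDerivAt (fun u _ => hderiv u)
      (hcont.intervalIntegrable _ _), intervalIntegral.integral_of_le hab.le,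
      ofReal_integral_eq_lintegral_ofReal (hcont.integrableOn_Ioc)]
    exact ae_of_all _ fun u => mul_nonneg (mul_nonneg hs (Real.exp_pos _).le)
      (total_nonneg hv (hy0 u))
  have hya : y a = c := by
    ext k i
    simp [hy]
  -- The jump of the potential at an event of type j is ∑ v_i α_{ijk} / β_{ki} = (vG)_j.
  have hpot : potential θ v c = potential θ v (state θ S a ω) +
      ∑ j, (S j ω).indicator (fun _ => (v ᵥ* θ.branching) j) a := by
    have h1 : ∀ j, (S j ω).indicator (fun _ => (v ᵥ* θ.branching) j) a =
        ∑ k, ∑ i, v i / θ.β k i * (S j ω).indicator (fun _ => θ.α k i j) a := by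
      intro j
      by_cases ha : a ∈ S j ω
      · simp only [indicator_of_mem ha, Matrix.vecMul, dotProduct, branching_apply hβ]
        simp_rw [Finset.mul_sum]
        rw [Finset.sum_comm]
        refine Finset.sum_congr rfl fun k _ => Finset.sum_congr rfl fun i _ => by ring
      · simp [ha]
    simp_rw [h1]
    rw [Finset.sum_comm, potential, potential, ← Finset.sum_add_distrib]
    refine Finset.sum_congr rfl fun k _ => ?_
    rw [Finset.sum_comm, ← Finset.sum_add_distrib]
    refine Finset.sum_congr rfl fun i _ => ?_
    rw [hc, mul_add, Finset.mul_sum]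
  have hw := vecMul_branching_nonneg hα hβ hv
  have hmono : Real.exp (-s * potential θ v (y a)) ≤ Real.exp (-s * potential θ v (y b)) := by
    refine Real.exp_le_exp.2 ?_
    rw [neg_mul, neg_mul, neg_le_neg_iff]
    refine mul_le_mul_of_nonneg_left ?_ hs
    refine Finset.sum_le_sum fun k _ => Finset.sum_le_sum fun i _ => ?_
    refine mul_le_mul_of_nonneg_left ?_ (div_nonneg (hv i) (hβ k i).le)
    rw [hya]
    refine mul_le_of_le_one_left (hc0 k i) (Real.exp_le_one_iff.2 ?_)
    nlinarith [hβ k i]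
  have hexp1 : ∀ j, 0 ≤ 1 - Real.exp (-s * (v ᵥ* θ.branching) j) := fun j =>
    sub_nonneg.2 (Real.exp_le_one_iff.2 (by nlinarith [hw j]))
  have hjump : ∀ j, ∫⁻ u in Ico a b, ENNReal.ofReal
      (Real.exp (-s * potential θ v (state θ S u ω)) *
        (1 - Real.exp (-s * (v ᵥ* θ.branching) j))) ∂(eventMeasure S j ω) =
      ENNReal.ofReal ((S j ω).indicator (fun _ => Real.exp (-s * potential θ v (state θ S a ω)) *
        (1 - Real.exp (-s * (v ᵥ* θ.branching) j))) a) := by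
    intro j
    rw [eventMeasure, lintegral_count_restrict_Ico hab (hgap j)]
    by_cases ha : a ∈ S j ω <;> simp [ha]
  have hind : ∀ j, 0 ≤ (S j ω).indicator
      (fun _ => Real.exp (-s * potential θ v (state θ S a ω)) *
        (1 - Real.exp (-s * (v ᵥ* θ.branching) j))) a := fun j =>
    indicator_nonneg (fun _ _ => mul_nonneg (Real.exp_pos _).le (hexp1 j)) a
  simp_rw [hjump]
  rw [hint, hstate b ⟨hab, le_rfl⟩, ← ENNReal.ofReal_sum_of_nonneg (fun j _ => hind j),
    ← ENNReal.ofReal_add (Real.exp_pos _).le (Finset.sum_nonneg fun j _ => hind j),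
    ← ENNReal.ofReal_add (Real.exp_pos _).le (sub_nonneg.2 hmono)]
  congr 1
  rw [hya, hpot, Fin.sum_univ_two, Fin.sum_univ_two]
  have hd : a ∈ S 0 ω → a ∉ S 1 ω := fun h => Set.disjoint_left.1 hω.disjoint h
  by_cases h0 : a ∈ S 0 ω
  · have h1 := hd h0
    simp only [h0, h1, indicator_of_mem, indicator_of_notMem, not_false_eq_true, add_zero, mul_add,
      Real.exp_add]
    ring
  · by_cases h1 : a ∈ S 1 ω
    · simp only [h0, h1, indicator_of_mem, indicator_of_notMem, not_false_eq_true, zero_add,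
        mul_add, Real.exp_add]
      ring
    · simp [h0, h1]

lemma IsPointProcess.exp_potential (hS : IsPointProcess P ℱ S) {ω : Ω} (hω : Regular θ S ω)
    (hα : ∀ k i j, 0 ≤ θ.α k i j) (hβ : ∀ k i, 0 < θ.β k i) {v : Fin 2 → ℝ} (hv : 0 ≤ v)
    {s : ℝ} (hs : 0 ≤ s) {a b : ℝ} (hab : a < b) :
    ENNReal.ofReal (Real.exp (-s * potential θ v (state θ S b ω))) +
      ∑ j, ∫⁻ u in Ico a b, ENNReal.ofReal (Real.exp (-s * potential θ v (state θ S u ω)) *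
        (1 - Real.exp (-s * (v ᵥ* θ.branching) j))) ∂(eventMeasure S j ω) =
    ENNReal.ofReal (Real.exp (-s * potential θ v (state θ S a ω))) +
      ∫⁻ u in Ico a b, ENNReal.ofReal
        (s * Real.exp (-s * potential θ v (state θ S u ω)) * total v (state θ S u ω)) := by
  refine rel_of_gap (T := ⋃ j, S j ω) (R := fun a b =>
    ENNReal.ofReal (Real.exp (-s * potential θ v (state θ S b ω))) +
      ∑ j, ∫⁻ u in Ico a b, ENNReal.ofReal (Real.exp (-s * potential θ v (state θ S u ω)) *
        (1 - Real.exp (-s * (v ᵥ* θ.branching) j))) ∂(eventMeasure S j ω) =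
    ENNReal.ofReal (Real.exp (-s * potential θ v (state θ S a ω))) +
      ∫⁻ u in Ico a b, ENNReal.ofReal
        (s * Real.exp (-s * potential θ v (state θ S u ω)) * total v (state θ S u ω)))
    (fun a b => ?_) (fun a b hab hgap => ?_)
    (fun a b c hab hbc h1 h2 => ?_) hab
  · rw [iUnion_inter]
    exact finite_iUnion fun j => hS.locallyFinite j ω a b
  · refine hω.exp_potential_of_gap hα hβ hv hs hab fun j => ?_
    exact subset_eq_empty (inter_subset_inter_left _ (subset_iUnion (fun j => S j ω) j)) hgap
  · simp only [← lintegral_Ico_add_Ico _ hab.le hbc.le, Finset.sum_add_distrib]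
    rw [add_left_comm, h2, ← add_assoc, ← add_assoc, ← h1, add_comm (ENNReal.ofReal _)]

end Exponential

/-! ### Nonnegative two-by-two matrices -/

/-- A nonnegative two-by-two matrix with spectral radius less than one. -/
structure Subcritical (G : Matrix (Fin 2) (Fin 2) ℝ) : Prop where
  lt_one : ∀ i, G i i < 1
  mul_lt : G 0 1 * G 1 0 < (1 - G 0 0) * (1 - G 1 1)

lemma Subcritical.isUnit {G : Matrix (Fin 2) (Fin 2) ℝ} (hG : Subcritical G) :
    IsUnit (1 - G) := by
  rw [Matrix.isUnit_iff_isUnit_det, isUnit_iff_ne_zero, Matrix.det_fin_two]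
  have := hG.mul_lt
  simp only [Matrix.sub_apply, Matrix.one_apply_eq, ne_eq, zero_ne_one, not_false_eq_true,
    Matrix.one_apply_ne, one_ne_zero]
  intro h
  linarith

lemma Subcritical.exists_vecMul_lt {G : Matrix (Fin 2) (Fin 2) ℝ} (hG : Subcritical G)
    (h0 : ∀ i j, 0 ≤ G i j) : ∃ v : Fin 2 → ℝ, (∀ i, 0 < v i) ∧ ∀ j, (v ᵥ* G) j < v j := by
  have h1 := hG.lt_one 0
  have h2 := hG.lt_one 1
  have h3 := hG.mul_lt
  -- This is (1, 1) times the adjugate of 1 - G, so v(1 - G) = det(1 - G) (1, 1), which is positive.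
  refine ⟨![1 - G 1 1 + G 1 0, 1 - G 0 0 + G 0 1], fun i => ?_, fun j => ?_⟩
  · fin_cases i
    · simpa using by linarith [h0 1 0]
    · simpa using by linarith [h0 0 1]
  · fin_cases j <;> simp [Matrix.vecMul, dotProduct, Fin.sum_univ_two] <;> nlinarith

lemma Subcritical.transpose {G : Matrix (Fin 2) (Fin 2) ℝ} (hG : Subcritical G) :
    Subcritical Gᵀ :=
  ⟨fun i => hG.lt_one i, by
    have := hG.mul_lt
    simp only [Matrix.transpose_apply]
    linarith⟩

/-- Perron–Frobenius by hand in dimension two. If some diagonal entry is at least one, a basis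
vector works; otherwise the row (1, 1) adj(1 - G) does, because v(1 - G) = det(1 - G) (1, 1) with a
nonpositive determinant. -/
lemma subcritical_or_exists_le_vecMul {G : Matrix (Fin 2) (Fin 2) ℝ} (h0 : ∀ i j, 0 ≤ G i j) :
    Subcritical G ∨ ∃ v : Fin 2 → ℝ, 0 ≤ v ∧ v ≠ 0 ∧ ∀ j, v j ≤ (v ᵥ* G) j := by
  by_cases hd : ∀ i, G i i < 1
  · by_cases h : G 0 1 * G 1 0 < (1 - G 0 0) * (1 - G 1 1)
    · exact Or.inl ⟨hd, h⟩
    · right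
      have h1 := hd 0
      have h2 := hd 1
      rw [not_lt] at h
      refine ⟨![1 - G 1 1 + G 1 0, 1 - G 0 0 + G 0 1], fun i => ?_, fun hv => ?_, fun j => ?_⟩
      · fin_cases i
        · simpa using by linarith [h0 1 0]
        · simpa using by linarith [h0 0 1]
      · have := congrFun hv 0
        simp at this
        linarith [h0 1 0]
      · fin_cases j <;> simp [Matrix.vecMul, dotProduct, Fin.sum_univ_two] <;> nlinarith
  · right
    push Not at hd
    obtain ⟨i, hi⟩ := hd
    refine ⟨Pi.single i 1, Pi.single_nonneg.2 zero_le_one, by simp, fun j => ?_⟩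
    rw [Matrix.single_one_vecMul]
    by_cases hij : j = i
    · subst hij
      simpa using hi
    · simpa [hij] using h0 i j

/-! ### Moments of a random vector with the stationary Laplace identity -/

section Laplace

variable {P : Measure Ω} {K : ℕ} {θ : Params K} {X : Ω → Fin K → Fin 2 → ℝ}

/-- The intensity as a function of the vector of all components. -/
def rate (θ : Params K) (x : Fin K → Fin 2 → ℝ) (j : Fin 2) : ℝ :=
  θ.μ j + ∑ k, x k j

lemma measurable_rate (j : Fin 2) : Measurable fun x => rate θ x j := by
  unfold rate
  fun_prop

lemma rate_nonneg (hμ : ∀ i, 0 < θ.μ i) {x : Fin K → Fin 2 → ℝ} (hx : 0 ≤ x) (j : Fin 2) :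
    0 ≤ rate θ x j :=
  add_nonneg (hμ j).le (Finset.sum_nonneg fun k _ => hx k j)

lemma sum_mul_rate (v : Fin 2 → ℝ) (x : Fin K → Fin 2 → ℝ) :
    ∑ j, v j * rate θ x j = ∑ j, v j * θ.μ j + total v x := by
  simp only [rate, total, mul_add, Finset.sum_add_distrib, Finset.mul_sum]
  congr 1
  exact Finset.sum_comm

lemma total_mono {v w : Fin 2 → ℝ} (hvw : v ≤ w) {x : Fin K → Fin 2 → ℝ} (hx : 0 ≤ x) :
    total v x ≤ total w x :=
  Finset.sum_le_sum fun k _ => Finset.sum_le_sum fun i _ =>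
    mul_le_mul_of_nonneg_right (hvw i) (hx k i)

lemma total_sub (v w : Fin 2 → ℝ) (x : Fin K → Fin 2 → ℝ) :
    total (v - w) x = total v x - total w x := by
  simp [total, sub_mul, Finset.sum_sub_distrib]

lemma mul_le_total {v : Fin 2 → ℝ} (hv : 0 ≤ v) {x : Fin K → Fin 2 → ℝ} (hx : 0 ≤ x)
    (k : Fin K) (i : Fin 2) : v i * x k i ≤ total v x := by
  have h : ∀ k i, 0 ≤ v i * x k i := fun k i => mul_nonneg (hv i) (hx k i)
  exact (Finset.single_le_sum (f := fun i => v i * x k i) (fun i _ => h k i)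
    (Finset.mem_univ i)).trans (Finset.single_le_sum (f := fun k => ∑ i, v i * x k i)
      (fun k _ => Finset.sum_nonneg fun i _ => h k i) (Finset.mem_univ k))

lemma div_mul_le_potential (hβ : ∀ k i, 0 < θ.β k i) {v : Fin 2 → ℝ} (hv : 0 ≤ v)
    {x : Fin K → Fin 2 → ℝ} (hx : 0 ≤ x) (k : Fin K) (i : Fin 2) :
    v i / θ.β k i * x k i ≤ potential θ v x := by
  have h : ∀ k i, 0 ≤ v i / θ.β k i * x k i := fun k i =>
    mul_nonneg (div_nonneg (hv i) (hβ k i).le) (hx k i)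
  exact (Finset.single_le_sum (f := fun i => v i / θ.β k i * x k i) (fun i _ => h k i)
    (Finset.mem_univ i)).trans (Finset.single_le_sum (f := fun k => ∑ i, v i / θ.β k i * x k i)
      (fun k _ => Finset.sum_nonneg fun i _ => h k i) (Finset.mem_univ k))

lemma total_le_mul_potential (hβ : ∀ k i, 0 < θ.β k i) {v : Fin 2 → ℝ} (hv : 0 ≤ v)
    {x : Fin K → Fin 2 → ℝ} (hx : 0 ≤ x) :
    total v x ≤ (∑ k, ∑ i, θ.β k i) * potential θ v x := by
  have hle : ∀ k i, θ.β k i ≤ ∑ k, ∑ i, θ.β k i := fun k i =>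
    (Finset.single_le_sum (f := fun i => θ.β k i) (fun i _ => (hβ k i).le)
    (Finset.mem_univ i)).trans (Finset.single_le_sum (f := fun k => ∑ i, θ.β k i)
      (fun k _ => Finset.sum_nonneg fun i _ => (hβ k i).le) (Finset.mem_univ k))
  rw [total, potential, Finset.mul_sum]
  refine Finset.sum_le_sum fun k _ => ?_
  rw [Finset.mul_sum]
  refine Finset.sum_le_sum fun i _ => ?_
  calc v i * x k i = θ.β k i * (v i / θ.β k i * x k i) := by
        have := (hβ k i).ne'
        field_simp
    _ ≤ _ := mul_le_mul_of_nonneg_right (hle k i)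
        (mul_nonneg (div_nonneg (hv i) (hβ k i).le) (hx k i))

lemma exp_neg_mul_le (x : ℝ) : Real.exp (-x) * x ≤ 1 := by
  have h := Real.add_one_le_exp x
  rw [Real.exp_neg, inv_mul_le_one₀ (Real.exp_pos x)]
  linarith

/-- Truncated moments of the components are bounded. -/
lemma exp_potential_mul_total_le (hβ : ∀ k i, 0 < θ.β k i) {v : Fin 2 → ℝ} (hv : 0 ≤ v)
    {x : Fin K → Fin 2 → ℝ} (hx : 0 ≤ x) {s : ℝ} (hs : 0 < s) :
    s * (Real.exp (-s * potential θ v x) * total v x) ≤ ∑ k, ∑ i, θ.β k i := by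
  have hb : 0 ≤ ∑ k, ∑ i, θ.β k i :=
    Finset.sum_nonneg fun k _ => Finset.sum_nonneg fun i _ => (hβ k i).le
  calc s * (Real.exp (-s * potential θ v x) * total v x)
      ≤ s * (Real.exp (-s * potential θ v x) * ((∑ k, ∑ i, θ.β k i) * potential θ v x)) := by
        gcongr
        exact total_le_mul_potential hβ hv hx
    _ = (∑ k, ∑ i, θ.β k i) *
          (Real.exp (-(s * potential θ v x)) * (s * potential θ v x)) := by
        rw [neg_mul]; ring
    _ ≤ (∑ k, ∑ i, θ.β k i) * 1 := mul_le_mul_of_nonneg_left (exp_neg_mul_le _) hb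
    _ = _ := mul_one _

/-- The Laplace transform of a stationary law of the components is annihilated by the generator. -/
def LaplaceIdentity (θ : Params K) (P : Measure Ω) (X : Ω → Fin K → Fin 2 → ℝ) : Prop :=
  ∀ v : Fin 2 → ℝ, 0 ≤ v → ∀ s : ℝ, 0 < s →
    ∑ j, ∫⁻ ω, ENNReal.ofReal (Real.exp (-s * potential θ v (X ω)) *
        (1 - Real.exp (-s * (v ᵥ* θ.branching) j)) * rate θ (X ω) j) ∂P =
      ∫⁻ ω, ENNReal.ofReal (s * Real.exp (-s * potential θ v (X ω)) * total v (X ω)) ∂P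

/-- The Laplace identity lives in [0, ∞], where the possibly negative h + l is replaced by its
positive part. This only increases the left side, so the finite ∫ h can still be cancelled. -/
lemma integral_nonpos_of_lintegral_le {h l : Ω → ℝ} (hh : Integrable h P) (hh0 : ∀ ω, 0 ≤ h ω)
    (hl : Integrable l P)
    (hle : ∫⁻ ω, ENNReal.ofReal (h ω + l ω) ∂P ≤ ∫⁻ ω, ENNReal.ofReal (h ω) ∂P) :
    ∫ ω, l ω ∂P ≤ 0 := by
  have h1 : ∫ ω, (h ω + l ω) ∂P ≤ ∫ ω, h ω ∂P := by
    calc ∫ ω, (h ω + l ω) ∂P ≤ ∫ ω, max (h ω + l ω) 0 ∂P :=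
          integral_mono (hh.add hl) (hh.add hl).pos_part fun ω => le_max_left _ _
      _ = (∫⁻ ω, ENNReal.ofReal (max (h ω + l ω) 0) ∂P).toReal :=
          integral_eq_lintegral_of_nonneg_ae (ae_of_all _ fun ω => le_max_right _ _)
            (hh.add hl).pos_part.aestronglyMeasurable
      _ = (∫⁻ ω, ENNReal.ofReal (h ω + l ω) ∂P).toReal := by
          simp [ENNReal.ofReal_max]
      _ ≤ (∫⁻ ω, ENNReal.ofReal (h ω) ∂P).toReal :=
          ENNReal.toReal_mono (hasFiniteIntegral_iff_ofReal (ae_of_all _ hh0) |>.1 hh.2).ne hle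
      _ = _ := (integral_eq_lintegral_of_nonneg_ae (ae_of_all _ hh0)
          hh.aestronglyMeasurable).symm
  rw [integral_add hh hl] at h1
  linarith

/-- Fatou's lemma, in the form that turns uniform bounds on damped moments into finiteness of the
moments. -/
lemma lintegral_le_of_tendsto_of_le {F : ℕ → Ω → ℝ≥0∞} {G : Ω → ℝ≥0∞}
    (hF : ∀ n, Measurable (F n)) (hlim : ∀ ω, Tendsto (fun n => F n ω) atTop (𝓝 (G ω)))
    {c : ℝ≥0∞} (hc : ∀ n, ∫⁻ ω, F n ω ∂P ≤ c) : ∫⁻ ω, G ω ∂P ≤ c := by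
  have h : ∀ ω, G ω = liminf (fun n => F n ω) atTop := fun ω => (hlim ω).liminf_eq.symm
  simp_rw [h]
  refine (lintegral_liminf_le hF).trans ?_
  exact liminf_le_of_le (by isBoundedDefault) fun b hb =>
    (hb.exists.choose_spec).trans (hc _)

lemma one_sub_exp_neg_ge {x : ℝ} (hx : 0 ≤ x) : x - x ^ 2 / 2 ≤ 1 - Real.exp (-x) := by
  have h1 := Real.quadratic_le_exp_of_nonneg hx
  have h2 : Real.exp (-x) ≤ 1 - x + x ^ 2 / 2 := by
    rw [Real.exp_neg, inv_le_iff_one_le_mul₀ (Real.exp_pos x)]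
    have h3 : 0 ≤ 1 - x + x ^ 2 / 2 := by nlinarith [sq_nonneg (x - 1)]
    -- (1 - x + x²/2)(1 + x + x²/2) = 1 + x⁴/4 ≥ 1.
    nlinarith [mul_le_mul_of_nonneg_left h1 h3, sq_nonneg (x ^ 2)]
  linarith

/-- `total` is at most (∑ β) times `potential`, and y exp(-y) ≤ 1, so the damped total is bounded by
(∑ β) / s. This permits subtraction before any moment of X is known. -/
lemma integrable_exp_potential_mul_total [IsFiniteMeasure P] (hβ : ∀ k i, 0 < θ.β k i)
    (hX : Measurable X) (hX0 : ∀ ω, 0 ≤ X ω) {v w : Fin 2 → ℝ} (hv : 0 ≤ v) (hw : 0 ≤ w)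
    (hwv : w ≤ v) {s : ℝ} (hs : 0 < s) :
    Integrable (fun ω => Real.exp (-s * potential θ v (X ω)) * total w (X ω)) P := by
  have hm1 := (measurable_potential (θ := θ) v).comp hX
  have hm2 := (measurable_total w).comp hX
  refine Integrable.of_bound
    ((Real.measurable_exp.comp (hm1.const_mul (-s))).mul hm2).aestronglyMeasurable
    ((∑ k, ∑ i, θ.β k i) / s) (ae_of_all _ fun ω => ?_)
  have h0 : 0 ≤ Real.exp (-s * potential θ v (X ω)) * total w (X ω) :=
    mul_nonneg (Real.exp_pos _).le (total_nonneg hw (hX0 ω))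
  rw [Real.norm_eq_abs, abs_of_nonneg h0, le_div_iff₀ hs, mul_comm]
  refine le_trans ?_ (exp_potential_mul_total_le hβ hv (hX0 ω) hs)
  gcongr
  exact total_mono hwv (hX0 ω)

lemma exp_neg_mul_potential_le_one (hβ : ∀ k i, 0 < θ.β k i) {v : Fin 2 → ℝ} (hv : 0 ≤ v)
    {x : Fin K → Fin 2 → ℝ} (hx : 0 ≤ x) {s : ℝ} (hs : 0 ≤ s) :
    Real.exp (-s * potential θ v x) ≤ 1 := by
  refine Real.exp_le_one_iff.2 ?_
  nlinarith [potential_nonneg hβ hv hx]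

/-- A vector that the branching matrix does not contract excludes stationarity. -/
lemma LaplaceIdentity.false_of_le_vecMul [IsProbabilityMeasure P] (hL : LaplaceIdentity θ P X)
    (hμ : ∀ i, 0 < θ.μ i) (hβ : ∀ k i, 0 < θ.β k i)
    (hX : Measurable X) (hX0 : ∀ ω, 0 ≤ X ω) {v : Fin 2 → ℝ} (hv : 0 ≤ v) (hv0 : v ≠ 0)
    (hvw : ∀ j, v j ≤ (v ᵥ* θ.branching) j) : False := by
  have hm1 := (measurable_potential (θ := θ) v).comp hX
  set c : ℝ := ∑ j, v j with hc
  have hvc : ∀ j, v j ≤ c := fun j =>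
    Finset.single_le_sum (f := v) (fun i _ => hv i) (Finset.mem_univ j)
  have hc0 : 0 ≤ c := Finset.sum_nonneg fun j _ => hv j
  set d : ℝ := ∑ j, v j * θ.μ j with hd
  have hd0 : 0 < d := by
    obtain ⟨j, hj⟩ := Function.ne_iff.1 hv0
    exact Finset.sum_pos' (fun i _ => mul_nonneg (hv i) (hμ i).le)
      ⟨j, Finset.mem_univ j, mul_pos ((hv j).lt_of_ne' hj) (hμ j)⟩
  -- `l s` is a lower bound for the drift of the exponential functional
  set l : ℝ → Ω → ℝ := fun s ω => Real.exp (-s * potential θ v (X ω)) *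
    (d - s * (c / 2) * (d + total v (X ω))) with hl
  have hlm : ∀ s, Measurable (l s) := fun s =>
    (Real.measurable_exp.comp (hm1.const_mul (-s))).mul
      ((((measurable_total v).comp hX).const_add d).const_mul (s * (c / 2)) |>.const_sub d)
  -- A bound independent of s: it uses s ≤ 1, exp(-sV) ≤ 1 and s exp(-sV) T_v ≤ ∑ β.
  set M : ℝ := d + c / 2 * (d + ∑ k, ∑ i, θ.β k i) with hM
  have hbound : ∀ s ∈ Ioc (0 : ℝ) 1, ∀ ω, ‖l s ω‖ ≤ M := by
    intro s hs ω
    have he := exp_neg_mul_potential_le_one hβ hv (hX0 ω) hs.1.le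
    have he0 := Real.exp_pos (-s * potential θ v (X ω))
    have ht := exp_potential_mul_total_le hβ hv (hX0 ω) hs.1
    have hT := total_nonneg hv (hX0 ω)
    set e := Real.exp (-s * potential θ v (X ω))
    have h1 : l s ω = e * d - c / 2 * (s * e * d + s * (e * total v (X ω))) := by
      simp only [hl]; ring
    have h2 : 0 ≤ e * d := by positivity
    have h3 : e * d ≤ d := by nlinarith
    have h4 : s * e * d ≤ d := by
      have : s * e ≤ 1 := by nlinarith [hs.1, hs.2]
      nlinarith
    have h5 : 0 ≤ s * e * d + s * (e * total v (X ω)) := by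
      have := hs.1
      positivity
    have h6 : c / 2 * (s * e * d + s * (e * total v (X ω))) ≤
        c / 2 * (d + ∑ k, ∑ i, θ.β k i) :=
      mul_le_mul_of_nonneg_left (by linarith) (by linarith)
    have h7 : 0 ≤ c / 2 * (s * e * d + s * (e * total v (X ω))) := mul_nonneg (by linarith) h5
    rw [h1, Real.norm_eq_abs, abs_le]
    constructor <;> linarith
  have hle : ∀ s ∈ Ioc (0 : ℝ) 1, ∫ ω, l s ω ∂P ≤ 0 := by
    intro s hs
    have hint := integrable_exp_potential_mul_total (P := P) hβ hX hX0 hv hv le_rfl hs.1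
    have hlint : Integrable (l s) P :=
      Integrable.of_bound (hlm s).aestronglyMeasurable M (ae_of_all _ (hbound s hs))
    have key : ∫ ω, s * l s ω ∂P ≤ 0 := by
      refine integral_nonpos_of_lintegral_le (hint.const_mul s) (fun ω => ?_)
        (hlint.const_mul s) ?_
      · exact mul_nonneg hs.1.le (mul_nonneg (Real.exp_pos _).le (total_nonneg hv (hX0 ω)))
      · have h1 := hL v hv s hs.1
        simp only [mul_assoc] at h1
        rw [← h1, ← lintegral_finsetSum]
        · refine lintegral_mono fun ω => ?_
          have hr := rate_nonneg hμ (hX0 ω)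
          -- Since (vG)_j ≥ v_j, the left factor is at least 1 - exp(-s v_j), and its quadratic term
          -- is controlled by v_j ≤ c. Multiplying by λ_j and summing produces (1 - sc/2)(d + T_v);
          -- subtracting T_v leaves the bracket in `l`.
          have hexp : ∀ j, s * v j - s * (c / 2) * (s * v j) ≤
              1 - Real.exp (-s * (v ᵥ* θ.branching) j) := by
            intro j
            have h2 := one_sub_exp_neg_ge (mul_nonneg hs.1.le (hv j))
            have h3 : Real.exp (-s * (v ᵥ* θ.branching) j) ≤ Real.exp (-(s * v j)) := by
              refine Real.exp_le_exp.2 ?_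
              nlinarith [hvw j, hs.1]
            have h4 : (s * v j) ^ 2 ≤ s * c * (s * v j) := by
              have : 0 ≤ s * v j := mul_nonneg hs.1.le (hv j)
              have : s * v j ≤ s * c := mul_le_mul_of_nonneg_left (hvc j) hs.1.le
              nlinarith
            linarith
          have hexp0 : ∀ j, 0 ≤ 1 - Real.exp (-s * (v ᵥ* θ.branching) j) := fun j => by
            refine sub_nonneg.2 (Real.exp_le_one_iff.2 ?_)
            nlinarith [hvw j, hs.1, hv j, mul_nonneg hs.1.le ((hv j).trans (hvw j))]
          rw [← ENNReal.ofReal_sum_of_nonneg fun j _ =>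
            mul_nonneg (Real.exp_pos _).le (mul_nonneg (hexp0 j) (hr j))]
          refine ENNReal.ofReal_le_ofReal ?_
          rw [← Finset.mul_sum]
          have hsum : ∑ j, (s * v j - s * (c / 2) * (s * v j)) * rate θ (X ω) j =
              s * (1 - s * (c / 2)) * (d + total v (X ω)) := by
            rw [hd, ← sum_mul_rate, Finset.mul_sum]
            exact Finset.sum_congr rfl fun j _ => by ring
          calc s * (Real.exp (-s * potential θ v (X ω)) * total v (X ω)) + s * l s ω
              = Real.exp (-s * potential θ v (X ω)) *
                ∑ j, (s * v j - s * (c / 2) * (s * v j)) * rate θ (X ω) j := by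
                rw [hsum]; simp only [hl]; ring
            _ ≤ _ := by
                refine mul_le_mul_of_nonneg_left ?_ (Real.exp_pos _).le
                exact Finset.sum_le_sum fun j _ => mul_le_mul_of_nonneg_right (hexp j) (hr j)
        · intro j _
          exact ((Real.measurable_exp.comp (hm1.const_mul (-s))).mul
            (((measurable_rate j).comp hX).const_mul _)).ennreal_ofReal
    rw [integral_const_mul] at key
    exact nonpos_of_mul_nonpos_right key hs.1
  -- As s → 0 the integrands tend to d, dominated by `M`; the limit of nonpositive integrals would
  -- then be d > 0.
  have hlim : Tendsto (fun s => ∫ ω, l s ω ∂P) (𝓝[Ioc 0 1] 0) (𝓝 (∫ _ω, d ∂P)) := by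
    refine tendsto_integral_filter_of_dominated_convergence (fun _ => M)
      (Eventually.of_forall fun s => (hlm s).aestronglyMeasurable) ?_ (integrable_const M)
      (ae_of_all _ fun ω => ?_)
    · filter_upwards [self_mem_nhdsWithin] with s hs
      exact ae_of_all _ (hbound s hs)
    · have hcont : Continuous fun s => l s ω := by
        simp only [hl]
        fun_prop
      have := hcont.tendsto 0
      simp only [hl, neg_zero, zero_mul, Real.exp_zero, sub_zero, one_mul] at this
      exact this.mono_left nhdsWithin_le_nhds
  have hne : (𝓝[Ioc (0 : ℝ) 1] 0).NeBot := by
    refine mem_closure_iff_nhdsWithin_neBot.1 ?_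
    rw [closure_Ioc zero_ne_one]
    exact ⟨le_rfl, zero_le_one⟩
  have h := le_of_tendsto hlim (eventually_nhdsWithin_of_forall hle)
  rw [integral_const, probReal_univ, one_smul] at h
  linarith

lemma LaplaceIdentity.subcritical [IsProbabilityMeasure P] (hL : LaplaceIdentity θ P X)
    (hμ : ∀ i, 0 < θ.μ i) (hα : ∀ k i j, 0 ≤ θ.α k i j) (hβ : ∀ k i, 0 < θ.β k i)
    (hX : Measurable X) (hX0 : ∀ ω, 0 ≤ X ω) : Subcritical θ.branching := by
  refine (subcritical_or_exists_le_vecMul (branching_nonneg hα hβ)).resolve_right ?_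
  rintro ⟨v, hv, hv0, hvw⟩
  exact hL.false_of_le_vecMul hμ hβ hX hX0 hv hv0 hvw

end Laplace

/-! ### First and second moments from the small-s expansion of the Laplace identity -/

section Moments

variable {P : Measure Ω} {K : ℕ} {θ : Params K} {X : Ω → Fin K → Fin 2 → ℝ}

lemma tendsto_one_sub_exp_div (y : ℝ) : Tendsto
    (fun n : ℕ => (1 - Real.exp (-(1 / ((n : ℝ) + 1)) * y)) / (1 / ((n : ℝ) + 1)))
    atTop (𝓝 y) := by
  have hd : HasDerivAt (fun s : ℝ => 1 - Real.exp (-s * y)) y 0 := by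
    have h := (((hasDerivAt_id (0 : ℝ)).neg.mul_const y).exp).const_sub 1
    simpa using h
  have h := hasDerivAt_iff_tendsto_slope_zero.1 hd
  have hs : Tendsto (fun n : ℕ => 1 / ((n : ℝ) + 1)) atTop (𝓝[≠] 0) :=
    tendsto_nhdsWithin_of_tendsto_nhds_of_eventually_within _
      tendsto_one_div_add_atTop_nhds_zero_nat
      (Eventually.of_forall fun n => Nat.one_div_pos_of_nat.ne')
  refine (h.comp hs).congr fun n => ?_
  simp only [Function.comp, smul_eq_mul, neg_zero, zero_mul, Real.exp_zero, sub_self, sub_zero,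
    zero_add]
  exact (div_eq_inv_mul _ _).symm

/-- The stationary components have finite means. -/
lemma LaplaceIdentity.integrable [IsProbabilityMeasure P] (hL : LaplaceIdentity θ P X)
    (hμ : ∀ i, 0 < θ.μ i) (hα : ∀ k i j, 0 ≤ θ.α k i j) (hβ : ∀ k i, 0 < θ.β k i)
    (hX : Measurable X) (hX0 : ∀ ω, 0 ≤ X ω) (k : Fin K) (i : Fin 2) :
    Integrable (fun ω => X ω k i) P := by
  obtain ⟨v, hvpos, hwv⟩ := (hL.subcritical hμ hα hβ hX hX0).exists_vecMul_lt
    (branching_nonneg hα hβ)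
  have hv : 0 ≤ v := fun i => (hvpos i).le
  set w := v ᵥ* θ.branching with hw
  have hw0 : 0 ≤ w := vecMul_branching_nonneg hα hβ hv
  have hwv' : w ≤ v := fun j => (hwv j).le
  have hvw0 : 0 ≤ v - w := fun j => sub_nonneg.2 (hwv j).le
  have hm1 := (measurable_potential (θ := θ) v).comp hX
  have hme : ∀ s : ℝ, Measurable fun ω => Real.exp (-s * potential θ v (X ω)) := fun s =>
    Real.measurable_exp.comp (hm1.const_mul (-s))
  have hmt : ∀ u : Fin 2 → ℝ, Measurable fun ω => total u (X ω) := fun u =>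
    (measurable_total u).comp hX
  -- By 1 - exp(-s w_j) ≤ s w_j, the identity gives E[exp(-sV) T_v] ≤ w·μ + E[exp(-sV) T_w]; the
  -- last term is finite and is cancelled, leaving a bound free of s.
  have htrunc : ∀ s : ℝ, 0 < s → ∫⁻ ω, ENNReal.ofReal
      (Real.exp (-s * potential θ v (X ω)) * total (v - w) (X ω)) ∂P ≤
      ENNReal.ofReal (∑ j, w j * θ.μ j) := by
    intro s hs
    have hfin : ∫⁻ ω, ENNReal.ofReal
        (Real.exp (-s * potential θ v (X ω)) * total w (X ω)) ∂P ≠ ∞ :=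
      ((hasFiniteIntegral_iff_ofReal (ae_of_all _ fun ω => mul_nonneg (Real.exp_pos _).le
        (total_nonneg hw0 (hX0 ω)))).1
        (integrable_exp_potential_mul_total (P := P) hβ hX hX0 hv hw0 hwv' hs).2).ne
    have hmet : Measurable fun ω => ENNReal.ofReal
        (Real.exp (-s * potential θ v (X ω)) * total (v - w) (X ω)) :=
      ((hme s).mul (hmt _)).ennreal_ofReal
    rw [← ENNReal.add_le_add_iff_right hfin, ← lintegral_add_left hmet,
      ← ENNReal.mul_le_mul_iff_right (a := ENNReal.ofReal s) (by simpa using hs)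
        ENNReal.ofReal_ne_top, ← lintegral_const_mul']
    swap
    · exact ENNReal.ofReal_ne_top
    calc _ = ∫⁻ ω, ENNReal.ofReal (s * Real.exp (-s * potential θ v (X ω)) * total v (X ω)) ∂P := by
          refine lintegral_congr fun ω => ?_
          rw [← ENNReal.ofReal_add (mul_nonneg (Real.exp_pos _).le (total_nonneg hvw0 (hX0 ω)))
            (mul_nonneg (Real.exp_pos _).le (total_nonneg hw0 (hX0 ω))),
            ← ENNReal.ofReal_mul hs.le, total_sub]
          congr 1
          ring
      _ = _ := (hL v hv s hs).symm
      _ = ∫⁻ ω, ∑ j, ENNReal.ofReal (Real.exp (-s * potential θ v (X ω)) *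
            (1 - Real.exp (-s * w j)) * rate θ (X ω) j) ∂P := by
          rw [lintegral_finsetSum]
          exact fun j _ => (((hme s).mul_const _).mul ((measurable_rate j).comp hX)).ennreal_ofReal
      _ ≤ ∫⁻ ω, ENNReal.ofReal s * (ENNReal.ofReal (∑ j, w j * θ.μ j) + ENNReal.ofReal
            (Real.exp (-s * potential θ v (X ω)) * total w (X ω))) ∂P := by
          refine lintegral_mono fun ω => ?_
          have he := exp_neg_mul_potential_le_one hβ hv (hX0 ω) hs.le
          have he0 := Real.exp_pos (-s * potential θ v (X ω))
          have hr := rate_nonneg hμ (hX0 ω)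
          have h1 : ∀ j, 0 ≤ 1 - Real.exp (-s * w j) := fun j =>
            sub_nonneg.2 (Real.exp_le_one_iff.2 (by nlinarith [mul_nonneg hs.le (hw0 j)]))
          have h2 : ∀ j, 1 - Real.exp (-s * w j) ≤ s * w j := fun j => by
            have := Real.add_one_le_exp (-s * w j)
            linarith
          have h3 : 0 ≤ ∑ j, w j * θ.μ j :=
            Finset.sum_nonneg fun j _ => mul_nonneg (hw0 j) (hμ j).le
          rw [← ENNReal.ofReal_sum_of_nonneg fun j _ =>
              mul_nonneg (mul_nonneg he0.le (h1 j)) (hr j),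
            ← ENNReal.ofReal_add h3 (mul_nonneg he0.le (total_nonneg hw0 (hX0 ω))),
            ← ENNReal.ofReal_mul hs.le]
          refine ENNReal.ofReal_le_ofReal ?_
          calc _ ≤ ∑ j, Real.exp (-s * potential θ v (X ω)) * (s * w j) * rate θ (X ω) j := by
                refine Finset.sum_le_sum fun j _ => mul_le_mul_of_nonneg_right ?_ (hr j)
                exact mul_le_mul_of_nonneg_left (h2 j) he0.le
            _ = s * (Real.exp (-s * potential θ v (X ω)) * (∑ j, w j * θ.μ j + total w (X ω))) := by
                rw [← sum_mul_rate, Finset.mul_sum, Finset.mul_sum]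
                exact Finset.sum_congr rfl fun j _ => by ring
            _ ≤ _ := by
                refine mul_le_mul_of_nonneg_left ?_ hs.le
                rw [mul_add]
                gcongr
                exact mul_le_of_le_one_left h3 he
      _ = _ := by
          rw [lintegral_const_mul' _ _ ENNReal.ofReal_ne_top,
            lintegral_add_left measurable_const, lintegral_const, measure_univ, mul_one]
  have hfinal : ∫⁻ ω, ENNReal.ofReal (total (v - w) (X ω)) ∂P ≤
      ENNReal.ofReal (∑ j, w j * θ.μ j) := by
    refine lintegral_le_of_tendsto_of_le (F := fun (n : ℕ) ω => ENNReal.ofReal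
      (Real.exp (-(1 / ((n : ℝ) + 1)) * potential θ v (X ω)) * total (v - w) (X ω)))
      (fun n => ((hme _).mul (hmt _)).ennreal_ofReal) (fun ω => ?_)
      (fun n => htrunc _ Nat.one_div_pos_of_nat)
    refine ENNReal.tendsto_ofReal ?_
    have hcont : Continuous fun s : ℝ =>
        Real.exp (-s * potential θ v (X ω)) * total (v - w) (X ω) := by fun_prop
    have := (hcont.tendsto 0).comp tendsto_one_div_add_atTop_nhds_zero_nat
    simpa [Function.comp_def] using this
  have hint : Integrable (fun ω => total (v - w) (X ω)) P :=
    ⟨(hmt _).aestronglyMeasurable, (hasFiniteIntegral_iff_ofReal (ae_of_all _ fun ω =>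
      total_nonneg hvw0 (hX0 ω))).2 (hfinal.trans_lt ENNReal.ofReal_lt_top)⟩
  refine (hint.const_mul ((v i - w i)⁻¹)).mono'
    ((measurable_pi_apply i).comp ((measurable_pi_apply k).comp hX)).aestronglyMeasurable
    (ae_of_all _ fun ω => ?_)
  have hpos : 0 < v i - w i := sub_pos.2 (hwv i)
  rw [Real.norm_eq_abs, abs_of_nonneg (hX0 ω k i), le_inv_mul_iff₀ hpos]
  exact mul_le_total hvw0 (hX0 ω) k i

/-- The stationary components have finite second moments. -/
lemma LaplaceIdentity.integrable_mul [IsProbabilityMeasure P] (hL : LaplaceIdentity θ P X)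
    (hμ : ∀ i, 0 < θ.μ i) (hα : ∀ k i j, 0 ≤ θ.α k i j) (hβ : ∀ k i, 0 < θ.β k i)
    (hX : Measurable X) (hX0 : ∀ ω, 0 ≤ X ω)
    (hmean : ∀ k i, ∫ ω, X ω k i ∂P = (θ.β k i)⁻¹ * ∑ j, θ.α k i j * ∫ ω, rate θ (X ω) j ∂P)
    (k l : Fin K) (i j : Fin 2) : Integrable (fun ω => X ω k i * X ω l j) P := by
  obtain ⟨v, hvpos, hwv⟩ := (hL.subcritical hμ hα hβ hX hX0).exists_vecMul_lt
    (branching_nonneg hα hβ)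
  have hv : 0 ≤ v := fun i => (hvpos i).le
  set w := v ᵥ* θ.branching with hw
  have hw0 : 0 ≤ w := vecMul_branching_nonneg hα hβ hv
  have hvw0 : 0 ≤ v - w := fun j => sub_nonneg.2 (hwv j).le
  have hXint := hL.integrable hμ hα hβ hX hX0
  have hmk : ∀ k i, Measurable fun ω => X ω k i := fun k i =>
    (measurable_pi_apply i).comp ((measurable_pi_apply k).comp hX)
  have hm1 : Measurable fun ω => potential θ v (X ω) := (measurable_potential (θ := θ) v).comp hX
  have hme : ∀ s : ℝ, Measurable fun ω => Real.exp (-s * potential θ v (X ω)) := fun s =>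
    Real.measurable_exp.comp (hm1.const_mul (-s))
  have hmt : ∀ u : Fin 2 → ℝ, Measurable fun ω => total u (X ω) := fun u =>
    (measurable_total u).comp hX
  have hVint : Integrable (fun ω => potential θ v (X ω)) P :=
    integrable_finsetSum _ fun k _ => integrable_finsetSum _ fun i _ => (hXint k i).const_mul _
  have hTint : ∀ u : Fin 2 → ℝ, Integrable (fun ω => total u (X ω)) P := fun u =>
    integrable_finsetSum _ fun k _ => integrable_finsetSum _ fun i _ => (hXint k i).const_mul _
  have hRint : ∀ j, Integrable (fun ω => rate θ (X ω) j) P := fun j =>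
    (integrable_const _).add (integrable_finsetSum _ fun k _ => hXint k j)
  have hEint : ∀ {s : ℝ}, 0 < s → ∀ {f : Ω → ℝ}, Integrable f P →
      Integrable (fun ω => Real.exp (-s * potential θ v (X ω)) * f ω) P := by
    intro s hs f hf
    refine hf.bdd_mul (c := 1) (hme s).aestronglyMeasurable (ae_of_all _ fun ω => ?_)
    rw [Real.norm_eq_abs, abs_of_pos (Real.exp_pos _)]
    exact exp_neg_mul_potential_le_one hβ hv (hX0 ω) hs.le
  -- Mean balance of the potential: the outflow E[T_v] equals the inflow by jumps w_j at rates λ_j.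
  have hmean' : ∫ ω, total v (X ω) ∂P = ∑ j, w j * ∫ ω, rate θ (X ω) j ∂P := by
    unfold total
    rw [integral_finsetSum _ fun k _ => integrable_finsetSum _ fun i _ => (hXint k i).const_mul _]
    simp_rw [integral_finsetSum _ fun i _ => (hXint _ i).const_mul (v i), integral_const_mul,
      hmean, hw, Matrix.vecMul, dotProduct, branching_apply hβ]
    rw [Finset.sum_comm]
    simp_rw [Finset.sum_mul]
    rw [Finset.sum_comm (s := Finset.univ (α := Fin 2)) (t := Finset.univ (α := Fin 2))]
    refine Finset.sum_congr rfl fun i _ => ?_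
    simp_rw [Finset.mul_sum, Finset.sum_mul]
    rw [Finset.sum_comm]
    exact Finset.sum_congr rfl fun j _ => Finset.sum_congr rfl fun k _ => by ring
  -- The factor (1 - exp(-sV)) / s approximates V. The bound comes from subtracting the damped
  -- balance from the undamped one and dividing by s, and it does not depend on s.
  have htrunc : ∀ s : ℝ, 0 < s → ∫⁻ ω, ENNReal.ofReal
      ((1 - Real.exp (-s * potential θ v (X ω))) / s * total (v - w) (X ω)) ∂P ≤
      ENNReal.ofReal ((∑ j, w j * θ.μ j) * ∫ ω, potential θ v (X ω) ∂P +
        ∑ j, w j ^ 2 / 2 * ∫ ω, rate θ (X ω) j ∂P) := by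
    intro s hs
    have hexp1 : ∀ j, 0 ≤ 1 - Real.exp (-s * w j) := fun j =>
      sub_nonneg.2 (Real.exp_le_one_iff.2 (by nlinarith [mul_nonneg hs.le (hw0 j)]))
    set E : (Fin 2 → ℝ) → ℝ := fun u =>
      ∫ ω, Real.exp (-s * potential θ v (X ω)) * total u (X ω) ∂P with hE
    set Q : Fin 2 → ℝ := fun j =>
      ∫ ω, Real.exp (-s * potential θ v (X ω)) * rate θ (X ω) j ∂P with hQ
    set e₀ : ℝ := ∫ ω, Real.exp (-s * potential θ v (X ω)) ∂P with he₀
    have he₀int : Integrable (fun ω => Real.exp (-s * potential θ v (X ω))) P := by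
      simpa using hEint hs (integrable_const (1 : ℝ))
    have hQ0 : ∀ j, 0 ≤ Q j := fun j =>
      integral_nonneg fun ω => mul_nonneg (Real.exp_pos _).le (rate_nonneg hμ (hX0 ω) j)
    have hQle : ∀ j, Q j ≤ ∫ ω, rate θ (X ω) j ∂P := fun j =>
      integral_mono (hEint hs (hRint j)) (hRint j) fun ω =>
        mul_le_of_le_one_left (rate_nonneg hμ (hX0 ω) j)
          (exp_neg_mul_potential_le_one hβ hv (hX0 ω) hs.le)
    have hlap : ∑ j, (1 - Real.exp (-s * w j)) * Q j = s * E v := by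
      have h1 := hL v hv s hs
      have h2 : ∀ j, ∫⁻ ω, ENNReal.ofReal (Real.exp (-s * potential θ v (X ω)) *
          (1 - Real.exp (-s * w j)) * rate θ (X ω) j) ∂P =
          ENNReal.ofReal ((1 - Real.exp (-s * w j)) * Q j) := by
        intro j
        rw [hQ, ← integral_const_mul, ofReal_integral_eq_lintegral_ofReal
          ((hEint hs (hRint j)).const_mul _) (ae_of_all _ fun ω => mul_nonneg (hexp1 j)
            (mul_nonneg (Real.exp_pos _).le (rate_nonneg hμ (hX0 ω) j)))]
        refine lintegral_congr fun ω => ?_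
        congr 1
        ring
      have h3 : ∫⁻ ω, ENNReal.ofReal (s * Real.exp (-s * potential θ v (X ω)) *
          total v (X ω)) ∂P = ENNReal.ofReal (s * E v) := by
        rw [hE, ← integral_const_mul, ofReal_integral_eq_lintegral_ofReal
          ((hEint hs (hTint v)).const_mul _) (ae_of_all _ fun ω => mul_nonneg hs.le
            (mul_nonneg (Real.exp_pos _).le (total_nonneg hv (hX0 ω))))]
        simp only [mul_assoc]
      rw [h3, Finset.sum_congr rfl fun j _ => h2 j, ← ENNReal.ofReal_sum_of_nonneg
        fun j _ => mul_nonneg (hexp1 j) (hQ0 j), ENNReal.ofReal_eq_ofReal_iff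
        (Finset.sum_nonneg fun j _ => mul_nonneg (hexp1 j) (hQ0 j))] at h1
      · exact h1
      · exact mul_nonneg hs.le (integral_nonneg fun ω =>
          mul_nonneg (Real.exp_pos _).le (total_nonneg hv (hX0 ω)))
    have hsumE : ∑ j, w j * Q j = (∑ j, w j * θ.μ j) * e₀ + E w := by
      rw [hQ, he₀, hE, ← integral_const_mul, ← integral_add (he₀int.const_mul _)
        (hEint hs (hTint w))]
      simp_rw [← integral_const_mul]
      rw [← integral_finsetSum _ fun j _ => (hEint hs (hRint j)).const_mul (w j)]
      refine integral_congr_ae (ae_of_all _ fun ω => ?_)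
      simp only
      rw [mul_comm _ (Real.exp _), ← mul_add, ← sum_mul_rate, Finset.mul_sum]
      exact Finset.sum_congr rfl fun j _ => by ring
    have hsumT : ∑ j, w j * ∫ ω, rate θ (X ω) j ∂P =
        ∑ j, w j * θ.μ j + ∫ ω, total w (X ω) ∂P := by
      have h1 : ∫ ω, (∑ j, w j * θ.μ j + total w (X ω)) ∂P =
          ∑ j, w j * θ.μ j + ∫ ω, total w (X ω) ∂P := by
        rw [integral_add (integrable_const _) (hTint w), integral_const, probReal_univ, one_smul]
      rw [← h1]
      simp_rw [← integral_const_mul, ← sum_mul_rate]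
      rw [integral_finsetSum _ fun j _ => (hRint j).const_mul (w j)]
    -- The quadratic correction is kept here: dividing by s² in total must leave a finite constant,
    -- the sum of w_j² m_j / 2.
    have hlow : s * ∑ j, w j * Q j - s ^ 2 * ∑ j, w j ^ 2 / 2 * ∫ ω, rate θ (X ω) j ∂P ≤
        s * E v := by
      rw [← hlap, Finset.mul_sum, Finset.mul_sum, ← Finset.sum_sub_distrib]
      refine Finset.sum_le_sum fun j _ => ?_
      have h1 := one_sub_exp_neg_ge (mul_nonneg hs.le (hw0 j))
      rw [← neg_mul] at h1
      have h2 := mul_le_mul_of_nonneg_right h1 (hQ0 j)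
      have h3 : (s * w j) ^ 2 / 2 * Q j ≤ (s * w j) ^ 2 / 2 * ∫ ω, rate θ (X ω) j ∂P :=
        mul_le_mul_of_nonneg_left (hQle j) (by positivity)
      linarith
    have he₀le : 1 - e₀ ≤ s * ∫ ω, potential θ v (X ω) ∂P := by
      have h1 : (1 : ℝ) = ∫ _ω, (1 : ℝ) ∂P := by simp
      rw [h1, he₀, ← integral_sub (integrable_const _) he₀int, ← integral_const_mul]
      refine integral_mono ((integrable_const _).sub he₀int) (hVint.const_mul s) fun ω => ?_
      have := Real.add_one_le_exp (-s * potential θ v (X ω))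
      simp only
      linarith
    have hphi : Integrable (fun ω => (1 - Real.exp (-s * potential θ v (X ω))) / s *
        total (v - w) (X ω)) P := by
      have := ((hTint (v - w)).sub (hEint hs (hTint (v - w)))).div_const s
      refine this.congr (ae_of_all _ fun ω => ?_)
      simp only [Pi.sub_apply]
      ring
    rw [← ofReal_integral_eq_lintegral_ofReal hphi (ae_of_all _ fun ω => mul_nonneg
      (div_nonneg (sub_nonneg.2 (exp_neg_mul_potential_le_one hβ hv (hX0 ω) hs.le)) hs.le)
      (total_nonneg hvw0 (hX0 ω)))]
    refine ENNReal.ofReal_le_ofReal ?_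
    -- With E[T_v] - E[T_w] = w·μ, the right side is w·μ - (E v - E w). The lower bound on E v
    -- reduces it to w·μ (1 - e₀) plus a term of order s, and 1 - e₀ ≤ s E[V].
    have hval : s * ∫ ω, (1 - Real.exp (-s * potential θ v (X ω))) / s * total (v - w) (X ω) ∂P =
        (∫ ω, total v (X ω) ∂P - ∫ ω, total w (X ω) ∂P) - (E v - E w) := by
      have h1 : Integrable (fun ω => total v (X ω) - total w (X ω)) P := (hTint v).sub (hTint w)
      have h2 : Integrable (fun ω => Real.exp (-s * potential θ v (X ω)) * total v (X ω) -
          Real.exp (-s * potential θ v (X ω)) * total w (X ω)) P :=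
        (hEint hs (hTint v)).sub (hEint hs (hTint w))
      rw [hE, ← integral_sub (hTint v) (hTint w),
        ← integral_sub (hEint hs (hTint v)) (hEint hs (hTint w)),
        ← integral_sub h1 h2, ← integral_const_mul]
      refine integral_congr_ae (ae_of_all _ fun ω => ?_)
      simp only [total_sub]
      field_simp
    rw [hmean', hsumT] at hval
    have hwμ : 0 ≤ ∑ j, w j * θ.μ j := Finset.sum_nonneg fun j _ => mul_nonneg (hw0 j) (hμ j).le
    refine le_of_mul_le_mul_left ?_ hs
    rw [hval]
    have h1 : ∑ j, w j * Q j - s * ∑ j, w j ^ 2 / 2 * ∫ ω, rate θ (X ω) j ∂P ≤ E v := by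
      refine le_of_mul_le_mul_left ?_ hs
      linarith
    have h2 := mul_le_mul_of_nonneg_left he₀le hwμ
    linarith
  have hfinal : ∫⁻ ω, ENNReal.ofReal (potential θ v (X ω) * total (v - w) (X ω)) ∂P ≤
      ENNReal.ofReal ((∑ j, w j * θ.μ j) * ∫ ω, potential θ v (X ω) ∂P +
        ∑ j, w j ^ 2 / 2 * ∫ ω, rate θ (X ω) j ∂P) := by
    refine lintegral_le_of_tendsto_of_le (F := fun (n : ℕ) ω => ENNReal.ofReal
      ((1 - Real.exp (-(1 / ((n : ℝ) + 1)) * potential θ v (X ω))) / (1 / ((n : ℝ) + 1)) *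
        total (v - w) (X ω)))
      (fun n => ((((hme _).const_sub 1).div_const _).mul (hmt _)).ennreal_ofReal) (fun ω => ?_)
      (fun n => htrunc _ Nat.one_div_pos_of_nat)
    refine ENNReal.tendsto_ofReal (Tendsto.mul_const _ ?_)
    exact tendsto_one_sub_exp_div _
  have hint : Integrable (fun ω => potential θ v (X ω) * total (v - w) (X ω)) P :=
    ⟨(hm1.mul (hmt _)).aestronglyMeasurable, (hasFiniteIntegral_iff_ofReal (ae_of_all _ fun ω =>
      mul_nonneg (potential_nonneg hβ hv (hX0 ω)) (total_nonneg hvw0 (hX0 ω)))).2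
      (hfinal.trans_lt ENNReal.ofReal_lt_top)⟩
  -- All weights in V and in T_{v-w} are positive, so each coordinate is dominated by either
  -- functional, and a product of two coordinates by V T_{v-w}.
  have hpos : 0 < v j - w j := sub_pos.2 (hwv j)
  have hpos' : 0 < v i / θ.β k i := div_pos (hvpos i) (hβ k i)
  refine (hint.const_mul ((v i / θ.β k i)⁻¹ * (v j - w j)⁻¹)).mono'
    ((hmk k i).mul (hmk l j)).aestronglyMeasurable (ae_of_all _ fun ω => ?_)
  rw [Real.norm_eq_abs, abs_of_nonneg (mul_nonneg (hX0 ω k i) (hX0 ω l j)), mul_mul_mul_comm]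
  refine mul_le_mul ?_ ?_ (hX0 ω l j) (mul_nonneg (inv_nonneg.2 hpos'.le)
    (potential_nonneg hβ hv (hX0 ω)))
  · rw [le_inv_mul_iff₀ hpos']
    exact div_mul_le_potential hβ hv (hX0 ω) k i
  · rw [le_inv_mul_iff₀ hpos]
    exact mul_le_total hvw0 (hX0 ω) l j

end Moments

/-! ### Expectations in the steady state -/

section SteadyState

variable {P : Measure Ω} {ℱ : Filtration ℝ mΩ} {K : ℕ} {θ : Params K} {S : Fin 2 → Ω → Set ℝ}

lemma IsPointProcess.measurable_state_prod (hS : IsPointProcess P ℱ S)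
    (hα : ∀ k i j, 0 ≤ θ.α k i j) :
    Measurable[predictable ℱ] fun p : ℝ × Ω => state θ S p.1 p.2 :=
  @measurable_pi_lambda _ _ _ (predictable ℱ) _ _ fun k =>
    @measurable_pi_lambda _ _ _ (predictable ℱ) _ _ fun i => hS.measurable_component hα k i

lemma IsPointProcess.measurable_state (hS : IsPointProcess P ℱ S)
    (hα : ∀ k i j, 0 ≤ θ.α k i j) (t : ℝ) : Measurable (state θ S t) :=
  ((hS.measurable_state_prod hα).mono (predictable_le ℱ) le_rfl).comp measurable_prodMk_left

lemma IsSteadyState.identDistrib_comp (hss : IsSteadyState θ P S) {E : Type*}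
    [MeasurableSpace E] {f : (Fin K → Fin 2 → ℝ) → E} (hf : Measurable f) {t : ℝ} (ht : 0 ≤ t) :
    IdentDistrib (fun ω => f (state θ S t ω)) (fun ω => f (state θ S 0 ω)) P P :=
  (hss t ht).comp hf

lemma IsSteadyState.lintegral_eq (hss : IsSteadyState θ P S)
    {f : (Fin K → Fin 2 → ℝ) → ℝ≥0∞} (hf : Measurable f) {t : ℝ} (ht : 0 ≤ t) :
    ∫⁻ ω, f (state θ S t ω) ∂P = ∫⁻ ω, f (state θ S 0 ω) ∂P :=
  (hss.identDistrib_comp hf ht).lintegral_eq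

lemma intensity_eq_rate (t : ℝ) (ω : Ω) (j : Fin 2) :
    intensity θ S t ω j = rate θ (state θ S t ω) j := rfl

/-- The pathwise identity is integrated over [0, 1]. The boundary terms have the same law and are at
most 1, so they cancel; the remaining time integrals have constant integrands over an interval of
length one. -/
lemma IsHawkes.laplaceIdentity [IsProbabilityMeasure P] (hS : IsHawkes θ P ℱ S)
    (hss : IsSteadyState θ P S) (hα : ∀ k i j, 0 ≤ θ.α k i j) (hβ : ∀ k i, 0 < θ.β k i) :
    LaplaceIdentity θ P (state θ S 0) := by
  intro v hv s hs
  set w := v ᵥ* θ.branching with hw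
  have hw0 : 0 ≤ w := vecMul_branching_nonneg hα hβ hv
  have hexp1 : ∀ j, 0 ≤ 1 - Real.exp (-s * w j) := fun j =>
    sub_nonneg.2 (Real.exp_le_one_iff.2 (by nlinarith [mul_nonneg hs.le (hw0 j)]))
  have hme : Measurable fun x => Real.exp (-s * potential θ v x) :=
    Real.measurable_exp.comp ((measurable_potential (θ := θ) v).const_mul (-s))
  have hst := hS.pointProcess.measurable_state hα
  have hC : ∀ j, Measurable[predictable ℱ] fun p : ℝ × Ω => ENNReal.ofReal
      (Real.exp (-s * potential θ v (state θ S p.1 p.2)) * (1 - Real.exp (-s * w j))) := fun j =>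
    (((hme.mul_const _).ennreal_ofReal).comp (hS.pointProcess.measurable_state_prod hα))
  have hmT : Measurable fun x : Fin K → Fin 2 → ℝ => ENNReal.ofReal
      (s * Real.exp (-s * potential θ v x) * total v x) :=
    ((hme.const_mul s).mul (measurable_total v)).ennreal_ofReal
  have h1 : ∫⁻ ω, (ENNReal.ofReal (Real.exp (-s * potential θ v (state θ S 1 ω))) +
      ∑ j, ∫⁻ u in Ico 0 1, ENNReal.ofReal (Real.exp (-s * potential θ v (state θ S u ω)) *
        (1 - Real.exp (-s * w j))) ∂(eventMeasure S j ω)) ∂P =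
      ∫⁻ ω, (ENNReal.ofReal (Real.exp (-s * potential θ v (state θ S 0 ω))) +
      ∫⁻ u in Ico 0 1, ENNReal.ofReal (s * Real.exp (-s * potential θ v (state θ S u ω)) *
        total v (state θ S u ω))) ∂P := by
    refine lintegral_congr_ae ?_
    filter_upwards [hS.ae_regular] with ω hω
    exact hS.pointProcess.exp_potential hω hα hβ hv hs.le one_pos
  have hmt : ∀ t, Measurable fun ω =>
      ENNReal.ofReal (Real.exp (-s * potential θ v (state θ S t ω))) := fun t =>
    hme.ennreal_ofReal.comp (hst t)
  rw [lintegral_add_left (hmt 1), lintegral_add_left (hmt 0),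
    hss.lintegral_eq hme.ennreal_ofReal zero_le_one,
    lintegral_finsetSum _ fun j _ => hS.pointProcess.measurable_lintegral_Ico j (hC j) 0 1] at h1
  have hfin : ∫⁻ ω, ENNReal.ofReal (Real.exp (-s * potential θ v (state θ S 0 ω))) ∂P ≠ ∞ := by
    refine ne_of_lt ((lintegral_mono (g := fun _ => 1) fun ω => ?_).trans_lt (by simp))
    exact ENNReal.ofReal_le_one.2
      (exp_neg_mul_potential_le_one hβ hv (state_nonneg hα 0 ω) hs.le)
  have h2 := (ENNReal.add_right_inj hfin).1 h1
  rw [lintegral_lintegral_swap] at h2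
  · have h3 : ∀ u ∈ Ico (0 : ℝ) 1, ∫⁻ ω, ENNReal.ofReal
        (s * Real.exp (-s * potential θ v (state θ S u ω)) * total v (state θ S u ω)) ∂P =
        ∫⁻ ω, ENNReal.ofReal (s * Real.exp (-s * potential θ v (state θ S 0 ω)) *
          total v (state θ S 0 ω)) ∂P := fun u hu => hss.lintegral_eq hmT hu.1
    rw [setLIntegral_congr_fun measurableSet_Ico h3, setLIntegral_const, Real.volume_Ico, sub_zero,
      ENNReal.ofReal_one, mul_one] at h2
    rw [← h2]
    refine Finset.sum_congr rfl fun j _ => ?_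
    rw [hS.lintegral_eventMeasure hα j (hC j) measurableSet_Ico]
    have hmR : Measurable fun x : Fin K → Fin 2 → ℝ => ENNReal.ofReal
        (Real.exp (-s * potential θ v x) * (1 - Real.exp (-s * w j)) * rate θ x j) :=
      ((hme.mul_const _).mul (measurable_rate j)).ennreal_ofReal
    have h4 : ∀ u ∈ Ico (0 : ℝ) 1, ∫⁻ ω, ENNReal.ofReal
        (Real.exp (-s * potential θ v (state θ S u ω)) * (1 - Real.exp (-s * w j))) *
          ENNReal.ofReal (intensity θ S u ω j) ∂P =
        ∫⁻ ω, ENNReal.ofReal (Real.exp (-s * potential θ v (state θ S 0 ω)) *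
          (1 - Real.exp (-s * w j)) * rate θ (state θ S 0 ω) j) ∂P := fun u hu => by
      rw [← hss.lintegral_eq hmR hu.1]
      refine lintegral_congr fun ω => ?_
      rw [← ENNReal.ofReal_mul (mul_nonneg (Real.exp_pos _).le (hexp1 j)), intensity_eq_rate]
    rw [setLIntegral_congr_fun measurableSet_Ico h4, setLIntegral_const, Real.volume_Ico, sub_zero,
      ENNReal.ofReal_one, mul_one]
  · have hm := (hmT.comp (hS.pointProcess.measurable_state_prod hα)).mono (predictable_le ℱ) le_rfl
    exact (hm.comp measurable_swap).aemeasurable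

lemma integral_exp_neg_mul_sub {b : ℝ} (hb : 0 < b) (t : ℝ) :
    ∫ u in (0 : ℝ)..t, Real.exp (-b * (t - u)) = (1 - Real.exp (-b * t)) / b := by
  have hd : ∀ u, HasDerivAt (fun u => Real.exp (-b * (t - u)) / b) (Real.exp (-b * (t - u))) u := by
    intro u
    have h1 : HasDerivAt (fun u => -b * (t - u)) b u := by
      simpa using ((hasDerivAt_id u).const_sub t).const_mul (-b)
    refine (h1.exp.div_const b).congr_deriv ?_
    field_simp
  rw [intervalIntegral.integral_eq_sub_of_hasDerivAt (fun u _ => hd u)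
    ((by fun_prop : Continuous fun u => Real.exp (-b * (t - u))).intervalIntegrable _ _)]
  simp
  ring

lemma lintegral_Ico_ofReal {t : ℝ} (ht : 0 ≤ t) {g : ℝ → ℝ}
    (hg : IntegrableOn g (Ico 0 t)) (hg0 : ∀ u ∈ Ico 0 t, 0 ≤ g u) :
    ∫⁻ u in Ico 0 t, ENNReal.ofReal (g u) = ENNReal.ofReal (∫ u in (0 : ℝ)..t, g u) := by
  rw [← ofReal_integral_eq_lintegral_ofReal hg
    ((ae_restrict_iff' measurableSet_Ico).2 (ae_of_all _ hg0)), integral_Ico_eq_integral_Ioc,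
    intervalIntegral.integral_of_le ht]

/-- In the steady state `E[λ_k] = β_k⁻¹ α_k E[λ]`. -/
lemma IsHawkes.integral_state [IsProbabilityMeasure P] (hS : IsHawkes θ P ℱ S)
    (hss : IsSteadyState θ P S) (hμ : ∀ i, 0 < θ.μ i) (hα : ∀ k i j, 0 ≤ θ.α k i j)
    (hβ : ∀ k i, 0 < θ.β k i) (hint : ∀ k i, Integrable (fun ω => state θ S 0 ω k i) P)
    (k : Fin K) (i : Fin 2) :
    ∫ ω, state θ S 0 ω k i ∂P =
      (θ.β k i)⁻¹ * ∑ j, θ.α k i j * ∫ ω, rate θ (state θ S 0 ω) j ∂P := by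
  have hRint : ∀ j, Integrable (fun ω => rate θ (state θ S 0 ω) j) P := fun j =>
    (integrable_const _).add (integrable_finsetSum _ fun k _ => hint k j)
  set m : Fin 2 → ℝ := fun j => ∫ ω, rate θ (state θ S 0 ω) j ∂P with hm
  have hm0 : ∀ j, 0 ≤ m j := fun j =>
    integral_nonneg fun ω => rate_nonneg hμ (state_nonneg hα 0 ω) j
  set x : ℝ := ∫ ω, state θ S 0 ω k i ∂P with hx
  have hx0 : 0 ≤ x := integral_nonneg fun ω => state_nonneg hα 0 ω k i
  have hmk : Measurable fun x : Fin K → Fin 2 → ℝ => ENNReal.ofReal (x k i) :=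
    ((measurable_pi_apply i).comp (measurable_pi_apply k)).ennreal_ofReal
  have hxE : ∀ t, 0 ≤ t → ∫⁻ ω, ENNReal.ofReal (state θ S t ω k i) ∂P = ENNReal.ofReal x := by
    intro t ht
    rw [hss.lintegral_eq hmk ht, hx, ofReal_integral_eq_lintegral_ofReal (hint k i)
      (ae_of_all _ fun ω => state_nonneg hα 0 ω k i)]
  have hmE : ∀ j t, 0 ≤ t → ∫⁻ ω, ENNReal.ofReal (intensity θ S t ω j) ∂P =
      ENNReal.ofReal (m j) := by
    intro j t ht
    simp only [intensity_eq_rate]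
    rw [hss.lintegral_eq (measurable_rate j).ennreal_ofReal ht, hm,
      ofReal_integral_eq_lintegral_ofReal (hRint j)
      (ae_of_all _ fun ω => rate_nonneg hμ (state_nonneg hα 0 ω) j)]
  have hC : ∀ j, Measurable[predictable ℱ] fun p : ℝ × Ω =>
      ENNReal.ofReal (θ.kernel k (1 - p.1) i j) := fun j =>
    (((measurable_kernel k i j).comp (measurable_const.sub measurable_id)).ennreal_ofReal).comp
      (measurable_predictable_fst ℱ)
  -- In the mean, one unit of time gives x = exp(-β) x + ∑_j α_{ijk} m_j (1 - exp(-β)) / β, which is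
  -- solved for x since exp(-β) < 1.
  have h1 : ∫⁻ ω, ENNReal.ofReal (state θ S 1 ω k i) ∂P =
      ∫⁻ ω, (ENNReal.ofReal (Real.exp (-θ.β k i * (1 - 0))) *
        ENNReal.ofReal (state θ S 0 ω k i) +
      ∑ j, ∫⁻ u in Ico 0 1, ENNReal.ofReal (θ.kernel k (1 - u) i j) ∂(eventMeasure S j ω)) ∂P := by
    refine lintegral_congr_ae ?_
    filter_upwards [hS.ae_regular] with ω hω
    simp only [state, hω.ofReal_component hα]
    exact componentE_eq_add k zero_le_one ω i
  have hst := hS.pointProcess.measurable_state (θ := θ) hα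
  have hm0' : Measurable fun ω => ENNReal.ofReal (Real.exp (-θ.β k i * (1 - 0))) *
      ENNReal.ofReal (state θ S 0 ω k i) := (hmk.comp (hst 0)).const_mul _
  rw [lintegral_add_left hm0', hxE 1 zero_le_one,
    lintegral_const_mul' _ _ ENNReal.ofReal_ne_top, hxE 0 le_rfl, lintegral_finsetSum _ fun j _ =>
      hS.pointProcess.measurable_lintegral_Ico (C := fun t _ => ENNReal.ofReal
        (θ.kernel k (1 - t) i j)) j (hC j) 0 1] at h1
  have h2 : ∀ j, ∫⁻ ω, ∫⁻ u in Ico 0 1, ENNReal.ofReal (θ.kernel k (1 - u) i j)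
      ∂(eventMeasure S j ω) ∂P =
      ENNReal.ofReal (θ.α k i j * m j * ((1 - Real.exp (-θ.β k i * 1)) / θ.β k i)) := by
    intro j
    rw [hS.lintegral_eventMeasure (C := fun t _ => ENNReal.ofReal
        (θ.kernel k (1 - t) i j)) hα j (hC j) measurableSet_Ico]
    rw [← integral_exp_neg_mul_sub (hβ k i), ← intervalIntegral.integral_const_mul,
      ← lintegral_Ico_ofReal zero_le_one]
    · refine setLIntegral_congr_fun measurableSet_Ico fun u hu => ?_
      rw [lintegral_const_mul' _ _ ENNReal.ofReal_ne_top, hmE j u hu.1,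
        ← ENNReal.ofReal_mul (kernel_nonneg hα _ _ _ _), kernel_apply]
      congr 1
      ring
    · exact ((by fun_prop : Continuous fun u => θ.α k i j * m j *
        Real.exp (-θ.β k i * (1 - u))).integrableOn_Icc).mono_set Ico_subset_Icc_self
    · exact fun u _ => mul_nonneg (mul_nonneg (hα _ _ _) (hm0 j)) (Real.exp_pos _).le
  have hlt : Real.exp (-θ.β k i * 1) < 1 := Real.exp_lt_one_iff.2 (by linarith [hβ k i])
  have h3 : ∀ j, 0 ≤ θ.α k i j * m j * ((1 - Real.exp (-θ.β k i * 1)) / θ.β k i) := fun j =>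
    mul_nonneg (mul_nonneg (hα _ _ _) (hm0 j)) (div_nonneg (by linarith) (hβ k i).le)
  rw [Finset.sum_congr rfl fun j _ => h2 j, ← ENNReal.ofReal_sum_of_nonneg fun j _ => h3 j,
    sub_zero, ← ENNReal.ofReal_mul (Real.exp_pos _).le,
    ← ENNReal.ofReal_add (mul_nonneg (Real.exp_pos _).le hx0) (Finset.sum_nonneg fun j _ => h3 j),
    ENNReal.ofReal_eq_ofReal_iff hx0 (add_nonneg (mul_nonneg (Real.exp_pos _).le hx0)
      (Finset.sum_nonneg fun j _ => h3 j)), ← Finset.sum_mul] at h1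
  have hne : 1 - Real.exp (-θ.β k i * 1) ≠ 0 := by linarith
  have hb := (hβ k i).ne'
  refine mul_left_cancel₀ hne ?_
  rw [sub_mul, one_mul]
  field_simp at h1 ⊢
  linarith

end SteadyState

/-! ### Second moments of the counting process and the renewal equation of the cross moment -/

section CrossMoment

variable {P : Measure Ω} {ℱ : Filtration ℝ mΩ} {K : ℕ} {θ : Params K} {S : Fin 2 → Ω → Set ℝ}

lemma IsSteadyState.integrable_comp (hss : IsSteadyState θ P S) {f : (Fin K → Fin 2 → ℝ) → ℝ}
    (hf : Measurable f) (hint : Integrable (fun ω => f (state θ S 0 ω)) P) {t : ℝ} (ht : 0 ≤ t) :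
    Integrable (fun ω => f (state θ S t ω)) P :=
  (hss.identDistrib_comp hf ht).integrable_iff.2 hint

lemma IsSteadyState.lintegral_ofReal (hss : IsSteadyState θ P S)
    {f : (Fin K → Fin 2 → ℝ) → ℝ} (hf : Measurable f)
    (hint : Integrable (fun ω => f (state θ S 0 ω)) P) (hf0 : ∀ ω, 0 ≤ f (state θ S 0 ω))
    {t : ℝ} (ht : 0 ≤ t) :
    ∫⁻ ω, ENNReal.ofReal (f (state θ S t ω)) ∂P = ENNReal.ofReal (∫ ω, f (state θ S 0 ω) ∂P) := by
  rw [hss.lintegral_eq hf.ennreal_ofReal ht,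
    ofReal_integral_eq_lintegral_ofReal hint (ae_of_all _ hf0)]

lemma IsSteadyState.meanIntensity_eq (hss : IsSteadyState θ P S) {t : ℝ} (ht : 0 ≤ t)
    (j : Fin 2) : meanIntensity θ P S t j = ∫ ω, rate θ (state θ S 0 ω) j ∂P :=
  (hss.identDistrib_comp (measurable_rate j) ht).integral_eq

lemma measurable_coord (k : Fin K) (i : Fin 2) :
    Measurable fun x : Fin K → Fin 2 → ℝ => x k i :=
  (measurable_pi_apply i).comp (measurable_pi_apply k)

lemma IsSteadyState.componentMoment_eq (hss : IsSteadyState θ P S) {t : ℝ} (ht : 0 ≤ t)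
    (k : Fin K) (i j : Fin 2) : componentMoment θ P S k t i j =
      ∫ ω, state θ S 0 ω k i * rate θ (state θ S 0 ω) j ∂P :=
  (hss.identDistrib_comp ((measurable_coord k i).mul (measurable_rate (θ := θ) j)) ht).integral_eq

lemma countBefore_mono (j : Fin 2) (ω : Ω) : Monotone fun t => countBefore S j t ω :=
  fun _ _ hst => measure_mono (Ico_subset_Ico_right hst)

lemma IsPointProcess.measurable_countBefore_apply (hS : IsPointProcess P ℱ S) (j : Fin 2)
    (t : ℝ) : Measurable fun ω => countBefore S j t ω :=
  ((hS.measurable_countBefore j).mono (predictable_le ℱ) le_rfl).comp measurable_prodMk_left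

/-- Young's inequality 2yr ≤ y²/(2t) + 2t r². The weight is chosen so that integration over [0, t]
returns half of the second moment, which can be absorbed. -/
lemma two_mul_add_one_mul_ofReal_le {t : ℝ} (ht : 0 < t) {x : ℝ≥0∞} (hx : x ≠ ∞) {r : ℝ}
    (hr : 0 ≤ r) : (2 * x + 1) * ENNReal.ofReal r ≤
      ENNReal.ofReal (2 * t)⁻¹ * x ^ 2 + ENNReal.ofReal (2 * t * r ^ 2 + r) := by
  obtain ⟨y, hy, rfl⟩ : ∃ y : ℝ, 0 ≤ y ∧ x = ENNReal.ofReal y :=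
    ⟨x.toReal, ENNReal.toReal_nonneg, (ENNReal.ofReal_toReal hx).symm⟩
  have h2 : (2 : ℝ≥0∞) = ENNReal.ofReal 2 := by simp
  rw [h2, ← ENNReal.ofReal_one, ← ENNReal.ofReal_mul zero_le_two, ← ENNReal.ofReal_pow hy,
    ← ENNReal.ofReal_add (by positivity) zero_le_one, ← ENNReal.ofReal_mul (by positivity),
    ← ENNReal.ofReal_mul (by positivity), ← ENNReal.ofReal_add (by positivity) (by positivity)]
  refine ENNReal.ofReal_le_ofReal ?_
  have h3 : (2 * t)⁻¹ * y ^ 2 + 2 * t * r ^ 2 - 2 * y * r = (2 * t)⁻¹ * (y - 2 * t * r) ^ 2 := by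
    field_simp
    ring
  have h4 : 0 ≤ (2 * t)⁻¹ * (y - 2 * t * r) ^ 2 := by positivity
  nlinarith

/-- The counting process has finite second moments. -/
lemma IsHawkes.lintegral_countBefore_sq_le [IsProbabilityMeasure P] (hS : IsHawkes θ P ℱ S)
    (hss : IsSteadyState θ P S) (hμ : ∀ i, 0 < θ.μ i) (hα : ∀ k i j, 0 ≤ θ.α k i j) (j : Fin 2)
    (hR : Integrable (fun ω => rate θ (state θ S 0 ω) j) P)
    (hR2 : Integrable (fun ω => rate θ (state θ S 0 ω) j ^ 2) P) {t : ℝ} (ht : 0 ≤ t) :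
    ∫⁻ ω, countBefore S j t ω ^ 2 ∂P ≤ ENNReal.ofReal (2 * t *
      (2 * t * ∫ ω, rate θ (state θ S 0 ω) j ^ 2 ∂P + ∫ ω, rate θ (state θ S 0 ω) j ∂P)) := by
  rcases ht.eq_or_lt with rfl | ht
  · simp [countBefore]
  set c : ℝ := 2 * t * ∫ ω, rate θ (state θ S 0 ω) j ^ 2 ∂P + ∫ ω, rate θ (state θ S 0 ω) j ∂P
    with hc
  have hc0 : 0 ≤ c := add_nonneg (mul_nonneg (by linarith) (integral_nonneg fun ω => sq_nonneg _))
    (integral_nonneg fun ω => rate_nonneg hμ (state_nonneg hα 0 ω) j)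
  have hmc := hS.pointProcess.measurable_countBefore_apply j
  have hbound : ∀ n : ℕ, ∫⁻ ω, min (countBefore S j t ω) n ^ 2 ∂P ≤ ENNReal.ofReal (2 * t * c) := by
    intro n
    set a := ∫⁻ ω, min (countBefore S j t ω) n ^ 2 ∂P with ha
    have hfin : a ≠ ∞ := by
      refine ne_of_lt ((lintegral_mono (g := fun _ => (n : ℝ≥0∞) ^ 2) fun ω => ?_).trans_lt ?_)
      · exact pow_le_pow_left₀ zero_le (min_le_right _ _) 2
      · rw [lintegral_const, measure_univ, mul_one]
        exact ENNReal.pow_lt_top (ENNReal.natCast_lt_top n)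
    have h1 : a ≤ ∫⁻ v in Ico 0 t, ∫⁻ ω, (2 * min (countBefore S j v ω) n + 1) *
        ENNReal.ofReal (intensity θ S v ω j) ∂P := by
      rw [← hS.lintegral_eventMeasure (C := fun v ω => 2 * min (countBefore S j v ω) n + 1) hα j
        ((((hS.pointProcess.measurable_countBefore j).min measurable_const).const_mul 2).add_const
          1) measurableSet_Ico]
      exact lintegral_mono fun ω => hS.pointProcess.sq_min_countBefore_le j n ht ω
    have h2 : ∀ v ∈ Ico 0 t, ∫⁻ ω, (2 * min (countBefore S j v ω) n + 1) *
        ENNReal.ofReal (intensity θ S v ω j) ∂P ≤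
        ENNReal.ofReal (2 * t)⁻¹ * a + ENNReal.ofReal c := by
      intro v hv
      have hf : Measurable fun x : Fin K → Fin 2 → ℝ => 2 * t * rate θ x j ^ 2 + rate θ x j :=
        ((measurable_rate j).pow_const 2 |>.const_mul (2 * t)).add (measurable_rate j)
      have h3 : ∫⁻ ω, ENNReal.ofReal (2 * t * rate θ (state θ S v ω) j ^ 2 +
          rate θ (state θ S v ω) j) ∂P = ENNReal.ofReal c := by
        rw [hss.lintegral_ofReal hf ((hR2.const_mul (2 * t)).add hR) (fun ω => add_nonneg
          (mul_nonneg (by linarith) (sq_nonneg _)) (rate_nonneg hμ (state_nonneg hα 0 ω) j)) hv.1,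
          integral_add (hR2.const_mul (2 * t)) hR, integral_const_mul]
      have hmm : Measurable fun ω => ENNReal.ofReal (2 * t)⁻¹ * min (countBefore S j t ω) n ^ 2 :=
        (((hmc t).min measurable_const).pow_const 2).const_mul _
      rw [← h3, ha, ← lintegral_const_mul' _ _ ENNReal.ofReal_ne_top, ← lintegral_add_left hmm]
      refine lintegral_mono fun ω => ?_
      have hne : min (countBefore S j t ω) n ≠ ∞ :=
        ((min_le_right _ _).trans_lt (ENNReal.natCast_lt_top n)).ne
      refine le_trans ?_ (two_mul_add_one_mul_ofReal_le ht hne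
        (rate_nonneg hμ (state_nonneg hα v ω) j))
      simp only [intensity_eq_rate]
      gcongr
      exact countBefore_mono j ω hv.2.le
    -- This reads a ≤ a/2 + tc; the truncation makes a finite, so a ≤ 2tc uniformly in n.
    have h4 : a ≤ (ENNReal.ofReal (2 * t)⁻¹ * a + ENNReal.ofReal c) * ENNReal.ofReal t := by
      refine h1.trans ((setLIntegral_mono' measurableSet_Ico h2).trans ?_)
      rw [setLIntegral_const, Real.volume_Ico, sub_zero]
    obtain ⟨r, hr, har⟩ : ∃ r : ℝ, 0 ≤ r ∧ a = ENNReal.ofReal r :=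
      ⟨a.toReal, ENNReal.toReal_nonneg, (ENNReal.ofReal_toReal hfin).symm⟩
    rw [har, ← ENNReal.ofReal_mul (by positivity), ← ENNReal.ofReal_add (by positivity) hc0,
      ← ENNReal.ofReal_mul (by positivity), ENNReal.ofReal_le_ofReal_iff (by positivity)] at h4
    rw [har]
    refine ENNReal.ofReal_le_ofReal ?_
    have h5 : ((2 * t)⁻¹ * r + c) * t = r / 2 + t * c := by
      field_simp
    linarith
  refine lintegral_le_of_tendsto_of_le
    (fun n => ((hmc t).min measurable_const).pow_const 2) (fun ω => ?_) hbound
  refine ENNReal.Tendsto.pow ?_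
  have := (tendsto_const_nhds (x := countBefore S j t ω)).min ENNReal.tendsto_nat_nhds_top
  simpa using this

/-- The cross moment `E[λ_i(t) N_j(t)]` as an integral with values in `[0, ∞]`. -/
def crossE (θ : Params K) (P : Measure Ω) (S : Fin 2 → Ω → Set ℝ) (i j : Fin 2) (t : ℝ) : ℝ≥0∞ :=
  ∫⁻ ω, countBefore S j t ω * ENNReal.ofReal (intensity θ S t ω i) ∂P

lemma IsPointProcess.measurable_crossE [SFinite P] (hS : IsPointProcess P ℱ S)
    (hα : ∀ k i j, 0 ≤ θ.α k i j) (i j : Fin 2) : Measurable (crossE θ P S i j) := by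
  have h := ((hS.measurable_countBefore j).mul
    (hS.measurable_intensity hα i).ennreal_ofReal).mono (predictable_le ℱ) le_rfl
  exact h.lintegral_prod_right'

/-- From xy ≤ x² + y². The bound is crude in T, but only local boundedness is needed for the renewal
argument. -/
lemma IsHawkes.crossE_le [IsProbabilityMeasure P] (hS : IsHawkes θ P ℱ S)
    (hss : IsSteadyState θ P S) (hμ : ∀ i, 0 < θ.μ i) (hα : ∀ k i j, 0 ≤ θ.α k i j)
    (hR : ∀ j, Integrable (fun ω => rate θ (state θ S 0 ω) j) P)
    (hR2 : ∀ j, Integrable (fun ω => rate θ (state θ S 0 ω) j ^ 2) P) (i j : Fin 2)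
    {t T : ℝ} (ht : 0 ≤ t) (htT : t ≤ T) :
    crossE θ P S i j t ≤ ENNReal.ofReal (2 * T *
      (2 * T * ∫ ω, rate θ (state θ S 0 ω) j ^ 2 ∂P + ∫ ω, rate θ (state θ S 0 ω) j ∂P)) +
      ENNReal.ofReal (∫ ω, rate θ (state θ S 0 ω) i ^ 2 ∂P) := by
  have hq : 0 ≤ ∫ ω, rate θ (state θ S 0 ω) j ^ 2 ∂P := integral_nonneg fun ω => sq_nonneg _
  have hm : 0 ≤ ∫ ω, rate θ (state θ S 0 ω) j ∂P :=
    integral_nonneg fun ω => rate_nonneg hμ (state_nonneg hα 0 ω) j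
  have hT := ht.trans htT
  calc crossE θ P S i j t
      ≤ ∫⁻ ω, (countBefore S j t ω ^ 2 + ENNReal.ofReal (rate θ (state θ S t ω) i ^ 2)) ∂P := by
        refine lintegral_mono fun ω => ?_
        simp only [intensity_eq_rate]
        rw [ENNReal.ofReal_pow (rate_nonneg hμ (state_nonneg hα t ω) i)]
        generalize ENNReal.ofReal (rate θ (state θ S t ω) i) = y
        generalize countBefore S j t ω = x
        rcases le_total x y with h | h
        · calc x * y ≤ y * y := by gcongr
            _ ≤ _ := by rw [← sq]; exact le_add_self
        · calc x * y ≤ x * x := by gcongr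
            _ ≤ _ := by rw [← sq]; exact le_self_add
    _ = ∫⁻ ω, countBefore S j t ω ^ 2 ∂P +
          ENNReal.ofReal (∫ ω, rate θ (state θ S 0 ω) i ^ 2 ∂P) := by
        rw [lintegral_add_left ((hS.pointProcess.measurable_countBefore_apply j t).pow_const 2),
          hss.lintegral_ofReal ((measurable_rate i).pow_const 2) (hR2 i) (fun ω => sq_nonneg _) ht]
    _ ≤ _ := by
        gcongr
        refine (hS.lintegral_countBefore_sq_le hss hμ hα j (hR j) (hR2 j) ht).trans ?_
        refine ENNReal.ofReal_le_ofReal ?_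
        gcongr

lemma N_nonneg (t : ℝ) (ω : Ω) (j : Fin 2) : 0 ≤ N S t ω j := Nat.cast_nonneg _

lemma IsHawkes.ofReal_intensity_mul_N [SFinite P] (hS : IsHawkes θ P ℱ S)
    (hα : ∀ k i j, 0 ≤ θ.α k i j) (i j : Fin 2) (t : ℝ) :
    ∀ᵐ ω ∂P, ENNReal.ofReal (intensity θ S t ω i * N S t ω j) =
      countBefore S j t ω * ENNReal.ofReal (intensity θ S t ω i) := by
  filter_upwards [hS.ae_countBefore hα j t] with ω hω
  rw [← hω, mul_comm, ENNReal.ofReal_mul (N_nonneg t ω j)]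

lemma IsHawkes.aestronglyMeasurable_intensity_mul_N [SFinite P] (hS : IsHawkes θ P ℱ S)
    (hα : ∀ k i j, 0 ≤ θ.α k i j) (i j : Fin 2) (t : ℝ) :
    AEStronglyMeasurable (fun ω => intensity θ S t ω i * N S t ω j) P := by
  have h1 : Measurable fun ω => intensity θ S t ω i :=
    (measurable_rate (θ := θ) i).comp (hS.pointProcess.measurable_state hα t)
  have h2 : Measurable fun ω => N S t ω j := by
    have h3 := (hS.pointProcess.adapted j 0 t).mono (ℱ.le t) le_rfl
    exact (measurable_from_top (f := fun n : ℕ => (n : ℝ))).comp h3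
  exact (h1.mul h2).aestronglyMeasurable

lemma IsHawkes.crossMoment_eq [SFinite P] (hS : IsHawkes θ P ℱ S) (hμ : ∀ i, 0 < θ.μ i)
    (hα : ∀ k i j, 0 ≤ θ.α k i j) (t : ℝ) (i j : Fin 2) :
    crossMoment θ P S t i j = (crossE θ P S i j t).toReal := by
  rw [crossMoment, Matrix.of_apply, integral_eq_lintegral_of_nonneg_ae
    (ae_of_all _ fun ω => mul_nonneg (intensity_pos hμ hα t ω i).le (N_nonneg t ω j))
    (hS.aestronglyMeasurable_intensity_mul_N hα i j t),
    lintegral_congr_ae (hS.ofReal_intensity_mul_N hα i j t), crossE]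

lemma IsHawkes.integrable_intensity_mul_N [SFinite P] (hS : IsHawkes θ P ℱ S)
    (hμ : ∀ i, 0 < θ.μ i) (hα : ∀ k i j, 0 ≤ θ.α k i j) {t : ℝ} {i j : Fin 2}
    (hfin : crossE θ P S i j t ≠ ∞) :
    Integrable (fun ω => intensity θ S t ω i * N S t ω j) P := by
  refine ⟨hS.aestronglyMeasurable_intensity_mul_N hα i j t, ?_⟩
  rw [hasFiniteIntegral_iff_ofReal (ae_of_all _ fun ω =>
    mul_nonneg (intensity_pos hμ hα t ω i).le (N_nonneg t ω j)),
    lintegral_congr_ae (hS.ofReal_intensity_mul_N hα i j t)]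
  exact hfin.lt_top

end CrossMoment

/-! ### The Volterra system satisfied by the cross moments -/

section Renewal

variable {P : Measure Ω} {ℱ : Filtration ℝ mΩ} {K : ℕ} {θ : Params K} {S : Fin 2 → Ω → Set ℝ}

lemma IsHawkes.lintegral_countBefore [IsProbabilityMeasure P] (hS : IsHawkes θ P ℱ S)
    (hss : IsSteadyState θ P S) (hμ : ∀ i, 0 < θ.μ i) (hα : ∀ k i j, 0 ≤ θ.α k i j) (j : Fin 2)
    (hR : Integrable (fun ω => rate θ (state θ S 0 ω) j) P) (t : ℝ) :
    ∫⁻ ω, countBefore S j t ω ∂P =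
      ENNReal.ofReal (∫ ω, rate θ (state θ S 0 ω) j ∂P) * ENNReal.ofReal t := by
  have h1 : ∀ ω, countBefore S j t ω = ∫⁻ v in Ico 0 t, 1 ∂(eventMeasure S j ω) := fun ω => by
    rw [setLIntegral_one, countBefore]
  simp_rw [h1]
  rw [hS.lintegral_eventMeasure (C := fun _ _ => 1) hα j measurable_const measurableSet_Ico]
  have h2 : ∀ v ∈ Ico 0 t, ∫⁻ ω, 1 * ENNReal.ofReal (intensity θ S v ω j) ∂P =
      ENNReal.ofReal (∫ ω, rate θ (state θ S 0 ω) j ∂P) := fun v hv => by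
    simp only [one_mul, intensity_eq_rate]
    exact hss.lintegral_ofReal (measurable_rate j) hR
      (fun ω => rate_nonneg hμ (state_nonneg hα 0 ω) j) hv.1
  rw [setLIntegral_congr_fun measurableSet_Ico h2, setLIntegral_const, Real.volume_Ico, sub_zero]

/-- Expectation of the integration by parts. Integrals against events of type j are replaced by
integrals against λ_j and give stationary moments; those against events of type l carry the earlier
count of type j and give the cross moment of λ_l and N_j. The system therefore closes for each fixed
j. -/
lemma IsHawkes.lintegral_componentE_mul_countBefore [IsProbabilityMeasure P]
    (hS : IsHawkes θ P ℱ S) (hss : IsSteadyState θ P S) (hμ : ∀ i, 0 < θ.μ i)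
    (hα : ∀ k i j, 0 ≤ θ.α k i j) (k : Fin K) (i j : Fin 2)
    (hR : Integrable (fun ω => rate θ (state θ S 0 ω) j) P)
    (hXR : Integrable (fun ω => state θ S 0 ω k i * rate θ (state θ S 0 ω) j) P)
    {t : ℝ} (hfin : ∀ l, ∀ v ∈ Ico 0 t, crossE θ P S l j v ≠ ∞) :
    ∫⁻ ω, componentE θ S k t ω i * countBefore S j t ω ∂P =
      ∫⁻ v in Ico 0 t, ENNReal.ofReal (Real.exp (-θ.β k i * (t - v)) *
        (∫ ω, state θ S 0 ω k i * rate θ (state θ S 0 ω) j ∂P +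
          θ.α k i j * ∫ ω, rate θ (state θ S 0 ω) j ∂P +
          ∑ l, θ.α k i l * (crossE θ P S l j v).toReal)) := by
  set m : ℝ := ∫ ω, rate θ (state θ S 0 ω) j ∂P with hm
  set Q : ℝ := ∫ ω, state θ S 0 ω k i * rate θ (state θ S 0 ω) j ∂P with hQ
  have hm0 : 0 ≤ m := integral_nonneg fun ω => rate_nonneg hμ (state_nonneg hα 0 ω) j
  have hXR0 : ∀ ω, 0 ≤ state θ S 0 ω k i * rate θ (state θ S 0 ω) j := fun ω =>
    mul_nonneg (state_nonneg hα 0 ω k i) (rate_nonneg hμ (state_nonneg hα 0 ω) j)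
  have hQ0 : 0 ≤ Q := integral_nonneg hXR0
  have hpred : ∀ l, Measurable[predictable ℱ] fun p : ℝ × Ω =>
      ENNReal.ofReal (θ.kernel k (t - p.1) i l) := fun l =>
    (((measurable_kernel k i l).comp (measurable_const.sub measurable_id)).ennreal_ofReal).comp
      (measurable_predictable_fst ℱ)
  have hexp : Measurable[predictable ℱ] fun p : ℝ × Ω =>
      ENNReal.ofReal (Real.exp (-θ.β k i * (t - p.1))) :=
    (by fun_prop : Measurable fun v : ℝ => ENNReal.ofReal (Real.exp (-θ.β k i * (t - v)))).comp
      (measurable_predictable_fst ℱ)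
  have hC1 : Measurable[predictable ℱ] fun p : ℝ × Ω =>
      ENNReal.ofReal (Real.exp (-θ.β k i * (t - p.1))) * componentE θ S k p.1 p.2 i +
        ENNReal.ofReal (θ.kernel k (t - p.1) i j) :=
    (hexp.mul (hS.pointProcess.measurable_componentE k i)).add (hpred j)
  have hC2 : ∀ l, Measurable[predictable ℱ] fun p : ℝ × Ω =>
      ENNReal.ofReal (θ.kernel k (t - p.1) i l) * countBefore S j p.1 p.2 := fun l =>
    (hpred l).mul (hS.pointProcess.measurable_countBefore j)
  have h1 : ∫⁻ ω, componentE θ S k t ω i * countBefore S j t ω ∂P = ∫⁻ ω,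
      (∫⁻ v in Ico 0 t, (ENNReal.ofReal (Real.exp (-θ.β k i * (t - v))) * componentE θ S k v ω i +
        ENNReal.ofReal (θ.kernel k (t - v) i j)) ∂(eventMeasure S j ω) +
      ∑ l, ∫⁻ u in Ico 0 t, ENNReal.ofReal (θ.kernel k (t - u) i l) * countBefore S j u ω
        ∂(eventMeasure S l ω)) ∂P := by
    refine lintegral_congr_ae ?_
    filter_upwards [hS.ae_regular] with ω hω
    exact hS.pointProcess.componentE_mul_countBefore hω k i j t
  rw [h1, lintegral_add_left (hS.pointProcess.measurable_lintegral_Ico j (C := fun v ω =>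
    ENNReal.ofReal (Real.exp (-θ.β k i * (t - v))) * componentE θ S k v ω i +
        ENNReal.ofReal (θ.kernel k (t - v) i j)) hC1 0 t), lintegral_finsetSum _ fun l _ =>
    hS.pointProcess.measurable_lintegral_Ico l (C := fun u ω =>
      ENNReal.ofReal (θ.kernel k (t - u) i l) * countBefore S j u ω) (hC2 l) 0 t,
    hS.lintegral_eventMeasure (C := fun v ω =>
    ENNReal.ofReal (Real.exp (-θ.β k i * (t - v))) * componentE θ S k v ω i +
        ENNReal.ofReal (θ.kernel k (t - v) i j)) hα j hC1 measurableSet_Ico,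
    Finset.sum_congr rfl fun l _ => hS.lintegral_eventMeasure (C := fun u ω =>
      ENNReal.ofReal (θ.kernel k (t - u) i l) * countBefore S j u ω) hα l (hC2 l)
      measurableSet_Ico]
  have hcm : ∀ l, Measurable fun v => ENNReal.ofReal (θ.kernel k (t - v) i l) *
      crossE θ P S l j v := fun l =>
    ((measurable_kernel k i l).comp (measurable_const.sub measurable_id)).ennreal_ofReal.mul
      (hS.pointProcess.measurable_crossE hα l j)
  have h2 : ∀ l, ∫⁻ u in Ico 0 t, ∫⁻ ω, ENNReal.ofReal (θ.kernel k (t - u) i l) *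
      countBefore S j u ω * ENNReal.ofReal (intensity θ S u ω l) ∂P =
      ∫⁻ u in Ico 0 t, ENNReal.ofReal (θ.kernel k (t - u) i l) * crossE θ P S l j u := by
    intro l
    refine lintegral_congr fun u => ?_
    simp_rw [mul_assoc]
    rw [lintegral_const_mul' _ _ ENNReal.ofReal_ne_top, crossE]
  rw [Finset.sum_congr rfl fun l _ => h2 l, ← lintegral_finsetSum _ fun l _ => hcm l,
    ← lintegral_add_right _ (Finset.measurable_sum _ fun l _ => hcm l)]
  refine setLIntegral_congr_fun measurableSet_Ico fun v hv => ?_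
  have h3 : ∫⁻ ω, (ENNReal.ofReal (Real.exp (-θ.β k i * (t - v))) * componentE θ S k v ω i +
        ENNReal.ofReal (θ.kernel k (t - v) i j)) * ENNReal.ofReal (intensity θ S v ω j) ∂P =
      ENNReal.ofReal (Real.exp (-θ.β k i * (t - v)) * (Q + θ.α k i j * m)) := by
    have hf : Measurable fun x : Fin K → Fin 2 → ℝ =>
        Real.exp (-θ.β k i * (t - v)) * (x k i * rate θ x j + θ.α k i j * rate θ x j) :=
      (((measurable_coord k i).mul (measurable_rate j)).add
        ((measurable_rate j).const_mul _)).const_mul _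
    have h4 := hss.lintegral_ofReal hf ((hXR.add (hR.const_mul (θ.α k i j))).const_mul _)
      (fun ω => mul_nonneg (Real.exp_pos _).le (add_nonneg (hXR0 ω) (mul_nonneg (hα _ _ _)
        (rate_nonneg hμ (state_nonneg hα 0 ω) j)))) hv.1
    rw [integral_const_mul, integral_add hXR (hR.const_mul _), integral_const_mul] at h4
    rw [← h4]
    refine lintegral_congr_ae ?_
    filter_upwards [hS.ae_regular] with ω hω
    have hr := rate_nonneg hμ (state_nonneg (θ := θ) (S := S) hα v ω) j
    have hs : 0 ≤ component θ S k v ω i := component_nonneg hα k v ω i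
    rw [← hω.ofReal_component hα, intensity_eq_rate, ← ENNReal.ofReal_mul (Real.exp_pos _).le,
      ← ENNReal.ofReal_add (mul_nonneg (Real.exp_pos _).le hs) (kernel_nonneg hα _ _ _ _),
      ← ENNReal.ofReal_mul (add_nonneg (mul_nonneg (Real.exp_pos _).le hs)
        (kernel_nonneg hα _ _ _ _)), kernel_apply]
    congr 1
    simp only [state]
    ring
  have h5 : ∀ l, ENNReal.ofReal (θ.kernel k (t - v) i l) * crossE θ P S l j v =
      ENNReal.ofReal (Real.exp (-θ.β k i * (t - v)) *
        (θ.α k i l * (crossE θ P S l j v).toReal)) := fun l => by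
    conv_lhs => rw [← ENNReal.ofReal_toReal (hfin l v hv)]
    rw [← ENNReal.ofReal_mul (kernel_nonneg hα _ _ _ _), kernel_apply]
    congr 1
    ring
  have h6 : ∀ l, 0 ≤ Real.exp (-θ.β k i * (t - v)) *
      (θ.α k i l * (crossE θ P S l j v).toReal) := fun l =>
    mul_nonneg (Real.exp_pos _).le (mul_nonneg (hα _ _ _) ENNReal.toReal_nonneg)
  rw [h3, Finset.sum_congr rfl fun l _ => h5 l, ← ENNReal.ofReal_sum_of_nonneg fun l _ => h6 l,
    ← ENNReal.ofReal_add (mul_nonneg (Real.exp_pos _).le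
      (add_nonneg hQ0 (mul_nonneg (hα _ _ _) hm0))) (Finset.sum_nonneg fun l _ => h6 l),
    ← Finset.mul_sum, ← mul_add]

lemma IsHawkes.crossE_toReal_locally_bounded [IsProbabilityMeasure P]
    (hS : IsHawkes θ P ℱ S) (hss : IsSteadyState θ P S) (hμ : ∀ i, 0 < θ.μ i)
    (hα : ∀ k i j, 0 ≤ θ.α k i j)
    (hR : ∀ j, Integrable (fun ω => rate θ (state θ S 0 ω) j) P)
    (hR2 : ∀ j, Integrable (fun ω => rate θ (state θ S 0 ω) j ^ 2) P) (i j : Fin 2) (T : ℝ) :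
    ∃ M, ∀ v ∈ Icc 0 T, (crossE θ P S i j v).toReal ≤ M :=
  ⟨_, fun _ hv => ENNReal.toReal_mono
    (ENNReal.add_ne_top.2 ⟨ENNReal.ofReal_ne_top, ENNReal.ofReal_ne_top⟩)
    (hS.crossE_le hss hμ hα hR hR2 i j hv.1 hv.2)⟩

lemma IsHawkes.integrableOn_crossE [IsProbabilityMeasure P]
    (hS : IsHawkes θ P ℱ S) (hss : IsSteadyState θ P S) (hμ : ∀ i, 0 < θ.μ i)
    (hα : ∀ k i j, 0 ≤ θ.α k i j)
    (hR : ∀ j, Integrable (fun ω => rate θ (state θ S 0 ω) j) P)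
    (hR2 : ∀ j, Integrable (fun ω => rate θ (state θ S 0 ω) j ^ 2) P) (i j : Fin 2) (t : ℝ) :
    IntegrableOn (fun v => (crossE θ P S i j v).toReal) (Icc 0 t) := by
  obtain ⟨M, hM⟩ := hS.crossE_toReal_locally_bounded hss hμ hα hR hR2 i j t
  refine Measure.integrableOn_of_bounded (M := M) (by simp)
    (hS.pointProcess.measurable_crossE hα i j).ennreal_toReal.aestronglyMeasurable
    ((ae_restrict_iff' measurableSet_Icc).2 (ae_of_all _ fun v hv => ?_))
  rw [Real.norm_eq_abs, abs_of_nonneg ENNReal.toReal_nonneg]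
  exact hM v hv

lemma IsHawkes.crossE_ne_top [IsProbabilityMeasure P]
    (hS : IsHawkes θ P ℱ S) (hss : IsSteadyState θ P S) (hμ : ∀ i, 0 < θ.μ i)
    (hα : ∀ k i j, 0 ≤ θ.α k i j)
    (hR : ∀ j, Integrable (fun ω => rate θ (state θ S 0 ω) j) P)
    (hR2 : ∀ j, Integrable (fun ω => rate θ (state θ S 0 ω) j ^ 2) P) (i j : Fin 2) {t : ℝ}
    (ht : 0 ≤ t) : crossE θ P S i j t ≠ ∞ :=
  ((hS.crossE_le hss hμ hα hR hR2 i j ht le_rfl).trans_lt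
    (ENNReal.add_lt_top.2 ⟨ENNReal.ofReal_lt_top, ENNReal.ofReal_lt_top⟩)).ne

lemma IsHawkes.crossE_toReal_eq [IsProbabilityMeasure P]
    (hS : IsHawkes θ P ℱ S) (hss : IsSteadyState θ P S) (hμ : ∀ i, 0 < θ.μ i)
    (hα : ∀ k i j, 0 ≤ θ.α k i j)
    (hR : ∀ j, Integrable (fun ω => rate θ (state θ S 0 ω) j) P)
    (hR2 : ∀ j, Integrable (fun ω => rate θ (state θ S 0 ω) j ^ 2) P)
    (hXR : ∀ k i j, Integrable (fun ω => state θ S 0 ω k i * rate θ (state θ S 0 ω) j) P)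
    (i j : Fin 2) {t : ℝ} (ht : 0 ≤ t) :
    (crossE θ P S i j t).toReal = θ.μ i * (∫ ω, rate θ (state θ S 0 ω) j ∂P) * t +
      ∑ k, ∫ v in (0 : ℝ)..t, Real.exp (-θ.β k i * (t - v)) *
        (∫ ω, state θ S 0 ω k i * rate θ (state θ S 0 ω) j ∂P +
          θ.α k i j * ∫ ω, rate θ (state θ S 0 ω) j ∂P +
          ∑ l, θ.α k i l * (crossE θ P S l j v).toReal) := by
  set m : ℝ := ∫ ω, rate θ (state θ S 0 ω) j ∂P with hm
  have hm0 : 0 ≤ m := integral_nonneg fun ω => rate_nonneg hμ (state_nonneg hα 0 ω) j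
  have hQ0 : ∀ k, 0 ≤ ∫ ω, state θ S 0 ω k i * rate θ (state θ S 0 ω) j ∂P := fun k =>
    integral_nonneg fun ω =>
      mul_nonneg (state_nonneg hα 0 ω k i) (rate_nonneg hμ (state_nonneg hα 0 ω) j)
  have hg0 : ∀ k v, 0 ≤ Real.exp (-θ.β k i * (t - v)) *
        (∫ ω, state θ S 0 ω k i * rate θ (state θ S 0 ω) j ∂P + θ.α k i j * m +
          ∑ l, θ.α k i l * (crossE θ P S l j v).toReal) := fun k v =>
    mul_nonneg (Real.exp_pos _).le (add_nonneg (add_nonneg (hQ0 k) (mul_nonneg (hα _ _ _) hm0))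
      (Finset.sum_nonneg fun l _ => mul_nonneg (hα _ _ _) ENNReal.toReal_nonneg))
  have hgint : ∀ k, IntegrableOn (fun v => Real.exp (-θ.β k i * (t - v)) *
        (∫ ω, state θ S 0 ω k i * rate θ (state θ S 0 ω) j ∂P + θ.α k i j * m +
          ∑ l, θ.α k i l * (crossE θ P S l j v).toReal)) (Icc 0 t) := fun k => by
    refine IntegrableOn.continuousOn_mul (by fun_prop) ?_ isCompact_Icc
    refine Integrable.add (integrable_const _) ?_
    exact integrable_finsetSum _ fun l _ => 
      (hS.integrableOn_crossE hss hμ hα hR hR2 l j t).const_mul _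
  have hmc := hS.pointProcess.measurable_countBefore_apply (j := j) t
  have hmE : ∀ k, Measurable fun ω => componentE θ S k t ω i := fun k =>
    ((hS.pointProcess.measurable_componentE k i).mono (predictable_le ℱ) le_rfl).comp
      measurable_prodMk_left
  have hmEc : ∀ k, Measurable fun ω => componentE θ S k t ω i * countBefore S j t ω := fun k =>
    (hmE k).mul hmc
  have h1 : crossE θ P S i j t = ∫⁻ ω, (ENNReal.ofReal (θ.μ i) * countBefore S j t ω +
      ∑ k, componentE θ S k t ω i * countBefore S j t ω) ∂P := by
    refine lintegral_congr_ae ?_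
    filter_upwards [hS.ae_regular] with ω hω
    rw [intensity, ENNReal.ofReal_add (hμ i).le
      (Finset.sum_nonneg fun k _ => component_nonneg hα k t ω i),
      ENNReal.ofReal_sum_of_nonneg fun k _ => component_nonneg hα k t ω i,
      Finset.sum_congr rfl fun k _ => hω.ofReal_component hα k t i, mul_comm, add_mul,
      Finset.sum_mul]
  rw [h1, lintegral_add_left (hmc.const_mul _), lintegral_const_mul' _ _ ENNReal.ofReal_ne_top,
    hS.lintegral_countBefore hss hμ hα j (hR j), lintegral_finsetSum _ fun k _ => hmEc k,
    Finset.sum_congr rfl fun k _ => (hS.lintegral_componentE_mul_countBefore hss hμ hα k i j (hR j)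
      (hXR k i j) (fun l v hv =>
        hS.crossE_ne_top hss hμ hα hR hR2 l j hv.1)).trans (lintegral_Ico_ofReal ht
        ((hgint k).mono_set Ico_subset_Icc_self) (fun v _ => hg0 k v)),
    ← ENNReal.ofReal_mul hm0, ← ENNReal.ofReal_mul (hμ i).le,
    ← ENNReal.ofReal_sum_of_nonneg fun k _ =>
      intervalIntegral.integral_nonneg ht fun v _ => hg0 k v,
    ← ENNReal.ofReal_add (mul_nonneg (hμ i).le (mul_nonneg hm0 ht)) (Finset.sum_nonneg fun k _ =>
      intervalIntegral.integral_nonneg ht fun v _ => hg0 k v), ENNReal.toReal_ofReal, ← mul_assoc]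
  exact add_nonneg (mul_nonneg (hμ i).le (mul_nonneg hm0 ht)) (Finset.sum_nonneg fun k _ =>
      intervalIntegral.integral_nonneg ht fun v _ => hg0 k v)

end Renewal

/-! ### Decay of solutions of the homogeneous renewal equation -/

section Decay

variable {K : ℕ} {θ : Params K}

/-- A subcritical branching matrix stays so after a small exponential tilt of the kernels. -/
lemma Subcritical.exists_tilt (hG : Subcritical θ.branching) (hα : ∀ k i j, 0 ≤ θ.α k i j)
    (hβ : ∀ k i, 0 < θ.β k i) : ∃ r : Fin 2 → ℝ, (∀ i, 0 < r i) ∧ ∃ ε : ℝ, 0 < ε ∧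
      (∀ k i, ε < θ.β k i) ∧
      ∀ i, ∑ k, ∑ l, θ.α k i l * r l / (θ.β k i - ε) < r i := by
  -- The transpose turns the left vector into a right one, Gr < r. This is the required inequality
  -- at ε = 0, and being strict it persists for small ε.
  obtain ⟨r, hr, hlt⟩ := hG.transpose.exists_vecMul_lt fun i j => branching_nonneg hα hβ j i
  refine ⟨r, hr, ?_⟩
  have h1 : ∀ᶠ ε : ℝ in 𝓝 0, ∀ k i, ε < θ.β k i := by
    rw [eventually_all]
    intro k
    rw [eventually_all]
    exact fun i => eventually_lt_nhds (hβ k i)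
  have h2 : ∀ᶠ ε : ℝ in 𝓝 0, ∀ i, ∑ k, ∑ l, θ.α k i l * r l / (θ.β k i - ε) < r i := by
    rw [eventually_all]
    intro i
    have hc : ContinuousAt (fun ε : ℝ => ∑ k, ∑ l, θ.α k i l * r l / (θ.β k i - ε)) 0 := by
      refine tendsto_finsetSum _ fun k _ => tendsto_finsetSum _ fun l _ => ?_
      refine ContinuousAt.div continuousAt_const (by fun_prop) ?_
      simpa using (hβ k i).ne'
    refine hc.eventually_lt_const ?_
    have h3 := hlt i
    rw [Matrix.vecMul_transpose, Matrix.mulVec, dotProduct] at h3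
    refine lt_of_eq_of_lt ?_ h3
    simp only [sub_zero, branching_apply hβ, Finset.sum_mul]
    rw [Finset.sum_comm]
    exact Finset.sum_congr rfl fun l _ => Finset.sum_congr rfl fun k _ => by ring
  obtain ⟨ε, hε, hε0⟩ := ((h1.and h2).filter_mono nhdsWithin_le_nhds |>.and
    (self_mem_nhdsWithin : Ioi (0 : ℝ) ∈ 𝓝[>] 0)).exists
  exact ⟨ε, hε0, hε.1, hε.2⟩

/-- exp(-b(t - v)) exp(-εv) = exp(-εt) exp(-(b - ε)(t - v)): convolution with a faster exponential
preserves the decay rate ε, at the cost of the factor 1/(b - ε). -/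
lemma norm_integral_exp_mul_le {b ε t c : ℝ} (hε : ε < b) (ht : 0 ≤ t) (hc : 0 ≤ c) {f : ℝ → ℝ}
    (hf : ∀ v ∈ Icc 0 t, |f v| ≤ c * Real.exp (-ε * v)) :
    |∫ v in (0 : ℝ)..t, Real.exp (-b * (t - v)) * f v| ≤ c * Real.exp (-ε * t) / (b - ε) := by
  have hb : 0 < b - ε := sub_pos.2 hε
  have h1 : |∫ v in (0 : ℝ)..t, Real.exp (-b * (t - v)) * f v| ≤
      ∫ v in (0 : ℝ)..t, c * Real.exp (-ε * t) * Real.exp (-(b - ε) * (t - v)) := by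
    rw [← Real.norm_eq_abs]
    refine intervalIntegral.norm_integral_le_of_norm_le ht (ae_of_all _ fun v hv => ?_)
      ((by fun_prop : Continuous fun v => c * Real.exp (-ε * t) *
        Real.exp (-(b - ε) * (t - v))).intervalIntegrable _ _)
    rw [Real.norm_eq_abs, abs_mul, abs_of_pos (Real.exp_pos _)]
    calc Real.exp (-b * (t - v)) * |f v| ≤ Real.exp (-b * (t - v)) * (c * Real.exp (-ε * v)) :=
          mul_le_mul_of_nonneg_left (hf v (Ioc_subset_Icc_self hv)) (Real.exp_pos _).le
      _ = c * (Real.exp (-b * (t - v)) * Real.exp (-ε * v)) := by ring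
      _ = c * (Real.exp (-ε * t) * Real.exp (-(b - ε) * (t - v))) := by
          rw [← Real.exp_add, ← Real.exp_add]
          congr 2
          ring
      _ = _ := by ring
  refine h1.trans ?_
  rw [intervalIntegral.integral_const_mul, integral_exp_neg_mul_sub hb, ← mul_div_assoc]
  refine div_le_div_of_nonneg_right ?_ hb.le
  exact mul_le_of_le_one_right (mul_nonneg hc (Real.exp_pos _).le)
    (by linarith [Real.exp_pos (-(b - ε) * t)])

/-- In the norm sup |z_i(t)| exp(εt) / r_i the convolution has factor κ < 1, while the forcing has
norm at most C. Local boundedness makes the norm on [0, T] finite, and the resulting bound C / (1 -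
κ) does not depend on T. -/
lemma Subcritical.tendsto_zero_of_renewal (hG : Subcritical θ.branching)
    (hα : ∀ k i j, 0 ≤ θ.α k i j) (hβ : ∀ k i, 0 < θ.β k i) {z : Fin 2 → ℝ → ℝ}
    {c : Fin K → Fin 2 → ℝ} (hbdd : ∀ T, ∃ M, ∀ i, ∀ t ∈ Icc 0 T, |z i t| ≤ M)
    (hz : ∀ i t, 0 ≤ t → z i t = ∑ k, (c k i * Real.exp (-θ.β k i * t) +
      ∫ v in (0 : ℝ)..t, Real.exp (-θ.β k i * (t - v)) * ∑ l, θ.α k i l * z l v)) (i : Fin 2) :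
    Tendsto (z i) atTop (𝓝 0) := by
  obtain ⟨r, hr, ε, hε0, hεβ, hlt⟩ := hG.exists_tilt hα hβ
  set g : Fin 2 → ℝ := fun i => ∑ k, ∑ l, θ.α k i l * r l / (θ.β k i - ε) with hg
  set κ : ℝ := max (g 0 / r 0) (g 1 / r 1) with hκ
  have hκ1 : κ < 1 := max_lt ((div_lt_one (hr 0)).2 (hlt 0)) ((div_lt_one (hr 1)).2 (hlt 1))
  have hgκ : ∀ i, g i / r i ≤ κ := Fin.forall_fin_two.2 ⟨le_max_left _ _, le_max_right _ _⟩
  set C : ℝ := ∑ i, (∑ k, |c k i|) / r i with hC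
  have hCi : ∀ i, (∑ k, |c k i|) / r i ≤ C := fun i =>
    Finset.single_le_sum (f := fun i => (∑ k, |c k i|) / r i) (fun i _ =>
      div_nonneg (Finset.sum_nonneg fun k _ => abs_nonneg _) (hr i).le) (Finset.mem_univ i)
  have hκC : ∀ T : ℝ, 0 ≤ T → ∀ i, ∀ t ∈ Icc 0 T,
      |z i t| * Real.exp (ε * t) / r i ≤ C / (1 - κ) := by
    intro T hT
    set B : Set ℝ := {x | ∃ i, ∃ t ∈ Icc 0 T, x = |z i t| * Real.exp (ε * t) / r i} with hB
    have hBne : B.Nonempty := ⟨_, 0, 0, ⟨le_rfl, hT⟩, rfl⟩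
    have hBbdd : BddAbove B := by
      obtain ⟨M, hM⟩ := hbdd T
      refine ⟨M * Real.exp (ε * T) / r 0 + M * Real.exp (ε * T) / r 1, ?_⟩
      have hM0 : 0 ≤ M := (abs_nonneg _).trans (hM 0 0 ⟨le_rfl, hT⟩)
      rintro _ ⟨i, t, ht, rfl⟩
      have h1 : |z i t| * Real.exp (ε * t) / r i ≤ M * Real.exp (ε * T) / r i := by
        refine div_le_div_of_nonneg_right ?_ (hr i).le
        refine mul_le_mul (hM i t ht) (Real.exp_le_exp.2 ?_) (Real.exp_pos _).le hM0
        exact mul_le_mul_of_nonneg_left ht.2 hε0.le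
      have h2 : ∀ i, 0 ≤ M * Real.exp (ε * T) / r i := fun i =>
        div_nonneg (mul_nonneg hM0 (Real.exp_pos _).le) (hr i).le
      refine h1.trans ?_
      have h3 := h2 0
      have h4 := h2 1
      fin_cases i
      · simpa using h4
      · simpa using h3
    set s := sSup B with hs
    have hle : ∀ i, ∀ t ∈ Icc 0 T, |z i t| * Real.exp (ε * t) / r i ≤ s := fun i t ht =>
      le_csSup hBbdd ⟨i, t, ht, rfl⟩
    have hs0 : 0 ≤ s := (div_nonneg (mul_nonneg (abs_nonneg _) (Real.exp_pos _).le)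
      (hr 0).le).trans (hle 0 0 ⟨le_rfl, hT⟩)
    have hz' : ∀ l, ∀ v ∈ Icc 0 T, |z l v| ≤ s * r l * Real.exp (-ε * v) := by
      intro l v hv
      have h1 := (div_le_iff₀ (hr l)).1 (hle l v hv)
      rw [neg_mul, Real.exp_neg, ← div_eq_mul_inv, le_div_iff₀ (Real.exp_pos _)]
      exact h1
    -- The contraction estimate; as s is a genuine supremum of a bounded set, it gives s ≤ C / (1 -
    -- κ).
    have hself : s ≤ C + κ * s := by
      refine csSup_le hBne ?_
      rintro _ ⟨i, t, ht, rfl⟩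
      have h1 : ∀ k, |∫ v in (0 : ℝ)..t, Real.exp (-θ.β k i * (t - v)) *
          ∑ l, θ.α k i l * z l v| ≤
          (s * ∑ l, θ.α k i l * r l) * Real.exp (-ε * t) / (θ.β k i - ε) := by
        intro k
        refine norm_integral_exp_mul_le (hεβ k i) ht.1 (mul_nonneg hs0
          (Finset.sum_nonneg fun l _ => mul_nonneg (hα _ _ _) (hr l).le)) fun v hv => ?_
        calc |∑ l, θ.α k i l * z l v| ≤ ∑ l, |θ.α k i l * z l v| :=
              Finset.abs_sum_le_sum_abs _ _
          _ ≤ ∑ l, θ.α k i l * (s * r l * Real.exp (-ε * v)) := by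
              refine Finset.sum_le_sum fun l _ => ?_
              rw [abs_mul, abs_of_nonneg (hα k i l)]
              exact mul_le_mul_of_nonneg_left (hz' l v ⟨hv.1, hv.2.trans ht.2⟩) (hα _ _ _)
          _ = _ := by
              rw [Finset.mul_sum, Finset.sum_mul]
              exact Finset.sum_congr rfl fun l _ => by ring
      have h2 : ∀ k, |c k i * Real.exp (-θ.β k i * t)| ≤ |c k i| * Real.exp (-ε * t) := by
        intro k
        rw [abs_mul, abs_of_pos (Real.exp_pos _)]
        refine mul_le_mul_of_nonneg_left (Real.exp_le_exp.2 ?_) (abs_nonneg _)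
        nlinarith [hεβ k i, ht.1]
      have h3 : |z i t| ≤ ((∑ k, |c k i|) + s * g i) * Real.exp (-ε * t) := by
        rw [hz i t ht.1]
        calc _ ≤ ∑ k, |c k i * Real.exp (-θ.β k i * t) +
              ∫ v in (0 : ℝ)..t, Real.exp (-θ.β k i * (t - v)) * ∑ l, θ.α k i l * z l v| :=
              Finset.abs_sum_le_sum_abs _ _
          _ ≤ ∑ k, (|c k i| * Real.exp (-ε * t) +
              (s * ∑ l, θ.α k i l * r l) * Real.exp (-ε * t) / (θ.β k i - ε)) :=
              Finset.sum_le_sum fun k _ => (abs_add_le _ _).trans (add_le_add (h2 k) (h1 k))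
          _ = _ := by
              rw [Finset.sum_add_distrib, add_mul, Finset.sum_mul, hg, mul_assoc, Finset.sum_mul,
                Finset.mul_sum]
              congr 1
              refine Finset.sum_congr rfl fun k _ => ?_
              rw [← Finset.sum_div]
              ring
      have h4 : |z i t| * Real.exp (ε * t) ≤ (∑ k, |c k i|) + s * g i := by
        rw [neg_mul, Real.exp_neg, ← div_eq_mul_inv, le_div_iff₀ (Real.exp_pos _)] at h3
        exact h3
      calc |z i t| * Real.exp (ε * t) / r i ≤ ((∑ k, |c k i|) + s * g i) / r i :=
            div_le_div_of_nonneg_right h4 (hr i).le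
        _ = (∑ k, |c k i|) / r i + g i / r i * s := by ring
        _ ≤ C + κ * s := add_le_add (hCi i) (mul_le_mul_of_nonneg_right (hgκ i) hs0)
    intro i t ht
    refine (hle i t ht).trans ?_
    rw [le_div_iff₀ (sub_pos.2 hκ1)]
    linarith
  have hexp : Tendsto (fun t : ℝ => C / (1 - κ) * r i * Real.exp (-(ε * t))) atTop (𝓝 0) := by
    rw [← mul_zero (C / (1 - κ) * r i)]
    refine Tendsto.const_mul _ (Real.tendsto_exp_neg_atTop_nhds_zero.comp ?_)
    exact tendsto_id.const_mul_atTop hε0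
  refine squeeze_zero_norm' ?_ hexp
  filter_upwards [eventually_ge_atTop 0] with t ht
  have h1 := (div_le_iff₀ (hr i)).1 (hκC t ht i t ⟨ht, le_rfl⟩)
  rw [Real.norm_eq_abs, Real.exp_neg, ← div_eq_mul_inv, le_div_iff₀ (Real.exp_pos _)]
  exact h1

/-- The affine particular solution of the renewal equation. -/
lemma integral_exp_mul_affine {b : ℝ} (p q t : ℝ) :
    ∫ v in (0 : ℝ)..t, Real.exp (-b * (t - v)) * (b * (p * v + q) + p) =
      p * t + q - q * Real.exp (-b * t) := by
  have hd : ∀ v, HasDerivAt (fun v => Real.exp (-b * (t - v)) * (p * v + q))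
      (Real.exp (-b * (t - v)) * (b * (p * v + q) + p)) v := by
    intro v
    have h1 : HasDerivAt (fun u => -b * (t - u)) b v := by
      simpa using ((hasDerivAt_id v).const_sub t).const_mul (-b)
    have h2 : HasDerivAt (fun u => p * u + q) p v := by
      simpa using ((hasDerivAt_id v).const_mul p).add_const q
    refine (h1.exp.mul h2).congr_deriv ?_
    ring
  rw [intervalIntegral.integral_eq_sub_of_hasDerivAt (fun v _ => hd v)
    ((by fun_prop : Continuous fun v => Real.exp (-b * (t - v)) *
      (b * (p * v + q) + p)).intervalIntegrable _ _)]
  simp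
  ring

end Decay

/-! ### Asymptotics of the cross moment -/

section Asymptotics

variable {P : Measure Ω} {ℱ : Filtration ℝ mΩ} {K : ℕ} {θ : Params K} {S : Fin 2 → Ω → Set ℝ}

/-- The mean intensity solves `E[λ] = μ + (∑ β_k⁻¹ α_k) E[λ]`. -/
lemma mean_rate_eq [IsProbabilityMeasure P] (hβ : ∀ k i, 0 < θ.β k i)
    {X : Ω → Fin K → Fin 2 → ℝ} (hint : ∀ k i, Integrable (fun ω => X ω k i) P)
    (hmean : ∀ k i, ∫ ω, X ω k i ∂P = (θ.β k i)⁻¹ * ∑ j, θ.α k i j * ∫ ω, rate θ (X ω) j ∂P)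
    (i : Fin 2) : ∫ ω, rate θ (X ω) i ∂P =
      θ.μ i + ∑ l, θ.branching i l * ∫ ω, rate θ (X ω) l ∂P := by
  have h1 : ∫ ω, rate θ (X ω) i ∂P = θ.μ i + ∑ k, ∫ ω, X ω k i ∂P := by
    unfold rate
    rw [integral_add (integrable_const _) (integrable_finsetSum _ fun k _ => hint k i),
      integral_const, probReal_univ, one_smul, integral_finsetSum _ fun k _ => hint k i]
  rw [h1]
  congr 1
  simp_rw [hmean, branching_apply hβ, Finset.mul_sum, Finset.sum_mul]
  rw [Finset.sum_comm]
  exact Finset.sum_congr rfl fun l _ => Finset.sum_congr rfl fun k _ => by ring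

/-- A function with the renewal equation of the cross moment is asymptotic to the affine solution
of that equation. -/
lemma Subcritical.tendsto_sub_affine_of_renewal (hG : Subcritical θ.branching)
    (hα : ∀ k i j, 0 ≤ θ.α k i j) (hβ : ∀ k i, 0 < θ.β k i) {Z : Fin 2 → ℝ → ℝ}
    (hbdd : ∀ i T, ∃ M, ∀ t ∈ Icc 0 T, |Z i t| ≤ M)
    (hint : ∀ i t, 0 ≤ t → IntervalIntegrable (Z i) volume 0 t)
    {a : Fin 2 → ℝ} {q : Fin K → Fin 2 → ℝ}
    (hZ : ∀ i t, 0 ≤ t → Z i t = a i * t + ∑ k, ∫ v in (0 : ℝ)..t,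
      Real.exp (-θ.β k i * (t - v)) * (q k i + ∑ l, θ.α k i l * Z l v))
    {A B : Fin 2 → ℝ} (hA : ∀ i, A i = a i + ∑ l, θ.branching i l * A l)
    (hB : ∀ i, B i = ∑ l, θ.branching i l * B l + ∑ k, (θ.β k i)⁻¹ *
      (-((θ.β k i)⁻¹ * ∑ l, θ.α k i l * A l) + q k i)) (i : Fin 2) :
    Tendsto (fun t => Z i t - (t * A i + B i)) atTop (𝓝 0) := by
  -- The k-th convolution of the affine candidate is p t + r up to an exponential: p and r are read
  -- off from βp = ∑ α A and βr = q + ∑ α B - p. The equations for A and B then say A = a + ∑ p and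
  -- B = ∑ r.
  set p : Fin K → Fin 2 → ℝ := fun k i => (θ.β k i)⁻¹ * ∑ l, θ.α k i l * A l with hp
  set r : Fin K → Fin 2 → ℝ := fun k i =>
    (θ.β k i)⁻¹ * (q k i + ∑ l, θ.α k i l * B l - p k i) with hr
  have hΓ : ∀ (y : Fin 2 → ℝ) i, ∑ l, θ.branching i l * y l =
      ∑ k, (θ.β k i)⁻¹ * ∑ l, θ.α k i l * y l := fun y i => by
    simp_rw [branching_apply hβ, Finset.mul_sum, Finset.sum_mul]
    rw [Finset.sum_comm]
    exact Finset.sum_congr rfl fun l _ => Finset.sum_congr rfl fun k _ => by ring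
  have hAp : ∀ i, A i = a i + ∑ k, p k i := fun i => by rw [hA i, hΓ]
  have hBr : ∀ i, B i = ∑ k, r k i := fun i => by
    rw [hB i, hΓ, ← Finset.sum_add_distrib]
    exact Finset.sum_congr rfl fun k _ => by simp only [hr, hp]; ring
  -- The forcing -r exp(-βt) is what remains of starting the convolution at time 0 instead of -∞.
  refine hG.tendsto_zero_of_renewal hα hβ (z := fun i t => Z i t - (t * A i + B i))
    (c := fun k i => -r k i) (fun T => ?_) (fun i t ht => ?_) i
  · choose M hM using fun i => hbdd i T
    refine ⟨∑ i, (|M i| + (|T| * |A i| + |B i|)), fun i t ht => ?_⟩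
    refine le_trans ?_ (Finset.single_le_sum (f := fun i => |M i| + (|T| * |A i| + |B i|))
      (fun i _ => by positivity) (Finset.mem_univ i))
    refine (abs_sub _ _).trans (add_le_add ((hM i t ht).trans (le_abs_self _)) ?_)
    refine (abs_add_le _ _).trans (add_le_add ?_ le_rfl)
    rw [abs_mul]
    refine mul_le_mul_of_nonneg_right ?_ (abs_nonneg _)
    rw [abs_of_nonneg ht.1]
    exact ht.2.trans (le_abs_self _)
  · have haff : ∀ k, ∫ v in (0 : ℝ)..t, Real.exp (-θ.β k i * (t - v)) *
        (q k i + ∑ l, θ.α k i l * (v * A l + B l)) =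
        p k i * t + r k i - r k i * Real.exp (-θ.β k i * t) := by
      intro k
      rw [← integral_exp_mul_affine]
      refine intervalIntegral.integral_congr fun v _ => ?_
      have hb := (hβ k i).ne'
      have h1 : θ.β k i * p k i = ∑ l, θ.α k i l * A l := by
        simp only [hp]; field_simp
      have h2 : θ.β k i * r k i = q k i + ∑ l, θ.α k i l * B l - p k i := by
        simp only [hr]; field_simp
      have h3 : ∑ l, θ.α k i l * (v * A l + B l) =
          v * ∑ l, θ.α k i l * A l + ∑ l, θ.α k i l * B l := by
        rw [Finset.mul_sum, ← Finset.sum_add_distrib]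
        exact Finset.sum_congr rfl fun l _ => by ring
      rw [h3, ← h1]
      congr 1
      linear_combination -h2
    have hI1 : ∀ k, IntervalIntegrable (fun v => Real.exp (-θ.β k i * (t - v)) *
        (q k i + ∑ l, θ.α k i l * Z l v)) volume 0 t := fun k => by
      refine IntervalIntegrable.continuousOn_mul ?_ (by fun_prop)
      refine (intervalIntegrable_const).add ?_
      rw [intervalIntegrable_iff]
      exact integrable_finsetSum _ fun l _ =>
        (intervalIntegrable_iff.1 (hint l t ht)).const_mul _
    have hI2 : ∀ k, IntervalIntegrable (fun v => Real.exp (-θ.β k i * (t - v)) *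
        (q k i + ∑ l, θ.α k i l * (v * A l + B l))) volume 0 t := fun k =>
      (by fun_prop : Continuous fun v => Real.exp (-θ.β k i * (t - v)) *
        (q k i + ∑ l, θ.α k i l * (v * A l + B l))).intervalIntegrable _ _
    have hdiff : ∀ k, ∫ v in (0 : ℝ)..t, Real.exp (-θ.β k i * (t - v)) *
        ∑ l, θ.α k i l * (Z l v - (v * A l + B l)) =
        (∫ v in (0 : ℝ)..t, Real.exp (-θ.β k i * (t - v)) * (q k i + ∑ l, θ.α k i l * Z l v)) -
        (p k i * t + r k i - r k i * Real.exp (-θ.β k i * t)) := by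
      intro k
      rw [← haff, ← intervalIntegral.integral_sub (hI1 k) (hI2 k)]
      refine intervalIntegral.integral_congr fun v _ => ?_
      simp only [mul_sub, Finset.sum_sub_distrib]
      ring
    simp_rw [hdiff]
    rw [hZ i t ht, hAp, hBr, Finset.sum_add_distrib, Finset.sum_sub_distrib,
      Finset.sum_sub_distrib, Finset.sum_add_distrib, ← Finset.sum_mul]
    simp_rw [neg_mul]
    rw [Finset.sum_neg_distrib]
    ring

end Asymptotics

end MultiKernelHawkes

end

/-! ### Stability, moments and affine asymptotics of the stationary process -/

open MultiKernelHawkes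

theorem proposition3 {Ω : Type*} [mΩ : MeasurableSpace Ω] (P : Measure Ω) [IsProbabilityMeasure P]
    (ℱ : Filtration ℝ mΩ) {K : ℕ} (θ : MultiKernelHawkes.Params K)
    (hμ : ∀ i, 0 < θ.μ i) (hα : ∀ k i j, 0 ≤ θ.α k i j) (hβ : ∀ k i, 0 < θ.β k i)
    (S : Fin 2 → Ω → Set ℝ) (hS : MultiKernelHawkes.IsHawkes θ P ℱ S)
    (hss : MultiKernelHawkes.IsSteadyState θ P S) :
    -- the inverse matrix in the formulas exists
    IsUnit (1 - θ.branching) ∧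
    -- all the moments in the formulas are finite
    (∀ t, 0 ≤ t → ∀ i j,
      Integrable (fun ω => MultiKernelHawkes.intensity θ S t ω i) P ∧
      (∀ k, Integrable (fun ω => MultiKernelHawkes.component θ S k t ω i *
        MultiKernelHawkes.intensity θ S t ω j) P) ∧
      Integrable (fun ω => MultiKernelHawkes.intensity θ S t ω i *
        MultiKernelHawkes.N S t ω j) P) ∧
    -- the formulas, with `A` and `B` computed at an arbitrary time `s`
    ∀ s, 0 ≤ s →
      (1 - θ.branching)⁻¹ * Matrix.vecMulVec θ.μ (MultiKernelHawkes.meanIntensity θ P S s) =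
        MultiKernelHawkes.slopeMat θ P S s ∧
      Tendsto (fun t : ℝ => MultiKernelHawkes.crossMoment θ P S t -
          (t • MultiKernelHawkes.slopeMat θ P S s + MultiKernelHawkes.offsetMat θ P S s))
        atTop (𝓝 0) := by
  have hX := hS.pointProcess.measurable_state (θ := θ) hα 0
  have hX0 := state_nonneg (θ := θ) (S := S) hα 0
  have hL := hS.laplaceIdentity hss hα hβ
  have hsub := hL.subcritical hμ hα hβ hX hX0
  have hint := hL.integrable hμ hα hβ hX hX0
  have hmean := hS.integral_state hss hμ hα hβ hint
  have hint2 := hL.integrable_mul hμ hα hβ hX hX0 hmean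
  have hR : ∀ j, Integrable (fun ω => rate θ (state θ S 0 ω) j) P := fun j =>
    (integrable_const _).add (integrable_finsetSum _ fun k _ => hint k j)
  have hXR : ∀ k i j, Integrable (fun ω => state θ S 0 ω k i * rate θ (state θ S 0 ω) j) P := by
    intro k i j
    simp only [rate, mul_add, Finset.mul_sum]
    exact ((hint k i).mul_const _).add (integrable_finsetSum _ fun l _ => hint2 k l i j)
  have hR2 : ∀ j, Integrable (fun ω => rate θ (state θ S 0 ω) j ^ 2) P := by
    intro j
    -- Expanding one factor as μ_j plus the components reduces the square to moments already known
    -- to be finite.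
    have h1 : ∀ ω, rate θ (state θ S 0 ω) j ^ 2 = θ.μ j * rate θ (state θ S 0 ω) j +
        ∑ k, state θ S 0 ω k j * rate θ (state θ S 0 ω) j := fun ω => by
      rw [← Finset.sum_mul, ← add_mul, sq]
      rfl
    simp only [h1]
    exact ((hR j).const_mul _).add (integrable_finsetSum _ fun k _ => hXR k j j)
  have hunit := hsub.isUnit
  have hdet := (Matrix.isUnit_iff_isUnit_det _).1 hunit
  refine ⟨hunit, fun t ht i j => ⟨?_, fun k => ?_, ?_⟩, fun s hs => ⟨?_, ?_⟩⟩
  · exact hss.integrable_comp (measurable_rate i) (hR i) ht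
  · exact hss.integrable_comp ((measurable_coord k i).mul (measurable_rate j)) (hXR k i j) ht
  · exact hS.integrable_intensity_mul_N hμ hα (hS.crossE_ne_top hss hμ hα hR hR2 i j ht)
  · have h1 : Matrix.vecMulVec θ.μ (meanIntensity θ P S s) =
        (1 - θ.branching) * slopeMat θ P S s := by
      rw [slopeMat, Matrix.mul_vecMulVec]
      congr 1
      ext i
      rw [Matrix.sub_mulVec, Matrix.one_mulVec, Pi.sub_apply, Matrix.mulVec, dotProduct]
      simp_rw [hss.meanIntensity_eq hs]
      rw [mean_rate_eq hβ hint hmean i]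
      ring
    rw [h1, Matrix.nonsing_inv_mul_cancel_left _ _ hdet]
  -- Multiplying by 1 - G puts the definition of the offset into the fixed-point form that matches
  -- the renewal equation.
  · have hBmat : offsetMat θ P S s = θ.branching * offsetMat θ P S s + ∑ k, (θ.βMat k)⁻¹ *
        (-((θ.βMat k)⁻¹ * θ.α k * slopeMat θ P S s) + componentMoment θ P S k s +
        θ.α k * Matrix.diagonal (meanIntensity θ P S s)) := by
      have h1 : (1 - θ.branching) * offsetMat θ P S s = ∑ k, (θ.βMat k)⁻¹ *
        (-((θ.βMat k)⁻¹ * θ.α k * slopeMat θ P S s) + componentMoment θ P S k s +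
        θ.α k * Matrix.diagonal (meanIntensity θ P S s)) := by
        rw [offsetMat, Matrix.mul_nonsing_inv_cancel_left _ _ hdet]
      rw [← h1, sub_mul, one_mul]
      abel
    refine tendsto_pi_nhds.2 fun i => tendsto_pi_nhds.2 fun j => ?_
    -- The column j is fixed: the renewal system couples only the rows, so each column is treated as
    -- a separate vector equation.
    have key := hsub.tendsto_sub_affine_of_renewal hα hβ
      (Z := fun i t => (crossE θ P S i j t).toReal)
      (a := fun i => θ.μ i * ∫ ω, rate θ (state θ S 0 ω) j ∂P)
      (q := fun k i => ∫ ω, state θ S 0 ω k i * rate θ (state θ S 0 ω) j ∂P +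
        θ.α k i j * ∫ ω, rate θ (state θ S 0 ω) j ∂P)
      (A := fun i => slopeMat θ P S s i j) (B := fun i => offsetMat θ P S s i j)
      (fun i T => ?_) (fun i t ht => 
        (intervalIntegrable_iff_integrableOn_Icc_of_le ht).2
          (hS.integrableOn_crossE hss hμ hα hR hR2 i j t))
      (fun i t ht => hS.crossE_toReal_eq hss hμ hα hR hR2 hXR i j ht) (fun i => ?_) (fun i => ?_) i
    · refine key.congr fun t => ?_
      rw [← hS.crossMoment_eq hμ hα t i j]
      simp [Matrix.sub_apply, Matrix.add_apply, Matrix.smul_apply]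
    · obtain ⟨M, hM⟩ := hS.crossE_toReal_locally_bounded hss hμ hα hR hR2 i j T
      exact ⟨M, fun t ht => by rw [abs_of_nonneg ENNReal.toReal_nonneg]; exact hM t ht⟩
    · simp only [slopeMat, Matrix.vecMulVec_apply, hss.meanIntensity_eq hs]
      conv_lhs => rw [mean_rate_eq hβ hint hmean i]
      rw [add_mul, Finset.sum_mul]
      simp_rw [mul_assoc]
    · conv_lhs => rw [hBmat]
      rw [Matrix.add_apply, Matrix.mul_apply, Matrix.sum_apply]
      congr 1
      refine Finset.sum_congr rfl fun k _ => ?_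
      rw [βMat_inv hβ, Matrix.diagonal_mul, Matrix.add_apply, Matrix.add_apply, Matrix.neg_apply,
        Matrix.mul_assoc, Matrix.diagonal_mul, Matrix.mul_apply, Matrix.mul_diagonal,
        hss.componentMoment_eq hs, hss.meanIntensity_eq hs, add_assoc]
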